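/- **Setting.** Let $g_{\mu\nu}$ be a smooth Lorentzian metric, signature $(-,+,+,+)$, in global coordinates $(x^0,x^1,x^2,x^3)\in\mathbb R^4$ such that everywhere $g^{00}<0$, $g^{ii}>0$ and $(g^{ij})^2<g^{ii}g^{jj}$ for spatial $i\ne j$. Put $r^2=\sum_i (x^i)^2$, $t=x^0$; all $O(\cdot)$ are as $r\to\infty$, uniformly for $t$ in bounded intervals. Assume asymptotic flatness: $$\partial^{(m)}(g_{\mu\nu}-\eta_{\mu\nu})=O(r^{-(m+1)})\quad\text{for all } m\ge 0 .$$ For $\mu\neq\nu$ let $\xi(\mu)=\eta_{\mu\mu}$, $n^\nu(\mu)=\xi(\mu)g^{\mu\nu}/\sqrt{|g^{\mu\mu}|}$, $\gamma^{\rho\sigma}(\mu)=g^{\rho\sigma}-g^{\rho\mu}g^{\mu\sigma}/g^{\mu\mu}$, let $\gamma(\mu)$, $\gamma(\mu\nu)$ be the determinants of the metrics induced on $x^\mu=$ const and on $x^\mu,x^\nu=$ const, let $K(\mu)=-\gamma^{ab}(\mu)\Gamma^\mu_{ab}/\sqrt{|g^{\mu\mu}|}$, $q(\mu\nu)=g^{\mu\nu}/\sqrt{\xi(\mu)\xi(\nu)g^{\mu\mu}g^{\nu\nu}}$,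 $\alpha(0i)=\alpha(i0)=\operatorname{arcsinh}q(0i)$, $\alpha(ij)=\arcsin q(ij)$. The trace $K$ and gamma-gamma Lagrangians are $$\mathcal L_K=\sqrt{|g|}R+2\,\partial_\mu\big(\sqrt{|\gamma(\mu)|}K(\mu)\big)-\sum_{\mu\ne\nu}\partial_\mu\partial_\nu\big(\sqrt{|\gamma(\mu\nu)|}\,\alpha(\mu\nu)\big),$$ $$\mathcal L_\Gamma=\sqrt{|g|}\,g^{\mu\nu}\big(\Gamma^\rho_{\mu\sigma}\Gamma^\sigma_{\rho\nu}-\Gamma^\rho_{\mu\nu}\Gamma^\sigma_{\rho\sigma}\big).$$ For a Lagrangian $\mathcal L(\phi,\phi_\mu,\phi_{\mu\nu})$ write $\frac{\delta S}{\delta\phi}=\frac{\partial\mathcal L}{\partial\phi}-\partial_\mu\frac{\partial\mathcal L}{\partial\phi_\mu}+\partial_\nu\partial_\mu\frac{\partial\mathcal L}{\partial\phi_{\mu\nu}}$, $\frac{\delta S}{\delta\dot\phi}=\frac{\partial\mathcal L}{\partial\phi_0}-\partial_\nu\big(\frac{\partial\mathcal L}{\partial\phi_{0\nu}}+\frac{\partial\mathcal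 L}{\partial\phi_{\nu0}}\big)$, $\frac{\delta S}{\delta\dot\phi_i}=\frac{\partial\mathcal L}{\partial\phi_{0i}}+\frac{\partial\mathcal L}{\partial\phi_{i0}}$. If $\delta_D\mathcal L=\partial_\mu F^\mu$, the Noether charge at time $t$ in the ball $B_r=\{\sum_i (x^i)^2<r^2\}$ is $$Q_r(t)=\int_{B_r}d^3x\,\Big(F^0-\frac{\delta S}{\delta\dot\phi}\,\delta_D\phi\Big)-\int_{\partial B_r}d\sigma_i\,\frac{\delta S}{\delta\dot\phi_i}\,\delta_D\phi .$$ *On shell* means that the Euler–Lagrange equations $\delta S_K/\delta g_{\mu\nu}=0$ of $\mathcal L_K$ hold. *$Q$ is conserved* means: for every $r>0$, $Q_r(t)$ is differentiable in $t$; as $r\to\infty$, $\frac{d}{dt}Q_r(t)\to0$ for each $t$ and $Q_r(t_1)-Q_r(t_0)\to0$ for all $t_0,t_1$; and if $\lim_{r\to\infty}Q_r(t)$ exists at one time, it exists at all times and has the same value. **Theorem.** 1. $\displaystyle \mathcal L_K=\mathcal L_\Gamma+\partial_\mu\Big(-\sum_{\nu\neq\mu}\alpha(\mu\nu)\partial_\nu\sqrt{|\gamma(\mu\nu)|}+N^\mu\Big)$,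 where $N^\mu=\sqrt{|g|}\sum_{\nu,\sigma}\big(\xi(\mu)n^\sigma(\mu)n^\nu(\mu)\Gamma^\mu_{\nu\sigma}-\xi(\nu)n^\sigma(\nu)n^\mu(\nu)\Gamma^\nu_{\nu\sigma}\big)$. 2. Let $\epsilon^\mu$ be a smooth vector field that is asymptotically Poincaré: for some constants $a^\mu$, $\omega^\mu{}_\nu$ with $\eta_{\rho\mu}\omega^\mu{}_\nu+\eta_{\nu\mu}\omega^\mu{}_\rho=0$, $$\epsilon^\mu=\omega^\mu{}_\nu x^\nu+a^\mu+O(r^{-1}),\qquad \partial_\nu\epsilon^\mu=\omega^\mu{}_\nu+O(r^{-2}),$$ and for every $m\ge2$ there is $\alpha>0$ with $\partial^{(m)}\epsilon^\mu=O(r^{-(m+\alpha)})$. Let $\delta_Dg_{\mu\nu}=\epsilon^\rho\partial_\rho g_{\mu\nu}+g_{\mu\rho}\partial_\nu\epsilon^\rho+g_{\rho\nu}\partial_\mu\epsilon^\rho$ and $$F^\mu=\epsilon^\mu\mathcal L_\Gamma-\sqrt{|g|}g^{\nu\sigma}\partial_\nu\partial_\sigma\epsilon^\mu+\sqrt{|g|}g^{\mu\sigma}\partial_\nu\partial_\sigma\epsilon^\nu-\delta_D\Big(\sum_{\nu\ne\mu}\alpha(\mu\nu)\partial_\nu\sqrt{|\gamma(\mu\nu)|}\Big)+\delta_DN^\mu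 .$$ Then $\delta_D\mathcal L_K=\partial_\mu F^\mu$; for every $t$, $\lim_{r\to\infty}\int_{\partial B_r}d\sigma_i\,F^i=0$; and, on shell, the Noether charge $Q$ of $\mathcal L_K$, $\delta_D$ and $F^\mu$ is conserved. 3. In particular, for a space translation (constant $\epsilon^\mu=a^\mu$ with $a^0=0$) one may also take $F^\mu=a^\mu\mathcal L_K$: $\delta_D\mathcal L_K=\partial_\mu F^\mu$; for every $t$, $\lim_{r\to\infty}\int_{\partial B_r}d\sigma_i\,F^i=0$; and, on shell, the corresponding charge is conserved and the limit $\lim_{r\to\infty}Q_r(t)$ exists, is finite and does not depend on $t$ (the conserved momentum). -/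

import Mathlib

open Filter Topology MeasureTheory
open scoped ContDiff

namespace TraceK

noncomputable section

/-! ### Coordinates, partial derivatives and jets -/

/-- Spacetime with its global coordinates `(x⁰, x¹, x², x³)`. -/
abbrev Spacetime := Fin 4 → ℝ

/-- Arrays `u μ ν` of components of a two-index tensor. -/
abbrev Tensor2 := Fin 4 → Fin 4 → ℝ

/-- Values of `(φ, ∂_μ φ)`. -/
abbrev Jet1 (E : Type) := E × (Fin 4 → E)

/-- Values of `(φ, ∂_μ φ, ∂_μ ∂_ν φ)`. -/
abbrev Jet2 (E : Type) := E × (Fin 4 → E) × (Fin 4 → Fin 4 → E)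

/-- The partial derivative `∂_μ f`. -/
def pd {E : Type} [NormedAddCommGroup E] [NormedSpace ℝ E]
    (μ : Fin 4) (f : Spacetime → E) (x : Spacetime) : E :=
  fderiv ℝ f x (Pi.single μ 1)

/-- The first jet of a field. -/
def jet1 {E : Type} [NormedAddCommGroup E] [NormedSpace ℝ E]
    (φ : Spacetime → E) (x : Spacetime) : Jet1 E :=
  (φ x, fun μ => pd μ φ x)

/-- The second jet of a field. -/
def jet2 {E : Type} [NormedAddCommGroup E] [NormedSpace ℝ E]
    (φ : Spacetime → E) (x : Spacetime) : Jet2 E :=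
  (φ x, fun μ => pd μ φ x, fun μ ν => pd μ (pd ν φ) x)

/-- Total derivative: `∂_μ (f(φ))` as a function of `(φ, ∂φ)`. -/
def totalDeriv0 {E : Type} [NormedAddCommGroup E] [NormedSpace ℝ E]
    (μ : Fin 4) (f : E → ℝ) (j : Jet1 E) : ℝ :=
  fderiv ℝ f j.1 (j.2 μ)

/-- Total derivative: `∂_μ (f(φ, ∂φ))` as a function of `(φ, ∂φ, ∂∂φ)`. -/
def totalDeriv1 {E : Type} [NormedAddCommGroup E] [NormedSpace ℝ E]
    (μ : Fin 4) (f : Jet1 E → ℝ) (j : Jet2 E) : ℝ :=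
  fderiv ℝ f (j.1, j.2.1) (j.2.1 μ, j.2.2 μ)

/-- The variation `δX` of a function `X(φ, ∂φ)` induced by a variation `δφ` of the field. -/
def variation1 {E : Type} [NormedAddCommGroup E] [NormedSpace ℝ E]
    (X : Jet1 E → ℝ) (φ δφ : Spacetime → E) (x : Spacetime) : ℝ :=
  fderiv ℝ X (jet1 φ x) (jet1 δφ x)

/-- The variation `δL` of a Lagrangian `L(φ, ∂φ, ∂∂φ)` induced by a variation `δφ`. -/
def variation2 {E : Type} [NormedAddCommGroup E] [NormedSpace ℝ E]
    (L : Jet2 E → ℝ) (φ δφ : Spacetime → E) (x : Spacetime) : ℝ :=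
  fderiv ℝ L (jet2 φ x) (jet2 δφ x)

/-! ### Second order Lagrangians: functional derivatives

All of these are linear functionals of a constant field value `e : E`. Second derivatives
`φ_{μν}` and `φ_{νμ}` are varied independently. -/

/-- `(∂L/∂φ) e` along the field `φ`. -/
def partialL0 {E : Type} [NormedAddCommGroup E] [NormedSpace ℝ E]
    (L : Jet2 E → ℝ) (φ : Spacetime → E) (e : E) (x : Spacetime) : ℝ :=
  fderiv ℝ L (jet2 φ x) (e, 0, 0)

/-- `(∂L/∂φ_μ) e` along the field `φ`. -/
def partialL1 {E : Type} [NormedAddCommGroup E] [NormedSpace ℝ E]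
    (L : Jet2 E → ℝ) (φ : Spacetime → E) (μ : Fin 4) (e : E) (x : Spacetime) : ℝ :=
  fderiv ℝ L (jet2 φ x) (0, Pi.single μ e, 0)

/-- `(∂L/∂φ_{μν}) e`, which is also `(δS/δφ_{μν}) e`, along the field `φ`. -/
def partialL2 {E : Type} [NormedAddCommGroup E] [NormedSpace ℝ E]
    (L : Jet2 E → ℝ) (φ : Spacetime → E) (μ ν : Fin 4) (e : E) (x : Spacetime) : ℝ :=
  fderiv ℝ L (jet2 φ x) (0, 0, Pi.single μ (Pi.single ν e))

/-- The Euler-Lagrange derivative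
`(δS/δφ) e = (∂L/∂φ - ∂_μ(∂L/∂φ_μ) + ∂_ν∂_μ(∂L/∂φ_{μν})) e`. -/
def eulerLagrange {E : Type} [NormedAddCommGroup E] [NormedSpace ℝ E]
    (L : Jet2 E → ℝ) (φ : Spacetime → E) (e : E) (x : Spacetime) : ℝ :=
  partialL0 L φ e x - ∑ μ, pd μ (partialL1 L φ μ e) x
    + ∑ μ, ∑ ν, pd ν (pd μ (partialL2 L φ μ ν e)) x

/-- `(δS/δφ_μ) e = (∂L/∂φ_μ - ∂_ν(∂L/∂φ_{μν} + ∂L/∂φ_{νμ})) e`. -/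
def momentum1 {E : Type} [NormedAddCommGroup E] [NormedSpace ℝ E]
    (L : Jet2 E → ℝ) (φ : Spacetime → E) (μ : Fin 4) (e : E) (x : Spacetime) : ℝ :=
  partialL1 L φ μ e x
    - ∑ ν, pd ν (fun y => partialL2 L φ μ ν e y + partialL2 L φ ν μ e y) x

/-! ### Space integrals and Noether charges -/

/-- The spacetime point with time `t` and space coordinates `y`. -/
def pt (t : ℝ) (y : EuclideanSpace ℝ (Fin 3)) : Spacetime := Fin.cons t (fun i => y i)

/-- The flux `∫ dσ_i V^i` at time `t` through the sphere of radius `r` about the origin. -/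
def flux (V : Spacetime → Fin 3 → ℝ) (r t : ℝ) : ℝ :=
  ∫ n : Metric.sphere (0 : EuclideanSpace ℝ (Fin 3)) 1,
    r ^ 2 * ∑ i, V (pt t (r • (n : EuclideanSpace ℝ (Fin 3)))) i
      * (n : EuclideanSpace ℝ (Fin 3)) i
    ∂((volume : Measure (EuclideanSpace ℝ (Fin 3))).toSphere)

/-- The space components `F^i` of a current `F^μ`. -/
def spatial (F : Spacetime → Fin 4 → ℝ) (x : Spacetime) (i : Fin 3) : ℝ := F x i.succ

/-- The Noether charge in the ball of radius `r` at time `t`: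
`∫ d³x (F⁰ - (δS/δφ̇) δφ) - ∫ dσ_i (δS/δφ̇_i) δφ`,
with `δS/δφ̇_i = δS/δφ_{0i} + δS/δφ_{i0}`. -/
def noetherCharge {E : Type} [NormedAddCommGroup E] [NormedSpace ℝ E]
    (L : Jet2 E → ℝ) (φ δφ : Spacetime → E) (F : Spacetime → Fin 4 → ℝ) (r t : ℝ) : ℝ :=
  (∫ y in Metric.ball (0 : EuclideanSpace ℝ (Fin 3)) r,
      (F (pt t y) 0 - momentum1 L φ 0 (δφ (pt t y)) (pt t y)))
    - flux (fun x i => partialL2 L φ 0 i.succ (δφ x) x + partialL2 L φ i.succ 0 (δφ x) x) r t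

/-- Conservation of a charge `Q r t`, computed at time `t` in the ball of radius `r`, in the
limit of infinite radius. The limit of `Q r t` itself need not exist; if it exists at one
time then it exists at all times and does not change. -/
def ConservedAtInfinity (Q : ℝ → ℝ → ℝ) : Prop :=
  (∀ r, 0 < r → Differentiable ℝ (Q r)) ∧
  (∀ t, Tendsto (fun r => deriv (Q r) t) atTop (𝓝 0)) ∧
  (∀ t₀ t₁, Tendsto (fun r => Q r t₁ - Q r t₀) atTop (𝓝 0)) ∧
  (∀ t₀ q, Tendsto (fun r => Q r t₀) atTop (𝓝 q) →
    ∀ t, Tendsto (fun r => Q r t) atTop (𝓝 q))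

/-! ### Algebra of the metric -/

/-- The signs `ξ(μ) = η_{μμ}` for the signature `(-,+,+,+)`. -/
def xi (μ : Fin 4) : ℝ := if μ = 0 then -1 else 1

/-- The Minkowski metric `η_{μν}`. -/
def eta : Tensor2 := fun μ ν => if μ = ν then xi μ else 0

/-- The inverse metric `g^{μν}`. -/
def inv (u : Tensor2) (μ ν : Fin 4) : ℝ := (Matrix.of u)⁻¹ μ ν

/-- `√|g|`. -/
def sqrtDet (u : Tensor2) : ℝ := √|(Matrix.of u).det|

/-- `√|γ(μ)|`, with `γ(μ)` the determinant of the metric of the surface `x^μ = constant`. -/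
def sqrtGamma1 (μ : Fin 4) (u : Tensor2) : ℝ :=
  √|((Matrix.of u).submatrix (Subtype.val : {a : Fin 4 // a ≠ μ} → Fin 4) Subtype.val).det|

/-- `√|γ(μν)|`, with `γ(μν)` the determinant of the metric of the two-surface
`x^μ = constant, x^ν = constant` (for `μ ≠ ν`). -/
def sqrtGamma2 (μ ν : Fin 4) (u : Tensor2) : ℝ :=
  √|((Matrix.of u).submatrix
      (Subtype.val : {a : Fin 4 // a ≠ μ ∧ a ≠ ν} → Fin 4) Subtype.val).det|

/-- `γ^{ρσ}(μ) = g^{ρσ} - g^{ρμ} g^{μσ} / g^{μμ}`; it vanishes when `ρ = μ` or `σ = μ`. -/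
def gammaInv (μ : Fin 4) (u : Tensor2) (ρ σ : Fin 4) : ℝ :=
  inv u ρ σ - inv u ρ μ * inv u μ σ / inv u μ μ

/-- The components `n^ν(μ) = ξ(μ) g^{μν} / √|g^{μμ}|` of the unit normal to
`x^μ = constant`. -/
def normal (μ : Fin 4) (u : Tensor2) (ν : Fin 4) : ℝ :=
  xi μ * inv u μ ν / √|inv u μ μ|

/-- `q(μν) = g^{μν} / √(ξ(μ) ξ(ν) g^{μμ} g^{νν})`. -/
def qProd (μ ν : Fin 4) (u : Tensor2) : ℝ :=
  inv u μ ν / √(xi μ * xi ν * inv u μ μ * inv u ν ν)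

/-- The angles `α(0i) = arcsinh q(0i)` and `α(ij) = arcsin q(ij)`. -/
def angle (μ ν : Fin 4) (u : Tensor2) : ℝ :=
  if μ = 0 ∨ ν = 0 then Real.arsinh (qProd μ ν u) else Real.arcsin (qProd μ ν u)

/-! ### Connection, curvature and Lagrangians, as functions of jets of the metric -/

/-- The Christoffel symbols `Γ^ρ_{μν}`. -/
def christoffel (ρ μ ν : Fin 4) (j : Jet1 Tensor2) : ℝ :=
  (1 / 2) * ∑ σ, inv j.1 ρ σ * (j.2 μ σ ν + j.2 ν σ μ - j.2 σ μ ν)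

/-- The Ricci tensor `R_{μν}`. -/
def ricci (μ ν : Fin 4) (j : Jet2 Tensor2) : ℝ :=
  ∑ ρ, (totalDeriv1 ρ (christoffel ρ μ ν) j - totalDeriv1 ν (christoffel ρ ρ μ) j
    + ∑ l, (christoffel ρ ρ l (j.1, j.2.1) * christoffel l μ ν (j.1, j.2.1)
      - christoffel ρ ν l (j.1, j.2.1) * christoffel l ρ μ (j.1, j.2.1)))

/-- The Einstein-Hilbert Lagrangian `√|g| R`. -/
def lagEH (j : Jet2 Tensor2) : ℝ :=
  sqrtDet j.1 * ∑ μ, ∑ ν, inv j.1 μ ν * ricci μ ν j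

/-- The gamma-gamma Lagrangian
`√|g| g^{μν} (Γ^ρ_{μσ} Γ^σ_{ρν} - Γ^ρ_{μν} Γ^σ_{ρσ})`. -/
def lagGamma (j : Jet1 Tensor2) : ℝ :=
  sqrtDet j.1 * ∑ μ, ∑ ν, inv j.1 μ ν *
    ∑ ρ, ∑ σ, (christoffel ρ μ σ j * christoffel σ ρ ν j
      - christoffel ρ μ ν j * christoffel σ ρ σ j)

/-- The extrinsic curvature `K_{ab}(μ) = -Γ^μ_{ab} / √|g^{μμ}|` of `x^μ = constant`. -/
def extrinsic (μ a b : Fin 4) (j : Jet1 Tensor2) : ℝ :=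
  -(1 / √|inv j.1 μ μ|) * christoffel μ a b j

/-- The trace `K(μ) = γ^{ab}(μ) K_{ab}(μ)`. -/
def traceK (μ : Fin 4) (j : Jet1 Tensor2) : ℝ :=
  ∑ a, ∑ b, gammaInv μ j.1 a b * extrinsic μ a b j

/-- The trace K Lagrangian
`√|g| R + 2 ∂_μ(√|γ(μ)| K(μ)) - ∂_μ∂_ν(√|γ(μν)| α(μν))`, the last sum over `μ ≠ ν`. -/
def lagK (j : Jet2 Tensor2) : ℝ :=
  lagEH j
    + 2 * ∑ μ, totalDeriv1 μ (fun k => sqrtGamma1 μ k.1 * traceK μ k) j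
    - ∑ μ, ∑ ν ∈ Finset.univ.erase μ,
        totalDeriv1 μ (totalDeriv0 ν (fun u => sqrtGamma2 μ ν u * angle μ ν u)) j

/-- `α(μν) ∂_ν √|γ(μν)|`, summed over `ν ≠ μ`. -/
def angleTerm (μ : Fin 4) (j : Jet1 Tensor2) : ℝ :=
  ∑ ν ∈ Finset.univ.erase μ, angle μ ν j.1 * totalDeriv0 ν (sqrtGamma2 μ ν) j

/-- `√|g| (ξ(μ) n^σ(μ) n^ν(μ) Γ^μ_{νσ} - ξ(ν) n^σ(ν) n^μ(ν) Γ^ν_{νσ})`, summed over `ν`, `σ`. -/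
def normalTerm (μ : Fin 4) (j : Jet1 Tensor2) : ℝ :=
  sqrtDet j.1 * ∑ ν, ∑ σ,
    (xi μ * normal μ j.1 σ * normal μ j.1 ν * christoffel μ ν σ j
      - xi ν * normal ν j.1 σ * normal ν j.1 μ * christoffel ν ν σ j)

/-! ### Diffeomorphisms and the associated `F^μ` -/

/-- `δ_D g_{μν} = ε^ρ ∂_ρ g_{μν} + g_{μρ} ∂_ν ε^ρ + g_{ρν} ∂_μ ε^ρ`. -/
def deltaD (ε : Spacetime → Fin 4 → ℝ) (g : Spacetime → Tensor2) (x : Spacetime) : Tensor2 :=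
  fun μ ν => ∑ ρ, (ε x ρ * pd ρ g x μ ν + g x μ ρ * pd ν ε x ρ + g x ρ ν * pd μ ε x ρ)

/-- `F^μ = ε^μ L_Γ - √|g| g^{νσ} ∂_ν∂_σ ε^μ + √|g| g^{μσ} ∂_ν∂_σ ε^ν`
`- δ_D(α(μν) ∂_ν √|γ(μν)|)`
`+ δ_D(√|g| (ξ(μ) n^σ(μ) n^ν(μ) Γ^μ_{νσ} - ξ(ν) n^σ(ν) n^μ(ν) Γ^ν_{νσ}))`. -/
def noetherF (ε : Spacetime → Fin 4 → ℝ) (g : Spacetime → Tensor2) (x : Spacetime)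
    (μ : Fin 4) : ℝ :=
  ε x μ * lagGamma (jet1 g x)
    - ∑ ν, ∑ σ, sqrtDet (g x) * inv (g x) ν σ * pd ν (pd σ ε) x μ
    + ∑ ν, ∑ σ, sqrtDet (g x) * inv (g x) μ σ * pd ν (pd σ ε) x ν
    - variation1 (angleTerm μ) g (deltaD ε g) x
    + variation1 (normalTerm μ) g (deltaD ε g) x

/-! ### Admissible metrics and behaviour at space infinity -/

/-- Smooth Lorentzian metrics in coordinates adapted to a 3+1 decomposition: the surfaces
`x⁰ = constant` are spacelike, the surfaces `x^i = constant` and the two-surfaces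
`x^i = constant, x^j = constant` are timelike. The last condition says `|q(ij)| < 1`, so that
the angles `α(ij)` are well defined. -/
structure IsAdmissibleMetric (g : Spacetime → Tensor2) : Prop where
  smooth : ContDiff ℝ ∞ g
  symm : ∀ x μ ν, g x μ ν = g x ν μ
  lorentzian : ∀ x, ∃ A : Matrix (Fin 4) (Fin 4) ℝ, IsUnit A.det ∧
    A.transpose * Matrix.of (g x) * A = Matrix.of eta
  inv_time : ∀ x, inv (g x) 0 0 < 0
  inv_space : ∀ x (i : Fin 3), 0 < inv (g x) i.succ i.succ
  inv_minor : ∀ x (i j : Fin 3), i ≠ j →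
    (inv (g x) i.succ j.succ) ^ 2 < inv (g x) i.succ i.succ * inv (g x) j.succ j.succ

/-- The radius `r = √((x¹)² + (x²)² + (x³)²)`. -/
def radius (x : Spacetime) : ℝ := √(∑ i : Fin 3, x i.succ ^ 2)

/-- `f = O(1/r^p)` as `r → ∞`, for finite times: uniformly on bounded time intervals. -/
def DecaysLike {V : Type} [NormedAddCommGroup V] (f : Spacetime → V) (p : ℝ) : Prop :=
  ∀ T : ℝ, ∃ C R : ℝ, 0 < R ∧ ∀ x : Spacetime, |x 0| ≤ T → R ≤ radius x →
    ‖f x‖ ≤ C / radius x ^ p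

/-- `∂^{(m)}(g_{μν} - η_{μν}) = O(1/r^{m+1})` for all `m ≥ 0`. -/
def IsAsymptoticallyFlat (g : Spacetime → Tensor2) : Prop :=
  ∀ m : ℕ, DecaysLike (iteratedFDeriv ℝ m (fun x => g x - eta)) (m + 1)

/-- The affine vector field `w^μ_ν x^ν + a^μ`. -/
def affineField (w : Fin 4 → Fin 4 → ℝ) (a : Fin 4 → ℝ) (x : Spacetime) : Fin 4 → ℝ :=
  fun μ => ∑ ν, w μ ν * x ν + a μ

/-- Infinitesimal diffeomorphisms that are asymptotically Poincaré:
`ε^μ = w^μ_ν x^ν + a^μ + O(1/r)`, `∂_ν ε^μ = w^μ_ν + O(1/r²)` with `w` an infinitesimal Lorentz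
transformation, and `∂^{(m)} ε^μ = O(1/r^{m+α})` with some `α > 0` for every `m ≥ 2`. -/
structure IsAsymptoticallyPoincare (ε : Spacetime → Fin 4 → ℝ) : Prop where
  smooth : ContDiff ℝ ∞ ε
  lowOrder : ∃ (w : Fin 4 → Fin 4 → ℝ) (a : Fin 4 → ℝ),
    (∀ ρ ν, ∑ μ, (eta ρ μ * w μ ν + eta ν μ * w μ ρ) = 0) ∧
    DecaysLike (fun x => ε x - affineField w a x) 1 ∧
    DecaysLike (fderiv ℝ (fun x => ε x - affineField w a x)) 2
  highOrder : ∀ m : ℕ, 2 ≤ m → ∃ α : ℝ, 0 < α ∧ DecaysLike (iteratedFDeriv ℝ m ε) (m + α)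

/-- On shell: the Euler-Lagrange equations of a Lagrangian for the (symmetric) metric hold. -/
def OnShell (L : Jet2 Tensor2 → ℝ) (g : Spacetime → Tensor2) : Prop :=
  ∀ x (h : Tensor2), (∀ μ ν, h μ ν = h ν μ) → eulerLagrange L g h x = 0

end

end TraceK

open TraceK

/-!
The proof separates the algebra of jets from the asymptotics.

**Jets.** All Lagrangians are functions of jets of the metric, but the identities between them hold
only for symmetric jets. Since `fderiv f j v` depends only on `f` along the line `j + s • v`,
identities between functions of symmetric jets may be differentiated in symmetric directions
(`Adm.fderiv_congr_symJet1`, `Adm.fderiv_congr_symJet2`), and this is how every variation is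
computed.

**The boundary terms.** The Einstein-Hilbert Lagrangian is the gamma-gamma Lagrangian plus the
divergence of `√|g| (g^{ρσ} Γ^μ_{ρσ} - g^{μρ} Γ^σ_{σρ})` (`Adm.lagEH_eq`). Adding
`2 √|γ(μ)| K(μ) - ∂_ν(√|γ(μν)| α(μν))` to this current leaves `-α(μν) ∂_ν√|γ(μν)| + N^μ`
(`Adm.boundary_eq`). The reason is that in `√|γ(μν)| ∂_ν α(μν)` the area element cancels the root in
the derivative of the angle, because complementary minors of the metric and of its inverse agree up
to `det g`; what remains is `√|g|` times a rational expression in the inverse metric and its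
derivatives (`Adm.sqrtGamma2_mul_fderiv_angle`).

The resulting current has the form `C^{μν}(g) ∂_ν g` with `C^{μμ} = 0` and `C = 0` at the Minkowski
metric (`Adm.boundaryCurrent_eq`, `currentCoeff_eta`). On symmetric jets the trace K Lagrangian is
therefore linear in second derivatives, with coefficient `C^{μν}`
(`Adm.lagK_eq_reducedLag`). The vanishing of `C^{00}` removes the second time derivative, and the
vanishing of `C` at the Minkowski metric gives the fall-off that the conservation law needs.

**Diffeomorphisms.** The jet of `δ_D g` is the sum of a transport term, a linear action of `∂ε`, and
a term in `∂∂ε` (`jet1_deltaD`). In the gamma-gamma Lagrangian the first two produce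
`∂_μ(ε^μ L_Γ)`. The last one shifts `Γ^ρ_{μν}` by `∂_μ∂_ν ε^ρ`, and its contribution is the divergence
of the remaining terms of `gammaCurrent` because third derivatives of `ε` cancel
(`variation1_lagGamma_deltaD`). Variation and total derivative commute, which takes care of the
boundary terms (`variation2_lagK_deltaD`).

**Conservation.** Writing `M^μ` for the momenta and `S^{μν}` for the symmetrized coefficients of the
second derivatives, on shell
`∂_μ F^μ = ∂_μ(M^μ δφ) + ∂_μ∂_ν(S^{μν} δφ)` (`variation2_eq_eulerLagrange_add`). As `S^{00} = 0`, the
divergence theorem on the ball turns the time derivative of the charge into the flux of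
`-F^i + M^i δφ + ∂_j(S^{ij} δφ)` (`hasDerivAt_noetherCharge`). By asymptotic flatness `M = O(r⁻²)`,
`S = O(r⁻¹)` and `δ_D g = O(r⁻¹)`, where the last estimate uses that `ω` preserves the Minkowski
metric, and `F^i` falls off faster than `r⁻²`. So the flux vanishes in the limit of large radius
(`conservedAtInfinity_noetherCharge`). For a space translation `δ_D g = O(r⁻²)` and `F⁰ = 0`; the
charge density is `O(r⁻⁴)`, hence integrable.

The divergence theorem for balls (`setIntegral_ball_spaceDiv`) is obtained by testing with radial
cutoffs in polar coordinates.
-/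

namespace TraceK

noncomputable section

/-! ### Admissible metrics at a point -/

/-- Algebraic admissibility of the components `u` of a metric at a point: symmetry,
nondegeneracy, and the sign conditions on the inverse metric. -/
structure Adm (u : Tensor2) : Prop where
  symm : ∀ μ ν, u μ ν = u ν μ
  det_ne : (Matrix.of u).det ≠ 0
  time : inv u 0 0 < 0
  space : ∀ i : Fin 3, 0 < inv u i.succ i.succ
  minor : ∀ i j : Fin 3, i ≠ j →
    (inv u i.succ j.succ) ^ 2 < inv u i.succ i.succ * inv u j.succ j.succ

theorem of_eta : Matrix.of eta = Matrix.diagonal xi := by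
  ext i j; simp [eta, Matrix.diagonal_apply]

theorem IsAdmissibleMetric.adm {g : Spacetime → Tensor2} (hg : IsAdmissibleMetric g)
    (x : Spacetime) : Adm (g x) where
  symm := hg.symm x
  det_ne := by
    obtain ⟨A, -, h⟩ := hg.lorentzian x
    intro h0
    have h1 := congrArg Matrix.det h
    rw [Matrix.det_mul, Matrix.det_mul, h0] at h1
    rw [of_eta, Matrix.det_diagonal, Fin.prod_univ_four] at h1
    simp [xi, Fin.reduceEq] at h1
  time := hg.inv_time x
  space := hg.inv_space x
  minor := hg.inv_minor x

/-! ### Determinants and minors -/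

theorem sum_mul_inv {u : Tensor2} (h : (Matrix.of u).det ≠ 0) (μ ν : Fin 4) :
    ∑ a, u μ a * inv u a ν = if μ = ν then 1 else 0 := by
  have := congrFun (congrFun (Matrix.mul_nonsing_inv (Matrix.of u) (Ne.isUnit h)) μ) ν
  rw [Matrix.mul_apply, Matrix.one_apply] at this
  exact this

theorem sum_inv_mul {u : Tensor2} (h : (Matrix.of u).det ≠ 0) (μ ν : Fin 4) :
    ∑ a, inv u μ a * u a ν = if μ = ν then 1 else 0 := by
  have := congrFun (congrFun (Matrix.nonsing_inv_mul (Matrix.of u) (Ne.isUnit h)) μ) ν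
  rw [Matrix.mul_apply, Matrix.one_apply] at this
  exact this

theorem inv_symm {u : Tensor2} (h : ∀ μ ν, u μ ν = u ν μ) (μ ν : Fin 4) :
    inv u μ ν = inv u ν μ := by
  have h1 : (Matrix.of u).transpose = Matrix.of u := by ext i j; exact h j i
  have h2 := Matrix.transpose_nonsing_inv (Matrix.of u)
  rw [h1] at h2
  exact (congrFun (congrFun h2 ν) μ)

/-- Complementary minors of a matrix and of its inverse, up to the sign of the determinants:
the minor of `M` on the indices satisfying `p` is `det M` times the minor of `M⁻¹` on the
other indices. -/
theorem det_mul_det_inv_toSquareBlockProp {n : Type*} [Fintype n] [DecidableEq n]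
    (M : Matrix n n ℝ) (hM : M.det ≠ 0) (p : n → Prop) [DecidablePred p] :
    M.det * (M⁻¹.toSquareBlockProp fun i => ¬p i).det = (M.toSquareBlockProp p).det := by
  let N : Matrix n n ℝ := Matrix.of fun i j => if p j then (1 : Matrix n n ℝ) i j else M⁻¹ i j
  have hMN : ∀ i j, (M * N) i j = if p j then M i j else (1 : Matrix n n ℝ) i j := by
    intro i j
    by_cases hj : p j
    · have : (M * N) i j = (M * (1 : Matrix n n ℝ)) i j := by
        simp only [Matrix.mul_apply, N, Matrix.of_apply, hj, if_true]
      rw [this, Matrix.mul_one, if_pos hj]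
    · have : (M * N) i j = (M * M⁻¹) i j := by
        simp only [Matrix.mul_apply, N, Matrix.of_apply, hj, if_false]
      rw [this, Matrix.mul_nonsing_inv M (Ne.isUnit hM), if_neg hj]
  have hN : N.det = (M⁻¹.toSquareBlockProp fun i => ¬p i).det := by
    rw [Matrix.twoBlockTriangular_det N p]
    · have h1 : N.toSquareBlockProp p = 1 := by
        ext i j
        simp [Matrix.toSquareBlockProp_def, N, j.2, Matrix.one_apply, Subtype.ext_iff]
      have h2 : (N.toSquareBlockProp fun i => ¬p i) = M⁻¹.toSquareBlockProp fun i => ¬p i := by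
        ext i j
        simp [Matrix.toSquareBlockProp_def, N, j.2]
      rw [h1, h2, Matrix.det_one, one_mul]
    · intro i hi j hj
      have : i ≠ j := by rintro rfl; exact hi hj
      simp [N, hj, Matrix.one_apply, this]
  have hMN' : (M * N).det = (M.toSquareBlockProp p).det := by
    rw [Matrix.twoBlockTriangular_det' (M * N) p]
    · have h1 : ((M * N).toSquareBlockProp fun i => ¬p i) = 1 := by
        ext i j
        simp [Matrix.toSquareBlockProp_def, hMN, j.2, Matrix.one_apply, Subtype.ext_iff]
      have h2 : (M * N).toSquareBlockProp p = M.toSquareBlockProp p := by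
        ext i j
        simp [Matrix.toSquareBlockProp_def, hMN, j.2]
      rw [h1, h2, Matrix.det_one, mul_one]
    · intro i hi j hj
      have : i ≠ j := by rintro rfl; exact hj hi
      simp [hMN, hj, this]
  rw [← hN, ← hMN', Matrix.det_mul]

/-- The complementary minor of the metric of a coordinate surface is an entry of the inverse metric. -/
theorem sqrtGamma1_eq {u : Tensor2} (h : (Matrix.of u).det ≠ 0) (μ : Fin 4) :
    sqrtGamma1 μ u = sqrtDet u * √|inv u μ μ| := by
  have h1 := det_mul_det_inv_toSquareBlockProp (Matrix.of u) h (fun a => a ≠ μ)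
  have h2 : ((Matrix.of u)⁻¹.toSquareBlockProp fun i => ¬ i ≠ μ).det = inv u μ μ := by
    let e : Fin 1 ≃ {a : Fin 4 // ¬ a ≠ μ} :=
      { toFun := fun _ => ⟨μ, by simp⟩
        invFun := fun _ => 0
        left_inv := fun _ => Subsingleton.elim _ _
        right_inv := fun a => Subtype.ext (not_not.mp a.2).symm }
    rw [← Matrix.det_submatrix_equiv_self e, Matrix.det_fin_one]; rfl
  rw [h2] at h1
  rw [sqrtDet, ← Real.sqrt_mul (abs_nonneg _), ← abs_mul, h1]
  rfl

/-- The complementary minor of the metric of a coordinate two-surface is a two-by-two minor of the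
inverse metric. -/
theorem sqrtGamma2_eq {u : Tensor2} (h : (Matrix.of u).det ≠ 0) {μ ν : Fin 4} (hμν : μ ≠ ν) :
    sqrtGamma2 μ ν u
      = sqrtDet u * √|inv u μ μ * inv u ν ν - inv u μ ν * inv u ν μ| := by
  have h1 := det_mul_det_inv_toSquareBlockProp (Matrix.of u) h (fun a => a ≠ μ ∧ a ≠ ν)
  have h2 : ((Matrix.of u)⁻¹.toSquareBlockProp fun i => ¬ (i ≠ μ ∧ i ≠ ν)).det
      = inv u μ μ * inv u ν ν - inv u μ ν * inv u ν μ := by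
    let f : Fin 2 → {a : Fin 4 // ¬ (a ≠ μ ∧ a ≠ ν)} :=
      ![⟨μ, by simp⟩, ⟨ν, by simp⟩]
    have hf : Function.Bijective f := by
      constructor
      · intro i j hij
        have hij' := congrArg Subtype.val hij
        fin_cases i <;> fin_cases j <;> simp_all [f]
      · rintro ⟨a, ha⟩
        have : a = μ ∨ a = ν := by tauto
        rcases this with rfl | rfl
        · exact ⟨0, rfl⟩
        · exact ⟨1, rfl⟩
    rw [← Matrix.det_submatrix_equiv_self (Equiv.ofBijective f hf), Matrix.det_fin_two]
    rfl
  rw [h2] at h1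
  rw [sqrtDet, ← Real.sqrt_mul (abs_nonneg _), ← abs_mul, h1]
  rfl

/-! ### Smoothness of the metric algebra -/

theorem contDiffAt_matrix_det {F : Type*} [NormedAddCommGroup F] [NormedSpace ℝ F]
    {n : Type*} [Fintype n] [DecidableEq n] {M : F → Matrix n n ℝ} {x : F}
    (h : ∀ i j, ContDiffAt ℝ ∞ (fun y => M y i j) x) :
    ContDiffAt ℝ ∞ (fun y => (M y).det) x := by
  simp only [Matrix.det_apply]
  refine ContDiffAt.sum fun σ _ => ContDiffAt.const_smul _ ?_
  exact contDiffAt_prod fun i _ => h _ _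

/-- The component `u ↦ u μ ν`, as a linear functional. -/
def entry (μ ν : Fin 4) : Tensor2 →L[ℝ] ℝ :=
  (ContinuousLinearMap.proj (R := ℝ) (φ := fun _ : Fin 4 => ℝ) ν).comp
    (ContinuousLinearMap.proj (R := ℝ) (φ := fun _ : Fin 4 => Fin 4 → ℝ) μ)

theorem contDiff_entry (μ ν : Fin 4) : ContDiff ℝ ∞ (fun u : Tensor2 => u μ ν) := by
  fun_prop

theorem contDiffAt_det (u : Tensor2) : ContDiffAt ℝ ∞ (fun u : Tensor2 => (Matrix.of u).det) u :=
  contDiffAt_matrix_det fun i j => (contDiff_entry i j).contDiffAt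

theorem contDiffAt_inv {u : Tensor2} (h : (Matrix.of u).det ≠ 0) (μ ν : Fin 4) :
    ContDiffAt ℝ ∞ (fun u => inv u μ ν) u := by
  have h1 : (fun u => inv u μ ν)
      = fun u : Tensor2 => (Matrix.of u).det⁻¹ * (Matrix.of u).adjugate μ ν := by
    funext u
    simp [inv, Matrix.inv_def]
  rw [h1]
  refine ((contDiffAt_det u).inv h).mul ?_
  simp only [Matrix.adjugate_apply]
  refine contDiffAt_matrix_det fun i j => ?_
  by_cases hi : i = ν
  · subst hi
    simp only [Matrix.updateRow_self]
    exact contDiffAt_const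
  · simp only [Matrix.updateRow_ne hi]
    exact (contDiff_entry i j).contDiffAt

theorem contDiffAt_sqrt_abs {F : Type*} [NormedAddCommGroup F] [NormedSpace ℝ F] {f : F → ℝ}
    {x : F} (hf : ContDiffAt ℝ ∞ f x) (h : f x ≠ 0) : ContDiffAt ℝ ∞ (fun y => √|f y|) x :=
  (hf.abs h).sqrt (abs_ne_zero.mpr h)

theorem eventually_det_ne {u : Tensor2} (h : (Matrix.of u).det ≠ 0) :
    ∀ᶠ v in 𝓝 u, (Matrix.of v).det ≠ 0 :=
  (contDiffAt_det u).continuousAt.eventually_ne h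

theorem contDiffAt_sqrtDet {u : Tensor2} (h : (Matrix.of u).det ≠ 0) :
    ContDiffAt ℝ ∞ sqrtDet u :=
  contDiffAt_sqrt_abs (contDiffAt_det u) h

theorem sqrtDet_pos {u : Tensor2} (h : (Matrix.of u).det ≠ 0) : 0 < sqrtDet u :=
  Real.sqrt_pos.mpr (abs_pos.mpr h)

/-- The derivative of the inverse metric, `δ(g⁻¹) = -g⁻¹ δg g⁻¹`. -/
theorem fderiv_inv {u : Tensor2} (h : (Matrix.of u).det ≠ 0) (μ ν : Fin 4) (v : Tensor2) :
    fderiv ℝ (fun u => inv u μ ν) u v = -∑ a, ∑ b, inv u μ a * v a b * inv u b ν := by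
  have hd : ∀ a b, HasFDerivAt (fun u => inv u a b) (fderiv ℝ (fun u => inv u a b) u) u :=
    fun a b => ((contDiffAt_inv h a b).differentiableAt (by simp)).hasFDerivAt
  -- differentiate `u⁻¹ u = 1`
  have key : ∀ b, ∑ a, (inv u μ a * v a b + u a b * fderiv ℝ (fun u => inv u μ a) u v) = 0 := by
    intro b
    have h1 : HasFDerivAt (𝕜 := ℝ) (fun w : Tensor2 => ∑ a, inv w μ a * w a b)
        (∑ a, (inv u μ a • entry a b + u a b • fderiv ℝ (fun u => inv u μ a) u)) u := by
      refine HasFDerivAt.fun_sum fun a _ => ?_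
      have he : HasFDerivAt (fun w : Tensor2 => w a b) (entry a b) u := (entry a b).hasFDerivAt
      exact (hd μ a).mul he
    have h2 : (fun w : Tensor2 => ∑ a, inv w μ a * w a b) =ᶠ[𝓝 u]
        fun _ => if μ = b then 1 else 0 := by
      filter_upwards [eventually_det_ne h] with w hw using sum_inv_mul hw μ b
    have h3 := (hasFDerivAt_const (𝕜 := ℝ) (if μ = b then (1 : ℝ) else 0)
      u).congr_of_eventuallyEq h2
    have h4 := DFunLike.congr_fun (h1.unique h3) v
    simpa [entry] using h4
  have h5 : ∑ b, (∑ a, (inv u μ a * v a b + u a b * fderiv ℝ (fun u => inv u μ a) u v))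
      * inv u b ν = 0 := by simp [key]
  have h6 : ∑ b, (∑ a, u a b * fderiv ℝ (fun u => inv u μ a) u v) * inv u b ν
      = fderiv ℝ (fun u => inv u μ ν) u v := by
    calc _ = ∑ a, (∑ b, u a b * inv u b ν) * fderiv ℝ (fun u => inv u μ a) u v := by
          simp only [Finset.sum_mul]
          rw [Finset.sum_comm]
          exact Finset.sum_congr rfl fun _ _ => Finset.sum_congr rfl fun _ _ => by ring
      _ = _ := by simp [sum_mul_inv h]
  simp only [Finset.sum_add_distrib, add_mul] at h5
  rw [h6] at h5
  rw [Finset.sum_comm]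
  simp only [Finset.sum_mul] at h5
  linarith

/-- Jacobi's formula, `δ det g = det g · g^{ab} δg_{ab}`. -/
theorem fderiv_det (u : Tensor2) (h : (Matrix.of u).det ≠ 0) (v : Tensor2) :
    fderiv ℝ (fun u : Tensor2 => (Matrix.of u).det) u v
      = (Matrix.of u).det * ∑ a, ∑ b, inv u a b * v b a := by
  have hd := ((contDiffAt_det u).differentiableAt (by simp)).hasFDerivAt.hasLineDerivAt v
  have hline : ∀ s : ℝ, (Matrix.of (u + s • v)).det
      = (Matrix.of u).det * (1 + s • ((Matrix.of u)⁻¹ * Matrix.of v)).det := by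
    intro s
    rw [← Matrix.det_mul, mul_add, mul_one, mul_smul_comm,
      Matrix.mul_nonsing_inv_cancel_left _ _ (Ne.isUnit h)]
    rfl
  have h2 : HasLineDerivAt ℝ (fun u : Tensor2 => (Matrix.of u).det)
      ((Matrix.of u).det * ∑ a, ∑ b, inv u a b * v b a) u v := by
    unfold HasLineDerivAt
    simp only [hline]
    refine HasDerivAt.const_mul _ ?_
    set M := (Matrix.of u)⁻¹ * Matrix.of v with hM
    have h3 := fun s : ℝ => Matrix.det_one_add_smul s M
    simp only [h3]
    have ht : M.trace = ∑ a, ∑ b, inv u a b * v b a := by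
      simp only [hM, Matrix.trace, Matrix.diag_apply, Matrix.mul_apply]; rfl
    rw [← ht]
    set P := (1 + (Polynomial.X : Polynomial ℝ) • M.map Polynomial.C).det.divX.divX
    have h4 : HasDerivAt (fun s : ℝ => 1 + M.trace * s + P.eval s * s ^ 2)
      (M.trace * 1 + (P.derivative.eval 0 * (0:ℝ) ^ 2 + P.eval 0 * ((2 : ℕ) * (0:ℝ) ^ (2 - 1) * 1)))
      0 := (((hasDerivAt_id (0:ℝ)).const_mul M.trace).const_add 1).add
        ((P.hasDerivAt 0).mul ((hasDerivAt_id (0:ℝ)).pow 2))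
    simpa using h4
  exact hd.unique h2

/-- The derivative of `√|g|`, `δ√|g| = ½ √|g| g^{ab} δg_{ab}`. -/
theorem fderiv_sqrtDet {u : Tensor2} (h : (Matrix.of u).det ≠ 0) (v : Tensor2) :
    fderiv ℝ sqrtDet u v = (1 / 2) * sqrtDet u * ∑ a, ∑ b, inv u a b * v b a := by
  have hsq : ∀ w, sqrtDet w * sqrtDet w = |(Matrix.of w).det| := fun w =>
    Real.mul_self_sqrt (abs_nonneg _)
  have hp := sqrtDet_pos h
  have hd := ((contDiffAt_sqrtDet h).differentiableAt (by simp)).hasFDerivAt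
  have hd2 := (contDiffAt_det u).differentiableAt (by simp : (∞ : WithTop ℕ∞) ≠ 0)
  have h1 := ((hd.mul hd).mul (hd.mul hd))
  -- `(√|g|)⁴ = g²` avoids the sign of the determinant
  have h2 : sqrtDet * sqrtDet * (sqrtDet * sqrtDet)
      = fun w : Tensor2 => (Matrix.of w).det * (Matrix.of w).det := by
    funext w; simp only [Pi.mul_apply]; rw [hsq, abs_mul_abs_self]
  rw [h2] at h1
  have h3 := congrArg (fun A : Tensor2 →L[ℝ] ℝ => A v)
    (h1.unique (hd2.hasFDerivAt.mul hd2.hasFDerivAt))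
  simp only [add_apply, smul_apply, smul_eq_mul, Pi.mul_apply,
    fderiv_det u h v] at h3
  have h4 : (Matrix.of u).det * (Matrix.of u).det = sqrtDet u ^ 4 := by
    rw [← abs_mul_abs_self, ← hsq]; ring
  have h5 : 4 * sqrtDet u ^ 3 * fderiv ℝ sqrtDet u v
      = 4 * sqrtDet u ^ 3 * ((1 / 2) * sqrtDet u * ∑ a, ∑ b, inv u a b * v b a) := by
    linear_combination h3 + 2 * (∑ a, ∑ b, inv u a b * v b a) * h4
  exact mul_left_cancel₀ (by positivity) h5

/-! ### Admissible points: normals, two-surfaces and angles -/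

theorem Adm.xi_mul_inv_pos {u : Tensor2} (h : Adm u) (μ : Fin 4) : 0 < xi μ * inv u μ μ := by
  refine Fin.cases ?_ (fun i => ?_) μ
  · have := h.time
    simp only [xi, if_true]; linarith
  · have := h.space i
    simpa [xi, Fin.succ_ne_zero] using this

theorem Adm.inv_diag_ne {u : Tensor2} (h : Adm u) (μ : Fin 4) : inv u μ μ ≠ 0 := by
  intro h0
  have := h.xi_mul_inv_pos μ
  simp [h0] at this

theorem Adm.inv_symm {u : Tensor2} (h : Adm u) (μ ν : Fin 4) : inv u μ ν = inv u ν μ :=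
  TraceK.inv_symm h.symm μ ν

theorem xi_mul_self (μ : Fin 4) : xi μ * xi μ = 1 := by
  unfold xi; split_ifs <;> norm_num

theorem Adm.diag_prod_pos {u : Tensor2} (h : Adm u) (μ ν : Fin 4) :
    0 < xi μ * xi ν * inv u μ μ * inv u ν ν := by
  have := mul_pos (h.xi_mul_inv_pos μ) (h.xi_mul_inv_pos ν)
  linarith

/-- The two-surfaces `x^μ, x^ν = constant` are nondegenerate, spacelike if one of the indices is `0`
and timelike otherwise. -/
theorem Adm.minor_pos {u : Tensor2} (h : Adm u) {μ ν : Fin 4} (hμν : μ ≠ ν) :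
    0 < xi μ * xi ν * (inv u μ μ * inv u ν ν - inv u μ ν * inv u ν μ) := by
  have hpos := h.diag_prod_pos μ ν
  have hs := h.inv_symm μ ν
  by_cases h0 : μ = 0 ∨ ν = 0
  · have hx : xi μ * xi ν = -1 := by
      rcases h0 with rfl | rfl
      · simp [xi, hμν.symm]
      · simp [xi, hμν]
    rw [hx] at hpos ⊢
    rw [← hs]
    nlinarith [mul_self_nonneg (inv u μ ν)]
  · push Not at h0
    obtain ⟨i, rfl⟩ := Fin.exists_succ_eq.mpr h0.1
    obtain ⟨j, rfl⟩ := Fin.exists_succ_eq.mpr h0.2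
    have := h.minor i j (fun hij => hμν (congrArg Fin.succ hij))
    rw [← hs]
    simp only [xi, h0.1, h0.2, if_false]
    nlinarith

theorem Adm.minor_ne {u : Tensor2} (h : Adm u) {μ ν : Fin 4} (hμν : μ ≠ ν) :
    inv u μ μ * inv u ν ν - inv u μ ν * inv u ν μ ≠ 0 := by
  intro h0
  have := h.minor_pos hμν
  rw [h0] at this
  simp at this

theorem Adm.contDiffAt_inv {u : Tensor2} (h : Adm u) (μ ν : Fin 4) :
    ContDiffAt ℝ ∞ (fun u => inv u μ ν) u :=
  TraceK.contDiffAt_inv h.det_ne μ ν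

theorem Adm.contDiffAt_sqrtDet {u : Tensor2} (h : Adm u) : ContDiffAt ℝ ∞ sqrtDet u :=
  TraceK.contDiffAt_sqrtDet h.det_ne

theorem Adm.contDiffAt_sqrtGamma1 {u : Tensor2} (h : Adm u) (μ : Fin 4) :
    ContDiffAt ℝ ∞ (sqrtGamma1 μ) u := by
  have h1 : sqrtGamma1 μ =ᶠ[𝓝 u] fun u => sqrtDet u * √|inv u μ μ| := by
    filter_upwards [eventually_det_ne h.det_ne] with w hw using sqrtGamma1_eq hw μ
  exact (h.contDiffAt_sqrtDet.mul (contDiffAt_sqrt_abs (h.contDiffAt_inv μ μ)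
    (h.inv_diag_ne μ))).congr_of_eventuallyEq h1

theorem Adm.contDiffAt_sqrtGamma2 {u : Tensor2} (h : Adm u) {μ ν : Fin 4} (hμν : μ ≠ ν) :
    ContDiffAt ℝ ∞ (sqrtGamma2 μ ν) u := by
  have h1 : sqrtGamma2 μ ν =ᶠ[𝓝 u]
      fun u => sqrtDet u * √|inv u μ μ * inv u ν ν - inv u μ ν * inv u ν μ| := by
    filter_upwards [eventually_det_ne h.det_ne] with w hw using sqrtGamma2_eq hw hμν
  refine (h.contDiffAt_sqrtDet.mul (contDiffAt_sqrt_abs ?_ (h.minor_ne hμν))).congr_of_eventuallyEq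
    h1
  exact ((h.contDiffAt_inv _ _).mul (h.contDiffAt_inv _ _)).sub
    ((h.contDiffAt_inv _ _).mul (h.contDiffAt_inv _ _))

theorem Adm.contDiffAt_gammaInv {u : Tensor2} (h : Adm u) (μ a b : Fin 4) :
    ContDiffAt ℝ ∞ (fun u => gammaInv μ u a b) u :=
  (h.contDiffAt_inv _ _).sub
    (((h.contDiffAt_inv _ _).mul (h.contDiffAt_inv _ _)).div (h.contDiffAt_inv _ _)
      (h.inv_diag_ne μ))

theorem Adm.contDiffAt_sqrt_inv {u : Tensor2} (h : Adm u) (μ : Fin 4) :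
    ContDiffAt ℝ ∞ (fun u => √|inv u μ μ|) u :=
  contDiffAt_sqrt_abs (h.contDiffAt_inv μ μ) (h.inv_diag_ne μ)

theorem Adm.sqrt_inv_pos {u : Tensor2} (h : Adm u) (μ : Fin 4) : 0 < √|inv u μ μ| :=
  Real.sqrt_pos.mpr (abs_pos.mpr (h.inv_diag_ne μ))

theorem Adm.contDiffAt_normal {u : Tensor2} (h : Adm u) (μ ν : Fin 4) :
    ContDiffAt ℝ ∞ (fun u => normal μ u ν) u :=
  (contDiffAt_const.mul (h.contDiffAt_inv _ _)).div (h.contDiffAt_sqrt_inv μ)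
    (h.sqrt_inv_pos μ).ne'

theorem Adm.contDiffAt_qProd {u : Tensor2} (h : Adm u) (μ ν : Fin 4) :
    ContDiffAt ℝ ∞ (qProd μ ν) u :=
  (h.contDiffAt_inv _ _).div
    (((contDiffAt_const.mul (h.contDiffAt_inv _ _)).mul (h.contDiffAt_inv _ _)).sqrt
      (h.diag_prod_pos μ ν).ne') (Real.sqrt_pos.mpr (h.diag_prod_pos μ ν)).ne'

theorem Adm.qProd_sq {u : Tensor2} (h : Adm u) (μ ν : Fin 4) :
    (qProd μ ν u) ^ 2 * (xi μ * xi ν * inv u μ μ * inv u ν ν) = inv u μ ν ^ 2 := by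
  have hs := h.diag_prod_pos μ ν
  rw [qProd, div_pow, Real.sq_sqrt hs.le, div_mul_cancel₀ _ hs.ne']

/-- For spacelike `μ ≠ ν` the condition `(g^{μν})² < g^{μμ} g^{νν}` says `|q(μν)| < 1`. -/
theorem Adm.qProd_sq_lt_one {u : Tensor2} (h : Adm u) {μ ν : Fin 4} (hμν : μ ≠ ν)
    (h0 : ¬(μ = 0 ∨ ν = 0)) : (qProd μ ν u) ^ 2 < 1 := by
  have hs := h.diag_prod_pos μ ν
  have hm := h.minor_pos hμν
  have hq := h.qProd_sq μ ν
  have hsy := h.inv_symm μ ν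
  push Not at h0
  simp only [xi, h0.1, h0.2, if_false, one_mul] at hs hm hq
  by_contra! hle
  rw [← hsy] at hm
  nlinarith [mul_le_mul_of_nonneg_right hle hs.le]

theorem Adm.contDiffAt_angle {u : Tensor2} (h : Adm u) {μ ν : Fin 4} (hμν : μ ≠ ν) :
    ContDiffAt ℝ ∞ (angle μ ν) u := by
  by_cases h0 : μ = 0 ∨ ν = 0
  · have : angle μ ν = fun u => Real.arsinh (qProd μ ν u) := by
      funext u; simp only [angle, if_pos h0]
    rw [this]
    exact (Real.contDiff_arsinh.contDiffAt).comp u (h.contDiffAt_qProd μ ν)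
  · have : angle μ ν = fun u => Real.arcsin (qProd μ ν u) := by
      funext u; simp only [angle, if_neg h0]
    rw [this]
    have hq := h.qProd_sq_lt_one hμν h0
    refine (Real.contDiffAt_arcsin ?_ ?_).comp u (h.contDiffAt_qProd μ ν)
    · intro h1; rw [h1] at hq; norm_num at hq
    · intro h1; rw [h1] at hq; norm_num at hq

theorem fderiv_eq_of_hasDerivAt_line {F : Type*} [NormedAddCommGroup F] [NormedSpace ℝ F]
    {f : F → ℝ} {u v : F} {f' : ℝ} (hf : DifferentiableAt ℝ f u)
    (h : HasDerivAt (fun s : ℝ => f (u + s • v)) f' 0) : fderiv ℝ f u v = f' :=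
  (hf.hasFDerivAt.hasLineDerivAt v).unique h

theorem Adm.hasDerivAt_inv {u : Tensor2} (h : Adm u) (v : Tensor2) (μ ν : Fin 4) :
    HasDerivAt (fun s : ℝ => inv (u + s • v) μ ν) (fderiv ℝ (fun u => inv u μ ν) u v) 0 :=
  ((h.contDiffAt_inv μ ν).differentiableAt (by simp)).hasFDerivAt.hasLineDerivAt v

/-- The variation of the angle between two coordinate surfaces, weighted by the area element
of their intersection. The area element cancels the root in the derivative of `arcsin` or
`arsinh`, which makes the right side rational in the inverse metric. -/
theorem Adm.sqrtGamma2_mul_fderiv_angle {u : Tensor2} (h : Adm u) {μ ν : Fin 4} (hμν : μ ≠ ν)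
    (v : Tensor2) :
    sqrtGamma2 μ ν u * fderiv ℝ (angle μ ν) u v = sqrtDet u *
      (fderiv ℝ (fun u => inv u μ ν) u v - 1 / 2 * inv u μ ν *
        (fderiv ℝ (fun u => inv u μ μ) u v / inv u μ μ
          + fderiv ℝ (fun u => inv u ν ν) u v / inv u ν ν)) := by
  have hs := h.diag_prod_pos μ ν
  have hm := h.minor_pos hμν
  have hq := h.qProd_sq μ ν
  have hsy := h.inv_symm μ ν
  have hP := h.inv_diag_ne μ
  have hQ := h.inv_diag_ne ν
  set D₁ := fderiv ℝ (fun u => inv u μ ν) u v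
  set D₂ := fderiv ℝ (fun u => inv u μ μ) u v
  set D₃ := fderiv ℝ (fun u => inv u ν ν) u v
  set s := xi μ * xi ν * inv u μ μ * inv u ν ν with hsdef
  have hss : 0 < √s := Real.sqrt_pos.mpr hs
  -- `√s · δq`
  have hqd : HasDerivAt (fun t : ℝ => qProd μ ν (u + t • v))
      ((√s)⁻¹ * (D₁ - 1 / 2 * inv u μ ν * (D₂ / inv u μ μ + D₃ / inv u ν ν))) 0 := by
    have h1 := h.hasDerivAt_inv v μ ν
    have h2 := (((h.hasDerivAt_inv v μ μ).const_mul (xi μ * xi ν)).fun_mul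
      (h.hasDerivAt_inv v ν ν)).sqrt (by simpa only [zero_smul, add_zero] using hs.ne')
    have h3 := h1.fun_div h2 (by simpa only [zero_smul, add_zero] using hss.ne')
    refine h3.congr_deriv ?_
    simp only [zero_smul, add_zero]
    rw [← hsdef]
    have e1 : xi μ * xi ν * D₂ * inv u ν ν + xi μ * xi ν * inv u μ μ * D₃
        = s * (D₂ / inv u μ μ + D₃ / inv u ν ν) := by
      rw [hsdef]; field_simp
    have e2 : s = √s ^ 2 := (Real.sq_sqrt hs.le).symm
    rw [e1]
    generalize D₂ / inv u μ μ + D₃ / inv u ν ν = Z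
    generalize √s = w at hss e2
    rw [e2]
    field_simp
    simp only [D₁]
    ring
  have hdet := sqrtGamma2_eq h.det_ne hμν
  have habs : |inv u μ μ * inv u ν ν - inv u μ ν * inv u ν μ|
      = xi μ * xi ν * (inv u μ μ * inv u ν ν - inv u μ ν * inv u ν μ) := by
    rw [← abs_of_pos hm, abs_mul, abs_mul]
    have : ∀ a, |xi a| = 1 := by intro a; unfold xi; split_ifs <;> norm_num
    simp [this]
  by_cases h0 : μ = 0 ∨ ν = 0
  · have hxi : xi μ * xi ν = -1 := by
      rcases h0 with rfl | rfl
      · simp [xi, hμν.symm]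
      · simp [xi, hμν]
    have ha : angle μ ν = fun u => Real.arsinh (qProd μ ν u) := by
      funext u; simp only [angle, if_pos h0]
    have hd := hqd.arsinh
    have h4 := fderiv_eq_of_hasDerivAt_line (f := angle μ ν)
      ((h.contDiffAt_angle hμν).differentiableAt (by simp)) (by rw [ha]; exact hd)
    simp only [zero_smul, add_zero, smul_eq_mul] at h4
    have h5 : xi μ * xi ν * (inv u μ μ * inv u ν ν - inv u μ ν * inv u ν μ)
        = s * (1 + qProd μ ν u ^ 2) := by
      linear_combination -hsdef - inv u μ ν * inv u ν μ * hxi - hq - inv u μ ν * hsy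
    have h6 : 0 < √(1 + qProd μ ν u ^ 2) := Real.sqrt_pos.mpr (by positivity)
    rw [h4, hdet, habs, h5, Real.sqrt_mul hs.le]
    field_simp
  · have hxi : xi μ * xi ν = 1 := by
      push Not at h0
      simp [xi, h0.1, h0.2]
    have hlt := h.qProd_sq_lt_one hμν h0
    have ha : angle μ ν = fun u => Real.arcsin (qProd μ ν u) := by
      funext u; simp only [angle, if_neg h0]
    have hne : ∀ e : ℝ, e ^ 2 = 1 → qProd μ ν (u + (0 : ℝ) • v) ≠ e := by
      intro e he h1
      rw [zero_smul, add_zero] at h1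
      rw [h1, he] at hlt
      exact lt_irrefl _ hlt
    have hd := (Real.hasDerivAt_arcsin (hne (-1) (by norm_num))
      (hne 1 (by norm_num))).comp (0 : ℝ) hqd
    have h4 := fderiv_eq_of_hasDerivAt_line (f := angle μ ν)
      ((h.contDiffAt_angle hμν).differentiableAt (by simp)) (by rw [ha]; exact hd)
    simp only [zero_smul, add_zero] at h4
    have h5 : xi μ * xi ν * (inv u μ μ * inv u ν ν - inv u μ ν * inv u ν μ)
        = s * (1 - qProd μ ν u ^ 2) := by
      linear_combination -hsdef - inv u μ ν * inv u ν μ * hxi + hq + inv u μ ν * hsy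
    have h6 : 0 < √(1 - qProd μ ν u ^ 2) := Real.sqrt_pos.mpr (by linarith)
    rw [h4, hdet, habs, h5, Real.sqrt_mul hs.le]
    field_simp

/-! ### Symmetric jets of the metric -/

/-- Symmetry of an array of components. -/
def IsSym (v : Tensor2) : Prop := ∀ μ ν, v μ ν = v ν μ

/-- A first jet of a symmetric tensor field. -/
structure SymJet1 (j : Jet1 Tensor2) : Prop where
  zero : IsSym j.1
  one : ∀ l, IsSym (j.2 l)

/-- A second jet of a symmetric tensor field. Symmetry in the two derivative indices is a
separate condition. -/
structure SymJet2 (j : Jet2 Tensor2) : Prop where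
  zero : IsSym j.1
  one : ∀ l, IsSym (j.2.1 l)
  two : ∀ k l, IsSym (j.2.2 k l)

theorem IsSym.add_smul {u v : Tensor2} (hu : IsSym u) (hv : IsSym v) (s : ℝ) :
    IsSym (u + s • v) := fun μ ν => by
  simp [hu μ ν, hv μ ν]

theorem SymJet1.add_smul {j v : Jet1 Tensor2} (hj : SymJet1 j) (hv : SymJet1 v) (s : ℝ) :
    SymJet1 (j + s • v) where
  zero := hj.zero.add_smul hv.zero s
  one l := (hj.one l).add_smul (hv.one l) s

theorem SymJet2.add_smul {j v : Jet2 Tensor2} (hj : SymJet2 j) (hv : SymJet2 v) (s : ℝ) :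
    SymJet2 (j + s • v) where
  zero := hj.zero.add_smul hv.zero s
  one l := (hj.one l).add_smul (hv.one l) s
  two k l := (hj.two k l).add_smul (hv.two k l) s

theorem SymJet2.fst {j : Jet2 Tensor2} (hj : SymJet2 j) : SymJet1 (j.1, j.2.1) :=
  ⟨hj.zero, hj.one⟩

theorem SymJet2.snd {j : Jet2 Tensor2} (hj : SymJet2 j) (μ : Fin 4) :
    SymJet1 (j.2.1 μ, j.2.2 μ) :=
  ⟨hj.one μ, hj.two μ⟩

/-- Admissibility is an open condition on symmetric arrays. -/
theorem Adm.eventually {u : Tensor2} (h : Adm u) : ∀ᶠ w in 𝓝 u, IsSym w → Adm w := by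
  have hc : ∀ μ ν, ContinuousAt (fun w => inv w μ ν) u := fun μ ν =>
    (h.contDiffAt_inv μ ν).continuousAt
  have h1 : ∀ᶠ w in 𝓝 u, inv w 0 0 < 0 := (hc 0 0).eventually_lt_const h.time
  have h2 : ∀ᶠ w in 𝓝 u, ∀ i : Fin 3, 0 < inv w i.succ i.succ :=
    Filter.eventually_all.mpr fun i => (hc _ _).eventually_const_lt (h.space i)
  have h3 : ∀ᶠ w in 𝓝 u, ∀ i j : Fin 3, i ≠ j →
      (inv w i.succ j.succ) ^ 2 < inv w i.succ i.succ * inv w j.succ j.succ := by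
    refine Filter.eventually_all.mpr fun i => Filter.eventually_all.mpr fun j => ?_
    by_cases hij : i = j
    · exact Filter.Eventually.of_forall fun w h => absurd hij h
    · have h4 := ((hc i.succ j.succ).pow 2).eventually_lt ((hc i.succ i.succ).mul
        (hc j.succ j.succ)) (h.minor i j hij)
      filter_upwards [h4] with w hw _ using hw
  filter_upwards [eventually_det_ne h.det_ne, h1, h2, h3] with w w0 w1 w2 w3 hs
    using ⟨hs, w0, w1, w2, w3⟩

theorem Adm.eventually_line {u v : Tensor2} (h : Adm u) (hv : IsSym v) :
    ∀ᶠ s : ℝ in 𝓝 0, Adm (u + s • v) := by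
  have hc : ContinuousAt (fun s : ℝ => u + s • v) 0 := by fun_prop
  have h1 : ∀ᶠ w in 𝓝 (u + (0 : ℝ) • v), IsSym w → Adm w := by
    rw [zero_smul, add_zero]; exact h.eventually
  filter_upwards [hc.eventually h1] with s hs using hs (IsSym.add_smul h.symm hv s)

/-- Functions that agree along a line have the same derivative in the direction of the line. -/
theorem fderiv_congr_line {F : Type*} [NormedAddCommGroup F] [NormedSpace ℝ F]
    {f h : F → ℝ} {u v : F} (hf : DifferentiableAt ℝ f u) (hh : DifferentiableAt ℝ h u)
    (heq : ∀ᶠ s : ℝ in 𝓝 0, f (u + s • v) = h (u + s • v)) :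
    fderiv ℝ f u v = fderiv ℝ h u v := by
  refine fderiv_eq_of_hasDerivAt_line hf ?_
  have h1 : HasDerivAt (fun s : ℝ => h (u + s • v)) (fderiv ℝ h u v) 0 :=
    hh.hasFDerivAt.hasLineDerivAt v
  exact h1.congr_of_eventuallyEq heq

/-! ### Christoffel symbols -/

/-- The Christoffel symbols `Γ_{σμν}` with all indices down. -/
def chrLow (σ μ ν : Fin 4) (p : Fin 4 → Tensor2) : ℝ :=
  (1 / 2) * (p μ σ ν + p ν σ μ - p σ μ ν)

theorem christoffel_eq (ρ μ ν : Fin 4) (j : Jet1 Tensor2) :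
    christoffel ρ μ ν j = ∑ σ, inv j.1 ρ σ * chrLow σ μ ν j.2 := by
  simp only [christoffel, chrLow, Finset.mul_sum]
  exact Finset.sum_congr rfl fun _ _ => by ring

/-- Metric compatibility, `Γ_{aλb} + Γ_{bλa} = ∂_λ g_{ab}`. -/
theorem chrLow_add_chrLow {p : Fin 4 → Tensor2} (hp : ∀ l, IsSym (p l)) (l a b : Fin 4) :
    chrLow a l b p + chrLow b l a p = p l a b := by
  simp only [chrLow]
  rw [hp l b a, hp b a l, hp a b l]; ring

theorem SymJet1.christoffel_symm {j : Jet1 Tensor2} (hj : SymJet1 j) (ρ μ ν : Fin 4) :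
    christoffel ρ μ ν j = christoffel ρ ν μ j := by
  simp only [christoffel]
  congr 1
  refine Finset.sum_congr rfl fun σ _ => ?_
  rw [hj.one σ μ ν]; ring

theorem contDiff_jet1_snd (l a b : Fin 4) : ContDiff ℝ ∞ (fun j : Jet1 Tensor2 => j.2 l a b) := by
  fun_prop

theorem contDiffAt_comp_fst {f : Tensor2 → ℝ} {j : Jet1 Tensor2} (h : ContDiffAt ℝ ∞ f j.1) :
    ContDiffAt ℝ ∞ (fun k : Jet1 Tensor2 => f k.1) j :=
  h.comp j contDiffAt_fst

theorem Adm.contDiffAt_christoffel {j : Jet1 Tensor2} (h : Adm j.1) (ρ μ ν : Fin 4) :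
    ContDiffAt ℝ ∞ (christoffel ρ μ ν) j := by
  unfold christoffel
  refine contDiffAt_const.mul (ContDiffAt.sum fun σ _ => ?_)
  exact (contDiffAt_comp_fst (h.contDiffAt_inv ρ σ)).mul
    (((contDiff_jet1_snd _ _ _).add (contDiff_jet1_snd _ _ _)).sub
      (contDiff_jet1_snd _ _ _)).contDiffAt

/-- Metric compatibility for the inverse metric:
`∂_λ g^{μν} = -Γ^μ_{λa} g^{aν} - Γ^ν_{λa} g^{aμ}`. -/
theorem Adm.fderiv_inv_eq {j : Jet1 Tensor2} (h : Adm j.1) (hj : SymJet1 j) (l μ ν : Fin 4) :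
    fderiv ℝ (fun u => inv u μ ν) j.1 (j.2 l)
      = -∑ a, christoffel μ l a j * inv j.1 a ν - ∑ a, christoffel ν l a j * inv j.1 a μ := by
  rw [fderiv_inv h.det_ne]
  simp only [← chrLow_add_chrLow hj.one l, christoffel_eq, Finset.sum_mul, mul_add, add_mul,
    Finset.sum_add_distrib]
  have e : ∑ a, ∑ b, inv j.1 μ a * chrLow a l b j.2 * inv j.1 b ν
      = ∑ b, ∑ a, inv j.1 μ a * chrLow a l b j.2 * inv j.1 b ν := Finset.sum_comm
  have e2 : ∑ a, ∑ b, inv j.1 μ a * chrLow b l a j.2 * inv j.1 b ν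
      = ∑ a, ∑ b, inv j.1 ν b * chrLow b l a j.2 * inv j.1 a μ := by
    refine Finset.sum_congr rfl fun a _ => Finset.sum_congr rfl fun b _ => ?_
    rw [h.inv_symm b ν, h.inv_symm a μ]; ring
  rw [e, e2]; ring

/-- `∂_λ √|g| = √|g| Γ^a_{λa}`. -/
theorem Adm.fderiv_sqrtDet_eq {j : Jet1 Tensor2} (h : Adm j.1) (hj : SymJet1 j) (l : Fin 4) :
    fderiv ℝ sqrtDet j.1 (j.2 l) = sqrtDet j.1 * ∑ a, christoffel a l a j := by
  rw [fderiv_sqrtDet h.det_ne]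
  simp only [← chrLow_add_chrLow hj.one l, christoffel_eq, mul_add, Finset.sum_add_distrib]
  have e2 : ∑ a, ∑ b, inv j.1 a b * chrLow a l b j.2
      = ∑ a, ∑ b, inv j.1 a b * chrLow b l a j.2 := by
    rw [Finset.sum_comm]
    refine Finset.sum_congr rfl fun a _ => Finset.sum_congr rfl fun b _ => ?_
    rw [h.inv_symm b a]
  rw [e2]; ring

/-! ### The boundary term of the trace K Lagrangian -/

/-- The vector density `√|g| (g^{ab} Γ^μ_{ab} - g^{μa} Γ^ρ_{ρa})`, whose divergence is the
difference of the Einstein-Hilbert and the gamma-gamma Lagrangians. -/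
def ehBoundary (μ : Fin 4) (j : Jet1 Tensor2) : ℝ :=
  sqrtDet j.1 * ((∑ a, ∑ b, inv j.1 a b * christoffel μ a b j)
    - ∑ a, inv j.1 μ a * ∑ ρ, christoffel ρ ρ a j)

theorem Adm.xi_div_abs {u : Tensor2} (h : Adm u) (μ : Fin 4) :
    xi μ * (xi μ / √|inv u μ μ|) * (xi μ / √|inv u μ μ|) = (inv u μ μ)⁻¹ := by
  have hp := h.xi_mul_inv_pos μ
  have hx := xi_mul_self μ
  have hne := h.inv_diag_ne μ
  have h1 : |inv u μ μ| = xi μ * inv u μ μ := by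
    rw [← abs_of_pos hp, abs_mul]
    have : |xi μ| = 1 := by unfold xi; split_ifs <;> norm_num
    rw [this, one_mul]
  have h2 : √|inv u μ μ| * √|inv u μ μ| = xi μ * inv u μ μ := by
    rw [Real.mul_self_sqrt (abs_nonneg _), h1]
  have h3 := h.sqrt_inv_pos μ
  have hxne : xi μ ≠ 0 := by intro h0; simp [h0] at hx
  rw [mul_assoc, div_mul_div_comm, h2, hx]
  field_simp

/-- The normal term is linear in the derivatives `∂_ν g`. The coefficient is antisymmetric in `μ`
and `ν`. -/
theorem Adm.normalTerm_eq {j : Jet1 Tensor2} (h : Adm j.1) (hj : SymJet1 j) (μ : Fin 4) :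
    normalTerm μ j = ∑ ν, 1 / 2 * sqrtDet j.1 * inv j.1 μ ν *
      (fderiv ℝ (fun u => inv u ν ν) j.1 (j.2 ν) / inv j.1 ν ν
        - fderiv ℝ (fun u => inv u μ μ) j.1 (j.2 ν) / inv j.1 μ μ) := by
  rw [normalTerm, Finset.mul_sum]
  refine Finset.sum_congr rfl fun ν _ => ?_
  rw [h.fderiv_inv_eq hj, h.fderiv_inv_eq hj]
  have e : ∀ σ, xi μ * normal μ j.1 σ * normal μ j.1 ν * christoffel μ ν σ j
      - xi ν * normal ν j.1 σ * normal ν j.1 μ * christoffel ν ν σ j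
      = inv j.1 μ ν / inv j.1 μ μ * (christoffel μ ν σ j * inv j.1 σ μ)
        - inv j.1 μ ν / inv j.1 ν ν * (christoffel ν ν σ j * inv j.1 σ ν) := by
    intro σ
    have h1 := h.xi_div_abs μ
    have h2 := h.xi_div_abs ν
    rw [div_eq_mul_inv, div_eq_mul_inv, ← h1, ← h2, h.inv_symm σ μ, h.inv_symm σ ν]
    simp only [normal]
    rw [h.inv_symm ν μ]
    ring
  simp only [e, Finset.sum_sub_distrib, ← Finset.mul_sum]
  ring

theorem Adm.sqrtGamma1_mul_traceK {j : Jet1 Tensor2} (h : Adm j.1) (μ : Fin 4) :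
    sqrtGamma1 μ j.1 * traceK μ j = -(sqrtDet j.1 *
      ((∑ a, ∑ b, inv j.1 a b * christoffel μ a b j)
        - ∑ a, ∑ b, inv j.1 a μ * inv j.1 μ b / inv j.1 μ μ * christoffel μ a b j)) := by
  have hp := h.sqrt_inv_pos μ
  rw [sqrtGamma1_eq h.det_ne, traceK, ← Finset.sum_sub_distrib, mul_assoc, ← mul_neg]
  congr 1
  rw [Finset.mul_sum, ← Finset.sum_neg_distrib]
  refine Finset.sum_congr rfl fun a _ => ?_
  rw [Finset.mul_sum, ← Finset.sum_sub_distrib, ← Finset.sum_neg_distrib]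
  refine Finset.sum_congr rfl fun b _ => ?_
  simp only [gammaInv, extrinsic]
  field_simp

theorem Adm.totalDeriv0_mul_angle {j : Jet1 Tensor2} (h : Adm j.1) {μ ν : Fin 4} (hμν : μ ≠ ν) :
    totalDeriv0 ν (fun u => sqrtGamma2 μ ν u * angle μ ν u) j
      = sqrtDet j.1 * (fderiv ℝ (fun u => inv u μ ν) j.1 (j.2 ν) - 1 / 2 * inv j.1 μ ν *
        (fderiv ℝ (fun u => inv u μ μ) j.1 (j.2 ν) / inv j.1 μ μ
          + fderiv ℝ (fun u => inv u ν ν) j.1 (j.2 ν) / inv j.1 ν ν))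
        + angle μ ν j.1 * totalDeriv0 ν (sqrtGamma2 μ ν) j := by
  have h1 := (h.contDiffAt_sqrtGamma2 hμν).differentiableAt (by simp)
  have h2 := (h.contDiffAt_angle hμν).differentiableAt (by simp)
  rw [← h.sqrtGamma2_mul_fderiv_angle hμν]
  simp only [totalDeriv0]
  rw [fderiv_fun_mul h1 h2]
  simp [smul_eq_mul]

/-- The total boundary current of the trace K Lagrangian, on first jets of the metric. -/
theorem Adm.boundary_eq {j : Jet1 Tensor2} (h : Adm j.1) (hj : SymJet1 j) (μ : Fin 4) :
    ehBoundary μ j + 2 * (sqrtGamma1 μ j.1 * traceK μ j)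
      - ∑ ν ∈ Finset.univ.erase μ, totalDeriv0 ν (fun u => sqrtGamma2 μ ν u * angle μ ν u) j
      = -angleTerm μ j + normalTerm μ j := by
  have hs : ∑ ν ∈ Finset.univ.erase μ,
      totalDeriv0 ν (fun u => sqrtGamma2 μ ν u * angle μ ν u) j
      = ∑ ν, sqrtDet j.1 * (fderiv ℝ (fun u => inv u μ ν) j.1 (j.2 ν) - 1 / 2 * inv j.1 μ ν *
        (fderiv ℝ (fun u => inv u μ μ) j.1 (j.2 ν) / inv j.1 μ μ
          + fderiv ℝ (fun u => inv u ν ν) j.1 (j.2 ν) / inv j.1 ν ν)) + angleTerm μ j := by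
    -- the summand with `ν = μ` vanishes identically
    rw [← Finset.sum_erase (s := Finset.univ) (a := μ), angleTerm, ← Finset.sum_add_distrib]
    · refine Finset.sum_congr rfl fun ν hν => ?_
      exact h.totalDeriv0_mul_angle (Finset.ne_of_mem_erase hν).symm
    · have := h.inv_diag_ne μ
      field_simp
      ring
  rw [hs, h.normalTerm_eq hj, h.sqrtGamma1_mul_traceK, ehBoundary]
  have e1 : ∑ ν, fderiv ℝ (fun u => inv u μ ν) j.1 (j.2 ν)
      = -(∑ a, ∑ b, inv j.1 a b * christoffel μ a b j)
        - ∑ a, inv j.1 μ a * ∑ ρ, christoffel ρ ρ a j := by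
    simp only [h.fderiv_inv_eq hj, Finset.sum_sub_distrib, Finset.sum_neg_distrib, Finset.mul_sum]
    congr 1
    · congr 1
      refine Finset.sum_congr rfl fun a _ => Finset.sum_congr rfl fun b _ => ?_
      rw [h.inv_symm b a]; ring
    · rw [Finset.sum_comm]
      refine Finset.sum_congr rfl fun a _ => Finset.sum_congr rfl fun b _ => ?_
      rw [h.inv_symm a μ]; ring
  have e2 : ∑ a, ∑ b, inv j.1 a μ * inv j.1 μ b / inv j.1 μ μ * christoffel μ a b j
      = -∑ ν, 1 / 2 * (inv j.1 μ ν *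
        (fderiv ℝ (fun u => inv u μ μ) j.1 (j.2 ν) / inv j.1 μ μ)) := by
    rw [← Finset.sum_neg_distrib]
    refine Finset.sum_congr rfl fun a _ => ?_
    rw [h.fderiv_inv_eq hj, h.inv_symm a μ]
    have : ∀ b, inv j.1 μ a * inv j.1 μ b / inv j.1 μ μ * christoffel μ a b j
        = inv j.1 μ a / inv j.1 μ μ * (christoffel μ a b j * inv j.1 b μ) := by
      intro b; rw [h.inv_symm b μ]; ring
    simp only [this, ← Finset.mul_sum]
    ring
  simp only [mul_sub, mul_add, Finset.sum_sub_distrib, Finset.sum_add_distrib, ← Finset.mul_sum,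
    mul_assoc] at *
  rw [e1, e2]
  ring

/-! ### Smoothness of the Lagrangians in the jet variables -/

section totalDeriv

variable {E : Type} [NormedAddCommGroup E] [NormedSpace ℝ E]

theorem contDiffAt_totalDeriv0 {f : E → ℝ} {j : Jet1 E} (h : ContDiffAt ℝ ∞ f j.1) (μ : Fin 4) :
    ContDiffAt ℝ ∞ (totalDeriv0 μ f) j := by
  have h1 : ContDiffAt ℝ ∞ (fderiv ℝ f) j.1 := h.fderiv_right (by simp)
  have h2 : ContDiffAt ℝ ∞ (fun k : Jet1 E => fderiv ℝ f k.1) j := h1.comp j contDiffAt_fst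
  exact h2.clm_apply (by fun_prop)

theorem contDiffAt_totalDeriv1 {f : Jet1 E → ℝ} {j : Jet2 E}
    (h : ContDiffAt ℝ ∞ f (j.1, j.2.1)) (μ : Fin 4) :
    ContDiffAt ℝ ∞ (totalDeriv1 μ f) j := by
  have h1 : ContDiffAt ℝ ∞ (fderiv ℝ f) (j.1, j.2.1) := h.fderiv_right (by simp)
  have h2 : ContDiffAt ℝ ∞ (fun k : Jet2 E => fderiv ℝ f (k.1, k.2.1)) j :=
    ContDiffAt.comp j (f := fun k : Jet2 E => (k.1, k.2.1)) h1 (by fun_prop)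
  exact h2.clm_apply (by fun_prop)

theorem contDiffAt_comp_jet1 {f : Jet1 E → ℝ} {j : Jet2 E}
    (h : ContDiffAt ℝ ∞ f (j.1, j.2.1)) : ContDiffAt ℝ ∞ (fun k : Jet2 E => f (k.1, k.2.1)) j :=
  ContDiffAt.comp j (f := fun k : Jet2 E => (k.1, k.2.1)) h (by fun_prop)

end totalDeriv

theorem Adm.contDiffAt_ehBoundary {j : Jet1 Tensor2} (h : Adm j.1) (μ : Fin 4) :
    ContDiffAt ℝ ∞ (ehBoundary μ) j := by
  refine (contDiffAt_comp_fst h.contDiffAt_sqrtDet).mul (ContDiffAt.sub ?_ ?_)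
  · exact ContDiffAt.sum fun a _ => ContDiffAt.sum fun b _ =>
      (contDiffAt_comp_fst (h.contDiffAt_inv a b)).mul (h.contDiffAt_christoffel _ _ _)
  · exact ContDiffAt.sum fun a _ => (contDiffAt_comp_fst (h.contDiffAt_inv μ a)).mul
      (ContDiffAt.sum fun b _ => h.contDiffAt_christoffel _ _ _)

theorem Adm.contDiffAt_lagGamma {j : Jet1 Tensor2} (h : Adm j.1) :
    ContDiffAt ℝ ∞ lagGamma j := by
  refine (contDiffAt_comp_fst h.contDiffAt_sqrtDet).mul (ContDiffAt.sum fun a _ =>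
    ContDiffAt.sum fun b _ => (contDiffAt_comp_fst (h.contDiffAt_inv a b)).mul
      (ContDiffAt.sum fun c _ => ContDiffAt.sum fun d _ => ContDiffAt.sub ?_ ?_))
  · exact (h.contDiffAt_christoffel _ _ _).mul (h.contDiffAt_christoffel _ _ _)
  · exact (h.contDiffAt_christoffel _ _ _).mul (h.contDiffAt_christoffel _ _ _)

theorem Adm.contDiffAt_angleTerm {j : Jet1 Tensor2} (h : Adm j.1) (μ : Fin 4) :
    ContDiffAt ℝ ∞ (angleTerm μ) j := by
  refine ContDiffAt.sum fun ν hν => ?_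
  have hμν : μ ≠ ν := (Finset.ne_of_mem_erase hν).symm
  exact (contDiffAt_comp_fst (h.contDiffAt_angle hμν)).mul
    (contDiffAt_totalDeriv0 (h.contDiffAt_sqrtGamma2 hμν) ν)

theorem Adm.contDiffAt_normalTerm {j : Jet1 Tensor2} (h : Adm j.1) (μ : Fin 4) :
    ContDiffAt ℝ ∞ (normalTerm μ) j := by
  refine (contDiffAt_comp_fst h.contDiffAt_sqrtDet).mul (ContDiffAt.sum fun a _ =>
    ContDiffAt.sum fun b _ => ContDiffAt.sub ?_ ?_)
  · exact ((contDiffAt_const.mul (contDiffAt_comp_fst (h.contDiffAt_normal _ _))).mul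
      (contDiffAt_comp_fst (h.contDiffAt_normal _ _))).mul (h.contDiffAt_christoffel _ _ _)
  · exact ((contDiffAt_const.mul (contDiffAt_comp_fst (h.contDiffAt_normal _ _))).mul
      (contDiffAt_comp_fst (h.contDiffAt_normal _ _))).mul (h.contDiffAt_christoffel _ _ _)

theorem Adm.contDiffAt_traceTerm {j : Jet1 Tensor2} (h : Adm j.1) (μ : Fin 4) :
    ContDiffAt ℝ ∞ (fun k : Jet1 Tensor2 => sqrtGamma1 μ k.1 * traceK μ k) j := by
  refine (contDiffAt_comp_fst (h.contDiffAt_sqrtGamma1 μ)).mul (ContDiffAt.sum fun a _ =>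
    ContDiffAt.sum fun b _ => (contDiffAt_comp_fst (h.contDiffAt_gammaInv μ a b)).mul
      (ContDiffAt.mul (ContDiffAt.neg ?_) (h.contDiffAt_christoffel _ _ _)))
  exact contDiffAt_const.div (contDiffAt_comp_fst (h.contDiffAt_sqrt_inv μ)) (h.sqrt_inv_pos μ).ne'

theorem Adm.contDiffAt_angleDeriv {j : Jet1 Tensor2} (h : Adm j.1) {μ ν : Fin 4} (hμν : μ ≠ ν) :
    ContDiffAt ℝ ∞ (totalDeriv0 ν (fun u => sqrtGamma2 μ ν u * angle μ ν u)) j :=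
  contDiffAt_totalDeriv0 ((h.contDiffAt_sqrtGamma2 hμν).mul (h.contDiffAt_angle hμν)) ν

theorem Adm.contDiffAt_ricci {j : Jet2 Tensor2} (h : Adm j.1) (μ ν : Fin 4) :
    ContDiffAt ℝ ∞ (ricci μ ν) j := by
  have hc : ∀ a b c, ContDiffAt ℝ ∞ (christoffel a b c) (j.1, j.2.1) := fun a b c =>
    Adm.contDiffAt_christoffel h _ _ _
  have hc' : ∀ a b c, ContDiffAt ℝ ∞ (fun k : Jet2 Tensor2 => christoffel a b c (k.1, k.2.1)) j :=
    fun a b c => contDiffAt_comp_jet1 (hc a b c)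
  refine ContDiffAt.sum fun a _ => ContDiffAt.add (ContDiffAt.sub ?_ ?_)
    (ContDiffAt.sum fun b _ => ContDiffAt.sub ?_ ?_)
  · exact contDiffAt_totalDeriv1 (hc _ _ _) _
  · exact contDiffAt_totalDeriv1 (hc _ _ _) _
  · exact (hc' _ _ _).mul (hc' _ _ _)
  · exact (hc' _ _ _).mul (hc' _ _ _)

theorem Adm.contDiffAt_lagK {j : Jet2 Tensor2} (h : Adm j.1) : ContDiffAt ℝ ∞ lagK j := by
  have hf : ∀ {f : Tensor2 → ℝ}, ContDiffAt ℝ ∞ f j.1 →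
      ContDiffAt ℝ ∞ (fun k : Jet2 Tensor2 => f k.1) j := fun hf => hf.comp j contDiffAt_fst
  have h' : Adm (j.1, j.2.1).1 := h
  refine ContDiffAt.sub (ContDiffAt.add ?_ (contDiffAt_const.mul (ContDiffAt.sum fun μ _ => ?_)))
    (ContDiffAt.sum fun μ _ => ContDiffAt.sum fun ν hν => ?_)
  · exact (hf h.contDiffAt_sqrtDet).mul (ContDiffAt.sum fun a _ => ContDiffAt.sum fun b _ =>
      (hf (h.contDiffAt_inv a b)).mul (h.contDiffAt_ricci a b))
  · exact contDiffAt_totalDeriv1 (h'.contDiffAt_traceTerm μ) μ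
  · exact contDiffAt_totalDeriv1 (h'.contDiffAt_angleDeriv (Finset.ne_of_mem_erase hν).symm) μ

/-! ### Sums over four indices and quadratic terms -/

section sums

variable {ι : Type*} [Fintype ι]

theorem sum4_swap12 (f : ι → ι → ι → ι → ℝ) :
    ∑ a, ∑ b, ∑ c, ∑ d, f a b c d = ∑ a, ∑ b, ∑ c, ∑ d, f b a c d := Finset.sum_comm

theorem sum4_swap23 (f : ι → ι → ι → ι → ℝ) :
    ∑ a, ∑ b, ∑ c, ∑ d, f a b c d = ∑ a, ∑ b, ∑ c, ∑ d, f a c b d :=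
  Finset.sum_congr rfl fun _ _ => Finset.sum_comm

theorem sum4_swap34 (f : ι → ι → ι → ι → ℝ) :
    ∑ a, ∑ b, ∑ c, ∑ d, f a b c d = ∑ a, ∑ b, ∑ c, ∑ d, f a b d c :=
  Finset.sum_congr rfl fun _ _ => Finset.sum_congr rfl fun _ _ => Finset.sum_comm

theorem sum4_congr {f h : ι → ι → ι → ι → ℝ} (e : ∀ a b c d, f a b c d = h a b c d) :
    ∑ a, ∑ b, ∑ c, ∑ d, f a b c d = ∑ a, ∑ b, ∑ c, ∑ d, h a b c d := by
  simp only [e]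

end sums

/-- The derivative `∂_l (√|g| g^{ab})`, divided by `√|g|`, in terms of Christoffel symbols. -/
def densitizedInvDeriv (l a b : Fin 4) (j : Jet1 Tensor2) : ℝ :=
  inv j.1 a b * ∑ c, christoffel c l c j - ∑ c, christoffel a l c j * inv j.1 c b
    - ∑ c, christoffel b l c j * inv j.1 c a

/-- The quadratic terms that arise when the divergence of `ehBoundary` is split off. -/
theorem Adm.quadratic_eq {j : Jet1 Tensor2} (h : Adm j.1) (hj : SymJet1 j) :
    ∑ μ, ∑ ν, inv j.1 μ ν * ∑ ρ, ∑ l, (christoffel ρ ρ l j * christoffel l μ ν j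
        - christoffel ρ ν l j * christoffel l ρ μ j)
      = (∑ μ, ∑ ν, inv j.1 μ ν * ∑ ρ, ∑ σ, (christoffel ρ μ σ j * christoffel σ ρ ν j
          - christoffel ρ μ ν j * christoffel σ ρ σ j))
        + ((∑ l, ∑ a, ∑ b, densitizedInvDeriv l a b j * christoffel l a b j)
          - ∑ l, ∑ a, densitizedInvDeriv l l a j * ∑ ρ, christoffel ρ ρ a j) := by
  have hG := h.inv_symm
  have hΓ := hj.christoffel_symm
  simp only [densitizedInvDeriv, Finset.mul_sum, Finset.sum_mul, sub_mul, mul_sub,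
    Finset.sum_sub_distrib]
  generalize inv j.1 = G at *
  generalize hC : (fun a b c => christoffel a b c j) = Γ
  have hC' : ∀ a b c, christoffel a b c j = Γ a b c := fun a b c => by rw [← hC]
  simp only [hC'] at hΓ ⊢
  clear hC hC'
  set X := ∑ μ, ∑ ν, ∑ ρ, ∑ σ, G μ ν * (Γ ρ μ σ * Γ σ ρ ν) with hX
  set Y := ∑ μ, ∑ ν, ∑ ρ, ∑ σ, G μ ν * (Γ ρ μ ν * Γ σ ρ σ) with hY
  have l1 : ∑ μ, ∑ ν, ∑ ρ, ∑ l, G μ ν * (Γ ρ ρ l * Γ l μ ν) = Y := by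
    rw [hY]
    refine (sum4_swap34 _).trans (sum4_congr fun a b c d => ?_)
    rw [hΓ d d c]; ring
  have l2 : ∑ μ, ∑ ν, ∑ ρ, ∑ l, G μ ν * (Γ ρ ν l * Γ l ρ μ) = X := by
    rw [hX]
    refine (sum4_swap12 _).trans (sum4_congr fun a b c d => ?_)
    rw [hG b a]
  have s1 : ∑ l, ∑ a, ∑ b, ∑ c, G a b * Γ c l c * Γ l a b = Y := by
    rw [hY]
    refine (sum4_swap12 _).trans ((sum4_swap23 _).trans (sum4_congr fun a b c d => ?_))
    ring
  have s2 : ∑ l, ∑ a, ∑ b, ∑ c, Γ a l c * G c b * Γ l a b = X := by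
    rw [hX]
    refine (sum4_swap34 _).trans ((sum4_swap23 _).trans ((sum4_swap12 _).trans
      ((sum4_swap34 _).trans ((sum4_swap23 _).trans ((sum4_swap34 _).trans
      (sum4_congr fun a b c d => ?_))))))
    rw [hΓ c d a]; ring
  have s3 : ∑ l, ∑ a, ∑ b, ∑ c, Γ b l c * G c a * Γ l a b = X := by
    rw [hX]
    refine (sum4_swap34 _).trans ((sum4_swap23 _).trans ((sum4_swap12 _).trans
      ((sum4_swap23 _).trans ((sum4_swap34 _).trans (sum4_congr fun a b c d => ?_)))))
    rw [hΓ c d a, hΓ d b c]; ring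
  have s5 : ∑ l, ∑ a, ∑ ρ, ∑ c, Γ l l c * G c a * Γ ρ ρ a
      = ∑ l, ∑ a, ∑ ρ, ∑ c, G l a * Γ c l c * Γ ρ ρ a := by
    refine (sum4_swap34 _).trans ((sum4_swap23 _).trans ((sum4_swap12 _).trans
      ((sum4_swap23 _).trans ((sum4_swap34 _).trans (sum4_congr fun a b c d => ?_)))))
    rw [hΓ d d a]; ring
  have s6 : ∑ l, ∑ a, ∑ ρ, ∑ c, Γ a l c * G c l * Γ ρ ρ a = Y := by
    rw [hY]
    refine (sum4_swap34 _).trans ((sum4_swap23 _).trans (sum4_congr fun a b c d => ?_))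
    rw [hG b a, hΓ d d c]; ring
  simp only [l1, l2, s1, s2, s3, s5, s6]
  ring

/-! ### Total derivatives -/

section totalDeriv

variable {E : Type} [NormedAddCommGroup E] [NormedSpace ℝ E]

theorem totalDeriv1_add {f h : Jet1 E → ℝ} {j : Jet2 E} (μ : Fin 4)
    (hf : ContDiffAt ℝ ∞ f (j.1, j.2.1)) (hh : ContDiffAt ℝ ∞ h (j.1, j.2.1)) :
    totalDeriv1 μ (fun k => f k + h k) j = totalDeriv1 μ f j + totalDeriv1 μ h j := by
  simp only [totalDeriv1]
  rw [fderiv_fun_add (hf.differentiableAt (by simp)) (hh.differentiableAt (by simp))]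
  rfl

theorem totalDeriv1_sub {f h : Jet1 E → ℝ} {j : Jet2 E} (μ : Fin 4)
    (hf : ContDiffAt ℝ ∞ f (j.1, j.2.1)) (hh : ContDiffAt ℝ ∞ h (j.1, j.2.1)) :
    totalDeriv1 μ (fun k => f k - h k) j = totalDeriv1 μ f j - totalDeriv1 μ h j := by
  simp only [totalDeriv1]
  rw [fderiv_fun_sub (hf.differentiableAt (by simp)) (hh.differentiableAt (by simp))]
  rfl

theorem totalDeriv1_mul {f h : Jet1 E → ℝ} {j : Jet2 E} (μ : Fin 4)
    (hf : ContDiffAt ℝ ∞ f (j.1, j.2.1)) (hh : ContDiffAt ℝ ∞ h (j.1, j.2.1)) :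
    totalDeriv1 μ (fun k => f k * h k) j
      = totalDeriv1 μ f j * h (j.1, j.2.1) + f (j.1, j.2.1) * totalDeriv1 μ h j := by
  simp only [totalDeriv1]
  rw [fderiv_fun_mul (hf.differentiableAt (by simp)) (hh.differentiableAt (by simp))]
  simp only [add_apply, smul_apply, smul_eq_mul]
  ring

theorem totalDeriv1_sum {ι : Type*} (s : Finset ι) {f : ι → Jet1 E → ℝ} {j : Jet2 E} (μ : Fin 4)
    (hf : ∀ i ∈ s, ContDiffAt ℝ ∞ (f i) (j.1, j.2.1)) :
    totalDeriv1 μ (fun k => ∑ i ∈ s, f i k) j = ∑ i ∈ s, totalDeriv1 μ (f i) j := by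
  simp only [totalDeriv1]
  rw [fderiv_fun_sum fun i hi => (hf i hi).differentiableAt (by simp)]
  simp

theorem totalDeriv1_comp_fst {f : E → ℝ} {j : Jet2 E} (μ : Fin 4)
    (hf : ContDiffAt ℝ ∞ f j.1) :
    totalDeriv1 μ (fun k => f k.1) j = fderiv ℝ f j.1 (j.2.1 μ) := by
  simp only [totalDeriv1]
  have h1 : HasFDerivAt (fun k : Jet1 E => f k.1)
      ((fderiv ℝ f j.1).comp (ContinuousLinearMap.fst ℝ E (Fin 4 → E))) (j.1, j.2.1) :=
    HasFDerivAt.comp (f := Prod.fst) (j.1, j.2.1) (hf.differentiableAt (by simp)).hasFDerivAt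
      hasFDerivAt_fst
  rw [h1.fderiv]
  rfl

end totalDeriv

/-! ### Splitting the Einstein-Hilbert Lagrangian -/

/-- The densitized inverse metric `√|g| g^{ab}`. -/
def densInv (a b : Fin 4) (u : Tensor2) : ℝ := sqrtDet u * inv u a b

theorem Adm.contDiffAt_densInv {u : Tensor2} (h : Adm u) (a b : Fin 4) :
    ContDiffAt ℝ ∞ (densInv a b) u := h.contDiffAt_sqrtDet.mul (h.contDiffAt_inv a b)

/-- The derivative `∂_λ(√|g| g^{ab})` in terms of Christoffel symbols. -/
theorem Adm.fderiv_densInv_eq {j : Jet1 Tensor2} (h : Adm j.1) (hj : SymJet1 j) (l a b : Fin 4) :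
    fderiv ℝ (densInv a b) j.1 (j.2 l) = sqrtDet j.1 * densitizedInvDeriv l a b j := by
  have h1 : densInv a b = fun u => sqrtDet u * inv u a b := rfl
  rw [h1, fderiv_fun_mul (h.contDiffAt_sqrtDet.differentiableAt (by simp))
    ((h.contDiffAt_inv a b).differentiableAt (by simp))]
  simp only [add_apply, smul_apply, smul_eq_mul,
    h.fderiv_sqrtDet_eq hj, h.fderiv_inv_eq hj, densitizedInvDeriv]
  ring

theorem Adm.totalDeriv1_ehBoundary {j : Jet2 Tensor2} (h : Adm j.1) (hj : SymJet2 j)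
    (μ : Fin 4) : totalDeriv1 μ (ehBoundary μ) j =
      (∑ a, ∑ b, (sqrtDet j.1 * densitizedInvDeriv μ a b (j.1, j.2.1)
          * christoffel μ a b (j.1, j.2.1)
        + sqrtDet j.1 * inv j.1 a b * totalDeriv1 μ (christoffel μ a b) j))
      - ∑ a, (sqrtDet j.1 * densitizedInvDeriv μ μ a (j.1, j.2.1)
          * ∑ ρ, christoffel ρ ρ a (j.1, j.2.1)
        + sqrtDet j.1 * inv j.1 μ a * ∑ ρ, totalDeriv1 μ (christoffel ρ ρ a) j) := by
  have h' : Adm (j.1, j.2.1).1 := h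
  have hF : ∀ a b, ContDiffAt ℝ ∞ (fun k : Jet1 Tensor2 => densInv a b k.1) (j.1, j.2.1) :=
    fun a b => contDiffAt_comp_fst (h'.contDiffAt_densInv a b)
  have hC : ∀ a b c, ContDiffAt ℝ ∞ (christoffel a b c) (j.1, j.2.1) := fun a b c =>
    h'.contDiffAt_christoffel a b c
  have hT : ∀ a b, totalDeriv1 μ (fun k : Jet1 Tensor2 => densInv a b k.1) j
      = sqrtDet j.1 * densitizedInvDeriv μ a b (j.1, j.2.1) := fun a b => by
    rw [totalDeriv1_comp_fst μ (h.contDiffAt_densInv a b)]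
    exact h'.fderiv_densInv_eq hj.fst μ a b
  have e : ehBoundary μ = fun k => (∑ a, ∑ b, densInv a b k.1 * christoffel μ a b k)
      - ∑ a, densInv μ a k.1 * ∑ ρ, christoffel ρ ρ a k := by
    funext k
    simp only [ehBoundary, densInv, mul_sub, Finset.mul_sum]
    congr 1
    · exact Finset.sum_congr rfl fun _ _ => Finset.sum_congr rfl fun _ _ => by ring
    · exact Finset.sum_congr rfl fun _ _ => Finset.sum_congr rfl fun _ _ => by ring
  have hS : ∀ a, ContDiffAt ℝ ∞ (fun k => ∑ ρ, christoffel ρ ρ a k) (j.1, j.2.1) := fun a =>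
    ContDiffAt.sum fun ρ _ => hC ρ ρ a
  rw [e, totalDeriv1_sub μ (ContDiffAt.sum fun a _ => ContDiffAt.sum fun b _ =>
      (hF a b).mul (hC μ a b)) (ContDiffAt.sum fun a _ => (hF μ a).mul (hS a)),
    totalDeriv1_sum _ μ fun a _ => ContDiffAt.sum fun b _ => (hF a b).mul (hC μ a b),
    totalDeriv1_sum _ μ fun a _ => (hF μ a).mul (hS a)]
  congr 1
  · refine Finset.sum_congr rfl fun a _ => ?_
    rw [totalDeriv1_sum _ μ fun b _ => (hF a b).mul (hC μ a b)]
    refine Finset.sum_congr rfl fun b _ => ?_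
    rw [totalDeriv1_mul μ (hF a b) (hC μ a b), hT]
    rfl
  · refine Finset.sum_congr rfl fun a _ => ?_
    rw [totalDeriv1_mul μ (hF μ a) (hS a), hT, totalDeriv1_sum _ μ fun ρ _ => hC ρ ρ a]
    rfl

/-- The Einstein-Hilbert Lagrangian is the gamma-gamma Lagrangian up to a divergence. -/
theorem Adm.lagEH_eq {j : Jet2 Tensor2} (h : Adm j.1) (hj : SymJet2 j) :
    lagEH j = lagGamma (j.1, j.2.1) + ∑ μ, totalDeriv1 μ (ehBoundary μ) j := by
  have h' : Adm (j.1, j.2.1).1 := h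
  have hq := h'.quadratic_eq hj.fst
  simp only [h.totalDeriv1_ehBoundary hj, lagEH, lagGamma, ricci]
  simp only [Finset.sum_add_distrib, Finset.sum_sub_distrib, mul_add, mul_sub, mul_assoc,
    ← Finset.mul_sum] at hq ⊢
  have e1 : ∑ a, ∑ b, inv j.1 a b * ∑ ρ, totalDeriv1 ρ (christoffel ρ a b) j
      = ∑ μ, ∑ a, ∑ b, inv j.1 a b * totalDeriv1 μ (christoffel μ a b) j := by
    simp only [Finset.mul_sum]
    exact (Finset.sum_congr rfl fun a _ => Finset.sum_comm).trans Finset.sum_comm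
  have e2 : ∑ a, ∑ b, inv j.1 a b * ∑ ρ, totalDeriv1 b (christoffel ρ ρ a) j
      = ∑ b, ∑ a, inv j.1 b a * ∑ ρ, totalDeriv1 b (christoffel ρ ρ a) j := by
    rw [Finset.sum_comm]
    exact Finset.sum_congr rfl fun _ _ => Finset.sum_congr rfl fun _ _ => by rw [h.inv_symm]
  rw [e1, e2]
  linear_combination sqrtDet j.1 * hq

/-! ### The trace K Lagrangian on symmetric jets -/

/-- The boundary current `-α(μν) ∂_ν√|γ(μν)| + N^μ`, whose divergence is the difference of the
trace K and the gamma-gamma Lagrangians. -/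
def boundaryCurrent (μ : Fin 4) (j : Jet1 Tensor2) : ℝ := -angleTerm μ j + normalTerm μ j

theorem Adm.contDiffAt_boundaryCurrent {j : Jet1 Tensor2} (h : Adm j.1) (μ : Fin 4) :
    ContDiffAt ℝ ∞ (boundaryCurrent μ) j :=
  (h.contDiffAt_angleTerm μ).neg.add (h.contDiffAt_normalTerm μ)

/-- Two functions of first jets that agree on symmetric jets of admissible metrics have the same
total derivatives there. -/
theorem Adm.fderiv_congr_symJet1 {f k : Jet1 Tensor2 → ℝ} {j v : Jet1 Tensor2} (h : Adm j.1)
    (hj : SymJet1 j) (hv : SymJet1 v) (hf : ContDiffAt ℝ ∞ f j) (hk : ContDiffAt ℝ ∞ k j)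
    (heq : ∀ i : Jet1 Tensor2, Adm i.1 → SymJet1 i → f i = k i) :
    fderiv ℝ f j v = fderiv ℝ k j v := by
  refine fderiv_congr_line (hf.differentiableAt (by simp)) (hk.differentiableAt (by simp)) ?_
  filter_upwards [h.eventually_line hv.zero] with s hs using heq _ hs (hj.add_smul hv s)

/-- The second-jet analogue of `Adm.fderiv_congr_symJet1`. -/
theorem Adm.fderiv_congr_symJet2 {f k : Jet2 Tensor2 → ℝ} {j v : Jet2 Tensor2} (h : Adm j.1)
    (hj : SymJet2 j) (hv : SymJet2 v) (hf : ContDiffAt ℝ ∞ f j) (hk : ContDiffAt ℝ ∞ k j)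
    (heq : ∀ i : Jet2 Tensor2, Adm i.1 → SymJet2 i → f i = k i) :
    fderiv ℝ f j v = fderiv ℝ k j v := by
  refine fderiv_congr_line (hf.differentiableAt (by simp)) (hk.differentiableAt (by simp)) ?_
  filter_upwards [h.eventually_line hv.zero] with s hs using heq _ hs (hj.add_smul hv s)

/-- The trace K Lagrangian is the gamma-gamma Lagrangian up to a divergence. -/
theorem Adm.lagK_eq {j : Jet2 Tensor2} (h : Adm j.1) (hj : SymJet2 j) :
    lagK j = lagGamma (j.1, j.2.1) + ∑ μ, totalDeriv1 μ (boundaryCurrent μ) j := by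
  have h' : Adm (j.1, j.2.1).1 := h
  have key : ∀ μ, totalDeriv1 μ (boundaryCurrent μ) j
      = totalDeriv1 μ (ehBoundary μ) j
        + 2 * totalDeriv1 μ (fun k => sqrtGamma1 μ k.1 * traceK μ k) j
        - ∑ ν ∈ Finset.univ.erase μ,
          totalDeriv1 μ (totalDeriv0 ν (fun u => sqrtGamma2 μ ν u * angle μ ν u)) j := by
    intro μ
    have c1 := h'.contDiffAt_ehBoundary μ
    have c2 := h'.contDiffAt_traceTerm μ
    have c3 : ∀ ν ∈ Finset.univ.erase μ, ContDiffAt ℝ ∞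
        (totalDeriv0 ν (fun u => sqrtGamma2 μ ν u * angle μ ν u)) (j.1, j.2.1) := fun ν hν =>
      h'.contDiffAt_angleDeriv (Finset.ne_of_mem_erase hν).symm
    have c4 : ContDiffAt ℝ ∞ (fun k : Jet1 Tensor2 => ∑ ν ∈ Finset.univ.erase μ,
        totalDeriv0 ν (fun u => sqrtGamma2 μ ν u * angle μ ν u) k) (j.1, j.2.1) :=
      ContDiffAt.sum c3
    have e : totalDeriv1 μ (boundaryCurrent μ) j
        = totalDeriv1 μ (fun k => ehBoundary μ k + 2 * (sqrtGamma1 μ k.1 * traceK μ k)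
          - ∑ ν ∈ Finset.univ.erase μ,
            totalDeriv0 ν (fun u => sqrtGamma2 μ ν u * angle μ ν u) k) j :=
      h'.fderiv_congr_symJet1 hj.fst (hj.snd μ) (h'.contDiffAt_boundaryCurrent μ)
        ((c1.add (contDiffAt_const.mul c2)).sub c4) fun i hi hi' => (hi.boundary_eq hi' μ).symm
    have e2 : totalDeriv1 μ (fun k => 2 * (sqrtGamma1 μ k.1 * traceK μ k)) j
        = 2 * totalDeriv1 μ (fun k => sqrtGamma1 μ k.1 * traceK μ k) j := by
      rw [totalDeriv1_mul μ contDiffAt_const c2]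
      simp [totalDeriv1]
    rw [e, totalDeriv1_sub μ (c1.add (contDiffAt_const.mul c2)) c4,
      totalDeriv1_add μ c1 (contDiffAt_const.mul c2), totalDeriv1_sum _ μ c3, e2]
  rw [lagK, h.lagEH_eq hj]
  simp only [key, Finset.sum_add_distrib, Finset.sum_sub_distrib, ← Finset.mul_sum]
  ring

/-- The coefficient of `∂_ν g` in the boundary current, as a linear functional of `∂_ν g`. It
vanishes for `μ = ν` and at the Minkowski metric. -/
def currentCoeff (μ ν : Fin 4) (u : Tensor2) : Tensor2 →L[ℝ] ℝ :=
  if μ = ν then 0 else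
    -(angle μ ν u • fderiv ℝ (sqrtGamma2 μ ν) u)
      + (1 / 2 * sqrtDet u * inv u μ ν) •
        ((inv u ν ν)⁻¹ • fderiv ℝ (fun u => inv u ν ν) u
          - (inv u μ μ)⁻¹ • fderiv ℝ (fun u => inv u μ μ) u)

theorem currentCoeff_self (μ : Fin 4) : currentCoeff μ μ = 0 := by
  funext u; simp [currentCoeff]

/-- On symmetric jets the boundary current is linear in first derivatives. -/
theorem Adm.boundaryCurrent_eq {j : Jet1 Tensor2} (h : Adm j.1) (hj : SymJet1 j) (μ : Fin 4) :
    boundaryCurrent μ j = ∑ ν, currentCoeff μ ν j.1 (j.2 ν) := by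
  rw [boundaryCurrent, h.normalTerm_eq hj, angleTerm, ← Finset.sum_neg_distrib,
    ← Finset.sum_erase (s := Finset.univ) (a := μ), ← Finset.sum_add_distrib,
    ← Finset.sum_erase (s := Finset.univ) (a := μ)]
  · refine Finset.sum_congr rfl fun ν hν => ?_
    simp only [currentCoeff, (Finset.ne_of_mem_erase hν).symm, if_false, totalDeriv0,
      add_apply, neg_apply, smul_apply, sub_apply, smul_eq_mul]
    ring
  · simp [currentCoeff_self]
  · simp

theorem Adm.contDiffAt_currentCoeff {u : Tensor2} (h : Adm u) (μ ν : Fin 4) :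
    ContDiffAt ℝ ∞ (currentCoeff μ ν) u := by
  by_cases hμν : μ = ν
  · subst hμν
    rw [currentCoeff_self]
    exact contDiffAt_const
  · have e : currentCoeff μ ν = fun u => -(angle μ ν u • fderiv ℝ (sqrtGamma2 μ ν) u)
      + (1 / 2 * sqrtDet u * inv u μ ν) •
        ((inv u ν ν)⁻¹ • fderiv ℝ (fun u => inv u ν ν) u
          - (inv u μ μ)⁻¹ • fderiv ℝ (fun u => inv u μ μ) u) := by
      funext w; simp only [currentCoeff, hμν, if_false]
    have hi : ∀ a, ContDiffAt ℝ ∞ (fderiv ℝ (fun u => inv u a a)) u := fun a =>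
      (h.contDiffAt_inv a a).fderiv_right (by simp)
    have hi' : ∀ a, ContDiffAt ℝ ∞ (fun u => (inv u a a)⁻¹) u := fun a =>
      (h.contDiffAt_inv a a).inv (h.inv_diag_ne a)
    rw [e]
    refine ((h.contDiffAt_angle hμν).smul
      ((h.contDiffAt_sqrtGamma2 hμν).fderiv_right (by simp))).neg.add ?_
    exact ((contDiffAt_const.mul h.contDiffAt_sqrtDet).mul (h.contDiffAt_inv μ ν)).smul
      (((hi' ν).smul (hi ν)).sub ((hi' μ).smul (hi μ)))

theorem Adm.contDiffAt_linearCurrent {j : Jet1 Tensor2} (h : Adm j.1) (μ : Fin 4) :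
    ContDiffAt ℝ ∞ (fun k : Jet1 Tensor2 => ∑ ν, currentCoeff μ ν k.1 (k.2 ν)) j := by
  refine ContDiffAt.sum fun ν _ => ?_
  have h1 : ContDiffAt ℝ ∞ (fun k : Jet1 Tensor2 => currentCoeff μ ν k.1) j :=
    (h.contDiffAt_currentCoeff μ ν).comp j contDiffAt_fst
  exact h1.clm_apply (by fun_prop)

theorem Adm.fderiv_linearCurrent {j : Jet1 Tensor2} (h : Adm j.1) (v : Jet1 Tensor2) (μ : Fin 4) :
    fderiv ℝ (fun k : Jet1 Tensor2 => ∑ ν, currentCoeff μ ν k.1 (k.2 ν)) j v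
      = ∑ ν, (fderiv ℝ (currentCoeff μ ν) j.1 v.1 (j.2 ν) + currentCoeff μ ν j.1 (v.2 ν)) := by
  have h1 : ∀ ν, HasFDerivAt (fun k : Jet1 Tensor2 => currentCoeff μ ν k.1)
      ((fderiv ℝ (currentCoeff μ ν) j.1).comp (ContinuousLinearMap.fst ℝ _ _)) j := fun ν =>
    HasFDerivAt.comp (f := Prod.fst) j
      ((h.contDiffAt_currentCoeff μ ν).differentiableAt (by simp)).hasFDerivAt hasFDerivAt_fst
  have h2 : ∀ ν, HasFDerivAt (fun k : Jet1 Tensor2 => k.2 ν)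
      ((ContinuousLinearMap.proj (R := ℝ) (φ := fun _ : Fin 4 => Tensor2) ν).comp
        (ContinuousLinearMap.snd ℝ Tensor2 (Fin 4 → Tensor2))) j := fun ν =>
    ((ContinuousLinearMap.proj (R := ℝ) (φ := fun _ : Fin 4 => Tensor2) ν).comp
        (ContinuousLinearMap.snd ℝ Tensor2 (Fin 4 → Tensor2))).hasFDerivAt
  have h3 := HasFDerivAt.fun_sum (u := Finset.univ) fun ν _ => (h1 ν).clm_apply (h2 ν)
  rw [h3.fderiv]
  simp [add_comm]

/-- The trace K Lagrangian in a form that is manifestly smooth, linear in second derivatives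
and small near the Minkowski metric. It agrees with `lagK` on symmetric jets. -/
def reducedLag (j : Jet2 Tensor2) : ℝ :=
  lagGamma (j.1, j.2.1) + ∑ μ, ∑ ν,
    (fderiv ℝ (currentCoeff μ ν) j.1 (j.2.1 μ) (j.2.1 ν) + currentCoeff μ ν j.1 (j.2.2 μ ν))

theorem Adm.lagK_eq_reducedLag {j : Jet2 Tensor2} (h : Adm j.1) (hj : SymJet2 j) :
    lagK j = reducedLag j := by
  rw [h.lagK_eq hj, reducedLag]
  congr 1
  refine Finset.sum_congr rfl fun μ _ => ?_
  have h' : Adm (j.1, j.2.1).1 := h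
  have e : totalDeriv1 μ (boundaryCurrent μ) j
      = totalDeriv1 μ (fun k => ∑ ν, currentCoeff μ ν k.1 (k.2 ν)) j :=
    h'.fderiv_congr_symJet1 hj.fst (hj.snd μ) (h'.contDiffAt_boundaryCurrent μ)
      (h'.contDiffAt_linearCurrent μ) fun i hi hi' => hi.boundaryCurrent_eq hi' μ
  rw [e]
  exact h'.fderiv_linearCurrent (j.2.1 μ, j.2.2 μ) μ

/-! ### Jets of fields -/

theorem minSmoothness_two_le_infty : minSmoothness ℝ 2 ≤ (∞ : WithTop ℕ∞) := by
  rw [minSmoothness_of_isRCLikeNormedField]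
  exact WithTop.coe_le_coe.mpr le_top

section fields

variable {E : Type} [NormedAddCommGroup E] [NormedSpace ℝ E] {φ δ : Spacetime → E}

theorem contDiff_pd (h : ContDiff ℝ ∞ φ) (μ : Fin 4) : ContDiff ℝ ∞ (pd μ φ) := by
  unfold pd
  exact (h.fderiv_right (m := ∞) (by simp)).clm_apply contDiff_const

theorem contDiff_jet1 (h : ContDiff ℝ ∞ φ) : ContDiff ℝ ∞ (jet1 φ) :=
  h.prodMk (contDiff_pi.mpr fun μ => contDiff_pd h μ)

theorem contDiff_jet2 (h : ContDiff ℝ ∞ φ) : ContDiff ℝ ∞ (jet2 φ) :=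
  h.prodMk ((contDiff_pi.mpr fun μ => contDiff_pd h μ).prodMk
    (contDiff_pi.mpr fun μ => contDiff_pi.mpr fun ν => contDiff_pd (contDiff_pd h ν) μ))

theorem pd_comm (h : ContDiff ℝ ∞ φ) (μ ν : Fin 4) (x : Spacetime) :
    pd μ (pd ν φ) x = pd ν (pd μ φ) x := by
  have hd : DifferentiableAt ℝ (fderiv ℝ φ) x :=
    (h.fderiv_right (m := ∞) (by simp)).differentiable (by simp) x
  have e : ∀ a b, pd a (pd b φ) x
      = fderiv ℝ (fderiv ℝ φ) x (Pi.single a 1) (Pi.single b 1) := by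
    intro a b
    have h1 := hd.hasFDerivAt.clm_apply (hasFDerivAt_const (Pi.single b 1 : Spacetime) x)
    change fderiv ℝ (fun y => fderiv ℝ φ y (Pi.single b 1)) x (Pi.single a 1) = _
    rw [h1.fderiv]
    simp
  rw [e, e]
  exact (h.contDiffAt.isSymmSndFDerivAt minSmoothness_two_le_infty).eq _ _

theorem pd_pi {n : Type} [Fintype n] {F : n → Type} [∀ i, NormedAddCommGroup (F i)]
    [∀ i, NormedSpace ℝ (F i)] {ψ : Spacetime → ∀ i, F i} {x : Spacetime}
    (h : DifferentiableAt ℝ ψ x) (μ : Fin 4) (i : n) :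
    pd μ ψ x i = pd μ (fun y => ψ y i) x := by
  simp only [pd]
  rw [fderiv_apply h]
  rfl

theorem pd_jet1 (h : ContDiff ℝ ∞ φ) (μ : Fin 4) (x : Spacetime) :
    pd μ (jet1 φ) x = (pd μ φ x, fun ν => pd μ (pd ν φ) x) := by
  have h1 : HasFDerivAt (jet1 φ) ((fderiv ℝ φ x).prod
      (ContinuousLinearMap.pi fun ν => fderiv ℝ (pd ν φ) x)) x :=
    ((h.differentiable (by simp) x).hasFDerivAt).prodMk
      (hasFDerivAt_pi.mpr fun ν => ((contDiff_pd h ν).differentiable (by simp) x).hasFDerivAt)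
  rw [pd, h1.fderiv]
  rfl

theorem pd_comp {F G : Type} [NormedAddCommGroup F] [NormedSpace ℝ F] [NormedAddCommGroup G]
    [NormedSpace ℝ G] {f : F → G} {ψ : Spacetime → F} {x : Spacetime}
    (hf : DifferentiableAt ℝ f (ψ x)) (hψ : DifferentiableAt ℝ ψ x) (μ : Fin 4) :
    pd μ (fun y => f (ψ y)) x = fderiv ℝ f (ψ x) (pd μ ψ x) := by
  have := (hf.hasFDerivAt.comp x hψ.hasFDerivAt).fderiv
  simp only [pd]
  rw [show (fun y => f (ψ y)) = f ∘ ψ from rfl, this]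
  rfl

theorem pd_comp_jet1 {f : Jet1 E → ℝ} {x : Spacetime} (h : ContDiff ℝ ∞ φ)
    (hf : ContDiffAt ℝ ∞ f (jet1 φ x)) (μ : Fin 4) :
    pd μ (fun y => f (jet1 φ y)) x = totalDeriv1 μ f (jet2 φ x) := by
  rw [pd_comp (hf.differentiableAt (by simp)) ((contDiff_jet1 h).differentiable (by simp) x),
    pd_jet1 h]
  rfl

/-- The variation of a total derivative is the total derivative of the variation. -/
theorem variation2_totalDeriv1 {f : Jet1 E → ℝ} {x : Spacetime} (hφ : ContDiff ℝ ∞ φ)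
    (hδ : ContDiff ℝ ∞ δ) (hf : ContDiffAt ℝ ∞ f (jet1 φ x)) (μ : Fin 4) :
    variation2 (totalDeriv1 μ f) φ δ x = pd μ (fun y => variation1 f φ δ y) x := by
  have hf' : ContDiffAt ℝ ∞ (fderiv ℝ f) (jet1 φ x) := hf.fderiv_right (by simp)
  have hd := (hf'.differentiableAt (by simp)).hasFDerivAt
  -- left side
  let π : Jet2 E →L[ℝ] Jet1 E := (ContinuousLinearMap.fst ℝ _ _).prod
    ((ContinuousLinearMap.fst ℝ _ _).comp (ContinuousLinearMap.snd ℝ _ _))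
  let τ : Jet2 E →L[ℝ] Jet1 E :=
    ((ContinuousLinearMap.proj (R := ℝ) (φ := fun _ : Fin 4 => E) μ).comp
      ((ContinuousLinearMap.fst ℝ _ _).comp (ContinuousLinearMap.snd ℝ _ _))).prod
    ((ContinuousLinearMap.proj (R := ℝ) (φ := fun _ : Fin 4 => Fin 4 → E) μ).comp
      ((ContinuousLinearMap.snd ℝ _ _).comp (ContinuousLinearMap.snd ℝ _ _)))
  have h1 : HasFDerivAt (fun j : Jet2 E => fderiv ℝ f (π j))
      ((fderiv ℝ (fderiv ℝ f) (jet1 φ x)).comp π) (jet2 φ x) :=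
    HasFDerivAt.comp (f := π) (jet2 φ x) hd π.hasFDerivAt
  have h2 := h1.clm_apply τ.hasFDerivAt
  have h3 : totalDeriv1 μ f = fun j : Jet2 E => fderiv ℝ f (π j) (τ j) := rfl
  have hjφ := ((contDiff_jet1 hφ).differentiable (by simp) x).hasFDerivAt
  have hjδ := ((contDiff_jet1 hδ).differentiable (by simp) x).hasFDerivAt
  have h4 : HasFDerivAt (fun y => fderiv ℝ f (jet1 φ y))
      ((fderiv ℝ (fderiv ℝ f) (jet1 φ x)).comp (fderiv ℝ (jet1 φ) x)) x := hd.comp x hjφ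
  have h5 := h4.clm_apply hjδ
  rw [variation2, h3, h2.fderiv]
  simp only [pd, variation1]
  rw [h5.fderiv]
  have hs := (hf.isSymmSndFDerivAt minSmoothness_two_le_infty).eq (jet1 δ x) (τ (jet2 φ x))
  have e1 : fderiv ℝ (jet1 φ) x (Pi.single μ 1) = τ (jet2 φ x) := pd_jet1 hφ μ x
  have e2 : fderiv ℝ (jet1 δ) x (Pi.single μ 1) = τ (jet2 δ x) := pd_jet1 hδ μ x
  have e3 : π (jet2 δ x) = jet1 δ x := rfl
  have e4 : π (jet2 φ x) = jet1 φ x := rfl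
  simp only [add_apply, ContinuousLinearMap.comp_apply, ContinuousLinearMap.flip_apply, e1, e2, e3,
    e4, hs]

end fields

/-! ### The gamma-gamma Lagrangian under infinitesimal diffeomorphisms -/

theorem sum3_swap12 {ι : Type*} [Fintype ι] (f : ι → ι → ι → ℝ) :
    ∑ a, ∑ b, ∑ c, f a b c = ∑ a, ∑ b, ∑ c, f b a c := Finset.sum_comm

theorem sum3_swap23 {ι : Type*} [Fintype ι] (f : ι → ι → ι → ℝ) :
    ∑ a, ∑ b, ∑ c, f a b c = ∑ a, ∑ b, ∑ c, f a c b :=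
  Finset.sum_congr rfl fun _ _ => Finset.sum_comm

theorem sum3_swap13 {ι : Type*} [Fintype ι] (f : ι → ι → ι → ℝ) :
    ∑ a, ∑ b, ∑ c, f a b c = ∑ a, ∑ b, ∑ c, f c b a :=
  (sum3_swap12 _).trans ((sum3_swap23 _).trans (sum3_swap12 _))

theorem Adm.fderiv_christoffel {j : Jet1 Tensor2} (h : Adm j.1) (d : Jet1 Tensor2)
    (ρ μ ν : Fin 4) : fderiv ℝ (christoffel ρ μ ν) j d
      = ∑ σ, (fderiv ℝ (fun u => inv u ρ σ) j.1 d.1 * chrLow σ μ ν j.2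
        + inv j.1 ρ σ * chrLow σ μ ν d.2) := by
  have e : christoffel ρ μ ν = fun k => ∑ σ, inv k.1 ρ σ * chrLow σ μ ν k.2 := by
    funext k; exact christoffel_eq ρ μ ν k
  refine fderiv_eq_of_hasDerivAt_line
    ((h.contDiffAt_christoffel ρ μ ν).differentiableAt (by simp)) ?_
  rw [e]
  have h1 : ∀ σ, HasDerivAt (fun s : ℝ => chrLow σ μ ν (j + s • d).2) (chrLow σ μ ν d.2) 0 := by
    intro σ
    have : (fun s : ℝ => chrLow σ μ ν (j + s • d).2)
        = fun s : ℝ => chrLow σ μ ν j.2 + s * chrLow σ μ ν d.2 := by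
      funext s; simp [chrLow]; ring
    rw [this]
    simpa using ((hasDerivAt_id (0 : ℝ)).mul_const (chrLow σ μ ν d.2)).const_add
      (chrLow σ μ ν j.2)
  have h2 := HasDerivAt.fun_sum (u := Finset.univ) fun σ _ =>
    (h.hasDerivAt_inv d.1 ρ σ).fun_mul (h1 σ)
  simpa using h2

/-- The quadratic form `Γ^ρ_{μσ} Γ^σ_{ρν} - Γ^ρ_{μν} Γ^σ_{ρσ}` in an array `Γ`. -/
def gammaForm (Γ : Fin 4 → Fin 4 → Fin 4 → ℝ) (μ ν : Fin 4) : ℝ :=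
  ∑ ρ, ∑ σ, (Γ ρ μ σ * Γ σ ρ ν - Γ ρ μ ν * Γ σ ρ σ)

/-- The derivative of `gammaForm` in the direction `H`. -/
def gammaFormDeriv (Γ H : Fin 4 → Fin 4 → Fin 4 → ℝ) (μ ν : Fin 4) : ℝ :=
  ∑ ρ, ∑ σ, (H ρ μ σ * Γ σ ρ ν + Γ ρ μ σ * H σ ρ ν - (H ρ μ ν * Γ σ ρ σ + Γ ρ μ ν * H σ ρ σ))

theorem Adm.fderiv_lagGamma {j : Jet1 Tensor2} (h : Adm j.1) (d : Jet1 Tensor2) :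
    fderiv ℝ lagGamma j d = fderiv ℝ sqrtDet j.1 d.1 *
        (∑ μ, ∑ ν, inv j.1 μ ν * gammaForm (fun a b c => christoffel a b c j) μ ν)
      + sqrtDet j.1 * ∑ μ, ∑ ν,
        (fderiv ℝ (fun u => inv u μ ν) j.1 d.1 * gammaForm (fun a b c => christoffel a b c j) μ ν
          + inv j.1 μ ν * gammaFormDeriv (fun a b c => christoffel a b c j)
            (fun a b c => fderiv ℝ (christoffel a b c) j d) μ ν) := by
  refine fderiv_eq_of_hasDerivAt_line (h.contDiffAt_lagGamma.differentiableAt (by simp)) ?_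
  have hΓ : ∀ a b c, HasDerivAt (fun s : ℝ => christoffel a b c (j + s • d))
      (fderiv ℝ (christoffel a b c) j d) 0 := fun a b c =>
    ((h.contDiffAt_christoffel a b c).differentiableAt (by simp)).hasFDerivAt.hasLineDerivAt d
  have hS : HasDerivAt (fun s : ℝ => sqrtDet (j.1 + s • d.1)) (fderiv ℝ sqrtDet j.1 d.1) 0 :=
    (h.contDiffAt_sqrtDet.differentiableAt (by simp)).hasFDerivAt.hasLineDerivAt d.1
  have hM : ∀ μ ν, HasDerivAt
      (fun s : ℝ => gammaForm (fun a b c => christoffel a b c (j + s • d)) μ ν)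
      (gammaFormDeriv (fun a b c => christoffel a b c j)
            (fun a b c => fderiv ℝ (christoffel a b c) j d) μ ν) 0 := by
    intro μ ν
    have := HasDerivAt.fun_sum (u := Finset.univ) fun ρ _ =>
      HasDerivAt.fun_sum (u := Finset.univ) fun σ _ =>
        ((hΓ ρ μ σ).fun_mul (hΓ σ ρ ν)).fun_sub ((hΓ ρ μ ν).fun_mul (hΓ σ ρ σ))
    simpa [gammaForm, gammaFormDeriv] using this
  have := hS.fun_mul (HasDerivAt.fun_sum (u := Finset.univ) fun μ _ =>
      HasDerivAt.fun_sum (u := Finset.univ) fun ν _ =>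
        (h.hasDerivAt_inv d.1 μ ν).fun_mul (hM μ ν))
  refine HasDerivAt.congr_deriv (f := fun s : ℝ => lagGamma (j + s • d)) this ?_
  simp

/-- The infinitesimal action of `A ∈ gl(4)` on covariant 2-tensors. -/
def glTensor (A : Fin 4 → Fin 4 → ℝ) (u : Tensor2) : Tensor2 := fun μ ν =>
  ∑ ρ, (u μ ρ * A ρ ν + u ρ ν * A ρ μ)

/-- The infinitesimal action of `A ∈ gl(4)` on first jets of covariant 2-tensors. -/
def glJet (A : Fin 4 → Fin 4 → ℝ) (j : Jet1 Tensor2) : Jet1 Tensor2 :=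
  (glTensor A j.1, fun l => glTensor A (j.2 l) + ∑ ρ, A ρ l • j.2 ρ)

theorem Adm.fderiv_inv_glTensor {u : Tensor2} (h : Adm u) (A : Fin 4 → Fin 4 → ℝ) (a b : Fin 4) :
    fderiv ℝ (fun u => inv u a b) u (glTensor A u)
      = -∑ c, (A a c * inv u c b + A b c * inv u a c) := by
  rw [fderiv_inv h.det_ne]
  congr 1
  simp only [glTensor, Finset.mul_sum, Finset.sum_mul, mul_add, add_mul, Finset.sum_add_distrib]
  congr 1
  · have e : ∑ i, ∑ k, ∑ c, inv u a i * (u i c * A c k) * inv u k b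
        = ∑ k, ∑ c, ∑ i, inv u a i * u i c * (A c k * inv u k b) :=
      (sum3_swap12 _).trans ((sum3_swap23 _).trans (Finset.sum_congr rfl fun _ _ =>
        Finset.sum_congr rfl fun _ _ => Finset.sum_congr rfl fun _ _ => by ring))
    rw [e]
    simp only [← Finset.sum_mul, sum_inv_mul h.det_ne]
    simp
  · have e : ∑ i, ∑ k, ∑ c, inv u a i * (u c k * A c i) * inv u k b
        = ∑ i, ∑ c, ∑ k, inv u a i * A c i * (u c k * inv u k b) :=
      (sum3_swap23 _).trans (Finset.sum_congr rfl fun _ _ =>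
        Finset.sum_congr rfl fun _ _ => Finset.sum_congr rfl fun _ _ => by ring)
    rw [e]
    simp only [← Finset.mul_sum, sum_mul_inv h.det_ne]
    simp [mul_comm]

theorem chrLow_glJet (A : Fin 4 → Fin 4 → ℝ) (j : Jet1 Tensor2) (σ μ ν : Fin 4) :
    chrLow σ μ ν (glJet A j).2 = ∑ a, (A a σ * chrLow a μ ν j.2 + A a μ * chrLow σ a ν j.2
      + A a ν * chrLow σ μ a j.2) := by
  simp only [chrLow, glJet, glTensor, Pi.add_apply, Finset.sum_apply, Pi.smul_apply, smul_eq_mul,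
    ← Finset.sum_add_distrib, ← Finset.sum_sub_distrib, Finset.mul_sum]
  exact Finset.sum_congr rfl fun a _ => by ring

theorem Adm.fderiv_christoffel_glJet {j : Jet1 Tensor2} (h : Adm j.1)
    (A : Fin 4 → Fin 4 → ℝ) (ρ μ ν : Fin 4) :
    fderiv ℝ (christoffel ρ μ ν) j (glJet A j)
      = ∑ a, (A a μ * christoffel ρ a ν j + A a ν * christoffel ρ μ a j
        - A ρ a * christoffel a μ ν j) := by
  rw [h.fderiv_christoffel]
  have e1 : ∀ σ, fderiv ℝ (fun u => inv u ρ σ) j.1 (glJet A j).1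
      = -∑ c, (A ρ c * inv j.1 c σ + A σ c * inv j.1 ρ c) := fun σ =>
    h.fderiv_inv_glTensor A ρ σ
  simp only [e1, chrLow_glJet, christoffel_eq, neg_mul, Finset.sum_mul, Finset.mul_sum, add_mul,
    mul_add, Finset.sum_add_distrib, Finset.sum_sub_distrib, Finset.sum_neg_distrib]
  have s1 : ∑ σ, ∑ c, A ρ c * inv j.1 c σ * chrLow σ μ ν j.2
      = ∑ a, ∑ σ, A ρ a * (inv j.1 a σ * chrLow σ μ ν j.2) := by
    rw [Finset.sum_comm]
    exact Finset.sum_congr rfl fun _ _ => Finset.sum_congr rfl fun _ _ => by ring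
  have s2 : ∑ σ, ∑ c, A σ c * inv j.1 ρ c * chrLow σ μ ν j.2
      = ∑ σ, ∑ a, inv j.1 ρ σ * (A a σ * chrLow a μ ν j.2) := by
    rw [Finset.sum_comm]
    exact Finset.sum_congr rfl fun _ _ => Finset.sum_congr rfl fun _ _ => by ring
  have s3 : ∑ σ, ∑ a, inv j.1 ρ σ * (A a μ * chrLow σ a ν j.2)
      = ∑ a, ∑ σ, A a μ * (inv j.1 ρ σ * chrLow σ a ν j.2) := by
    rw [Finset.sum_comm]
    exact Finset.sum_congr rfl fun _ _ => Finset.sum_congr rfl fun _ _ => by ring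
  have s4 : ∑ σ, ∑ a, inv j.1 ρ σ * (A a ν * chrLow σ μ a j.2)
      = ∑ a, ∑ σ, A a ν * (inv j.1 ρ σ * chrLow σ μ a j.2) := by
    rw [Finset.sum_comm]
    exact Finset.sum_congr rfl fun _ _ => Finset.sum_congr rfl fun _ _ => by ring
  rw [s1, s2, s3, s4]
  ring

/-- `gammaForm` is a covariant 2-tensor under the `gl(4)` action on arrays `Γ^ρ_{μν}`. -/
theorem gammaFormDeriv_gl (Γ : Fin 4 → Fin 4 → Fin 4 → ℝ) (A : Fin 4 → Fin 4 → ℝ) (μ ν : Fin 4) :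
    gammaFormDeriv Γ (fun ρ μ ν => ∑ a, (A a μ * Γ ρ a ν + A a ν * Γ ρ μ a - A ρ a * Γ a μ ν)) μ ν
      = ∑ a, (A a μ * gammaForm Γ a ν + A a ν * gammaForm Γ μ a) := by
  simp only [gammaFormDeriv, gammaForm, Finset.mul_sum, Finset.sum_mul, add_mul, sub_mul, mul_add,
    mul_sub, Finset.sum_add_distrib, Finset.sum_sub_distrib]
  -- the contracted indices cancel in pairs
  have c1 : ∑ ρ, ∑ σ, ∑ a, A ρ a * Γ a μ σ * Γ σ ρ ν
      = ∑ ρ, ∑ σ, ∑ a, Γ ρ μ σ * (A a ρ * Γ σ a ν) :=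
    (sum3_swap13 _).trans (Finset.sum_congr rfl fun _ _ => Finset.sum_congr rfl fun _ _ =>
      Finset.sum_congr rfl fun _ _ => by ring)
  have c2 : ∑ ρ, ∑ σ, ∑ a, A a σ * Γ ρ μ a * Γ σ ρ ν
      = ∑ ρ, ∑ σ, ∑ a, Γ ρ μ σ * (A σ a * Γ a ρ ν) :=
    (sum3_swap23 _).trans (Finset.sum_congr rfl fun _ _ => Finset.sum_congr rfl fun _ _ =>
      Finset.sum_congr rfl fun _ _ => by ring)
  have c3 : ∑ ρ, ∑ σ, ∑ a, A ρ a * Γ a μ ν * Γ σ ρ σ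
      = ∑ ρ, ∑ σ, ∑ a, Γ ρ μ ν * (A a ρ * Γ σ a σ) :=
    (sum3_swap13 _).trans (Finset.sum_congr rfl fun _ _ => Finset.sum_congr rfl fun _ _ =>
      Finset.sum_congr rfl fun _ _ => by ring)
  have c4 : ∑ ρ, ∑ σ, ∑ a, Γ ρ μ ν * (A a σ * Γ σ ρ a)
      = ∑ ρ, ∑ σ, ∑ a, Γ ρ μ ν * (A σ a * Γ a ρ σ) :=
    (sum3_swap23 _)
  have d : ∀ f : Fin 4 → Fin 4 → Fin 4 → ℝ,
      ∑ a, ∑ ρ, ∑ σ, f a ρ σ = ∑ ρ, ∑ σ, ∑ a, f a ρ σ := fun f =>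
    (sum3_swap12 _).trans (sum3_swap23 _)
  have d1 : ∑ a, ∑ ρ, ∑ σ, A a μ * (Γ ρ a σ * Γ σ ρ ν)
      = ∑ ρ, ∑ σ, ∑ a, A a μ * Γ ρ a σ * Γ σ ρ ν := by rw [d]; simp only [mul_assoc]
  have d2 : ∑ a, ∑ ρ, ∑ σ, A a μ * (Γ ρ a ν * Γ σ ρ σ)
      = ∑ ρ, ∑ σ, ∑ a, A a μ * Γ ρ a ν * Γ σ ρ σ := by rw [d]; simp only [mul_assoc]
  have d3 : ∑ a, ∑ ρ, ∑ σ, A a ν * (Γ ρ μ σ * Γ σ ρ a)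
      = ∑ ρ, ∑ σ, ∑ a, Γ ρ μ σ * (A a ν * Γ σ ρ a) := by
    rw [d]; simp only [mul_left_comm]
  have d4 : ∑ a, ∑ ρ, ∑ σ, A a ν * (Γ ρ μ a * Γ σ ρ σ)
      = ∑ ρ, ∑ σ, ∑ a, A a ν * Γ ρ μ a * Γ σ ρ σ := by rw [d]; simp only [mul_assoc]
  rw [d1, d2, d3, d4, c1, c2, c3, c4]
  ring

/-- Invariance of the contraction `g^{μν} M_{μν}` under the infinitesimal `gl(4)` action. -/
theorem contraction_gl (G M A : Fin 4 → Fin 4 → ℝ) :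
    ∑ μ, ∑ ν, (-(∑ c, (A μ c * G c ν + A ν c * G μ c)) * M μ ν
      + G μ ν * ∑ a, (A a μ * M a ν + A a ν * M μ a)) = 0 := by
  simp only [neg_mul, Finset.mul_sum, Finset.sum_mul, add_mul, mul_add, Finset.sum_add_distrib,
    Finset.sum_neg_distrib]
  have c1 : ∑ μ, ∑ ν, ∑ c, A μ c * G c ν * M μ ν = ∑ μ, ∑ ν, ∑ a, G μ ν * (A a μ * M a ν) :=
    (sum3_swap13 _).trans (Finset.sum_congr rfl fun _ _ => Finset.sum_congr rfl fun _ _ =>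
      Finset.sum_congr rfl fun _ _ => by ring)
  have c2 : ∑ μ, ∑ ν, ∑ c, A ν c * G μ c * M μ ν = ∑ μ, ∑ ν, ∑ a, G μ ν * (A a ν * M μ a) :=
    (sum3_swap23 _).trans (Finset.sum_congr rfl fun _ _ => Finset.sum_congr rfl fun _ _ =>
      Finset.sum_congr rfl fun _ _ => by ring)
  rw [c1, c2]; ring

/-- Under linear coordinate changes the gamma-gamma Lagrangian is a scalar density. -/
theorem Adm.fderiv_lagGamma_glJet {j : Jet1 Tensor2} (h : Adm j.1) (A : Fin 4 → Fin 4 → ℝ) :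
    fderiv ℝ lagGamma j (glJet A j) = (∑ a, A a a) * lagGamma j := by
  rw [h.fderiv_lagGamma]
  have e1 : fderiv ℝ sqrtDet j.1 (glJet A j).1 = sqrtDet j.1 * ∑ a, A a a := by
    rw [fderiv_sqrtDet h.det_ne]
    simp only [glJet, glTensor, Finset.mul_sum, mul_add, Finset.sum_add_distrib]
    have t1 : ∑ a, ∑ b, ∑ c, 1 / 2 * sqrtDet j.1 * (inv j.1 a b * (j.1 b c * A c a))
        = ∑ a, ∑ c, ∑ b, inv j.1 a b * j.1 b c * (1 / 2 * sqrtDet j.1 * A c a) :=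
      (sum3_swap23 _).trans (Finset.sum_congr rfl fun _ _ => Finset.sum_congr rfl fun _ _ =>
        Finset.sum_congr rfl fun _ _ => by ring)
    have t2 : ∑ a, ∑ b, ∑ c, 1 / 2 * sqrtDet j.1 * (inv j.1 a b * (j.1 c a * A c b))
        = ∑ b, ∑ c, ∑ a, j.1 c a * inv j.1 a b * (1 / 2 * sqrtDet j.1 * A c b) :=
      (sum3_swap12 _).trans ((sum3_swap23 _).trans (Finset.sum_congr rfl fun _ _ =>
        Finset.sum_congr rfl fun _ _ => Finset.sum_congr rfl fun _ _ => by ring))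
    rw [t1, t2]
    simp only [← Finset.sum_mul, sum_mul_inv h.det_ne, sum_inv_mul h.det_ne]
    simp only [ite_mul, one_mul, zero_mul, Finset.sum_ite_eq, Finset.sum_ite_eq',
      Finset.mem_univ, if_true, ← Finset.sum_add_distrib]
    exact Finset.sum_congr rfl fun _ _ => by ring
  have e2 : ∀ μ ν, fderiv ℝ (fun u => inv u μ ν) j.1 (glJet A j).1
      = -∑ c, (A μ c * inv j.1 c ν + A ν c * inv j.1 μ c) := fun μ ν =>
    h.fderiv_inv_glTensor A μ ν
  simp only [e1, e2, h.fderiv_christoffel_glJet A]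
  have e3 := fun μ ν => gammaFormDeriv_gl (fun a b c => christoffel a b c j) A μ ν
  simp only [e3]
  rw [contraction_gl]
  simp only [lagGamma, gammaForm]
  ring

/-- The change of the first jet of the metric due to the second derivatives
`H ρ μ ν = ∂_μ∂_ν ε^ρ` of a vector field. -/
def hessJet (H : Fin 4 → Fin 4 → Fin 4 → ℝ) (u : Tensor2) : Jet1 Tensor2 :=
  (0, fun l μ ν => ∑ ρ, (u μ ρ * H ρ l ν + u ρ ν * H ρ l μ))

/-- Second derivatives of a vector field shift the Christoffel symbols by `∂_μ∂_ν ε^ρ`. -/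
theorem Adm.fderiv_christoffel_hessJet {j : Jet1 Tensor2} (h : Adm j.1)
    {H : Fin 4 → Fin 4 → Fin 4 → ℝ} (hH : ∀ ρ μ ν, H ρ μ ν = H ρ ν μ) (ρ μ ν : Fin 4) :
    fderiv ℝ (christoffel ρ μ ν) j (hessJet H j.1) = H ρ μ ν := by
  rw [h.fderiv_christoffel]
  have e : ∀ σ, chrLow σ μ ν (hessJet H j.1).2 = ∑ a, j.1 σ a * H a μ ν := by
    intro σ
    simp only [chrLow, hessJet, ← Finset.sum_add_distrib, ← Finset.sum_sub_distrib, Finset.mul_sum]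
    refine Finset.sum_congr rfl fun a _ => ?_
    rw [h.symm a ν, h.symm a μ, hH a μ σ, hH a ν μ, hH a ν σ]
    ring
  have e0 : (hessJet H j.1).1 = 0 := rfl
  simp only [e, e0, map_zero, zero_mul, zero_add, Finset.mul_sum, ← mul_assoc]
  rw [Finset.sum_comm]
  simp only [← Finset.sum_mul, sum_inv_mul h.det_ne]
  simp

/-- The response of the gamma-gamma Lagrangian to `∂_μ∂_ν ε^ρ`, with coefficients that are derivatives
of `√|g| g^{ab}`. -/
theorem Adm.fderiv_lagGamma_hessJet {j : Jet1 Tensor2} (h : Adm j.1) (hj : SymJet1 j)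
    {H : Fin 4 → Fin 4 → Fin 4 → ℝ} (hH : ∀ ρ μ ν, H ρ μ ν = H ρ ν μ) :
    fderiv ℝ lagGamma j (hessJet H j.1)
      = (∑ l, ∑ a, (sqrtDet j.1 * densitizedInvDeriv l l a j) * ∑ ν, H ν ν a)
        - ∑ l, ∑ a, ∑ b, (sqrtDet j.1 * densitizedInvDeriv l a b j) * H l a b := by
  have hG := h.inv_symm
  have hΓ := hj.christoffel_symm
  rw [h.fderiv_lagGamma]
  simp only [h.fderiv_christoffel_hessJet hH, mul_assoc, ← Finset.mul_sum]
  have e0 : (hessJet H j.1).1 = 0 := rfl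
  simp only [e0, map_zero, zero_mul, zero_add, ← mul_sub]
  congr 1
  simp only [gammaFormDeriv, densitizedInvDeriv, Finset.mul_sum, Finset.sum_mul, sub_mul, mul_sub,
    mul_add, Finset.sum_sub_distrib, Finset.sum_add_distrib]
  generalize inv j.1 = G at *
  generalize hC : (fun a b c => christoffel a b c j) = Γ
  have hC' : ∀ a b c, christoffel a b c j = Γ a b c := fun a b c => by rw [← hC]
  simp only [hC'] at hΓ ⊢
  clear hC hC'
  have s1 : ∑ l, ∑ a, ∑ b, ∑ c, Γ b l c * G c a * H l a b
      = ∑ μ, ∑ ν, ∑ ρ, ∑ σ, G μ ν * (H ρ μ σ * Γ σ ρ ν) := by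
    refine (sum4_swap34 _).trans ((sum4_swap23 _).trans ((sum4_swap12 _).trans
      ((sum4_swap23 _).trans ((sum4_swap12 _).trans (sum4_congr fun a b c d => ?_)))))
    rw [hG b a]; ring
  have s2 : ∑ l, ∑ a, ∑ b, ∑ c, Γ a l c * G c b * H l a b
      = ∑ μ, ∑ ν, ∑ ρ, ∑ σ, G μ ν * (Γ ρ μ σ * H σ ρ ν) := by
    refine (sum4_swap34 _).trans ((sum4_swap23 _).trans ((sum4_swap12 _).trans
      ((sum4_swap34 _).trans ((sum4_swap23 _).trans ((sum4_swap34 _).trans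
      (sum4_congr fun a b c d => ?_))))))
    rw [hΓ c d a]; ring
  have s3 : ∑ l, ∑ a, ∑ b, ∑ c, G a b * Γ c l c * H l a b
      = ∑ μ, ∑ ν, ∑ ρ, ∑ σ, G μ ν * (H ρ μ ν * Γ σ ρ σ) := by
    refine (sum4_swap12 _).trans ((sum4_swap23 _).trans (sum4_congr fun a b c d => ?_))
    ring
  have s4 : ∑ l, ∑ a, ∑ ρ, ∑ c, Γ a l c * G c l * H ρ ρ a
      = ∑ μ, ∑ ν, ∑ ρ, ∑ σ, G μ ν * (Γ ρ μ ν * H σ ρ σ) := by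
    refine (sum4_swap34 _).trans ((sum4_swap23 _).trans (sum4_congr fun a b c d => ?_))
    rw [hG b a, hH d d c]; ring
  have s5 : ∑ l, ∑ a, ∑ ρ, ∑ c, Γ l l c * G c a * H ρ ρ a
      = ∑ l, ∑ a, ∑ ρ, ∑ c, G l a * Γ c l c * H ρ ρ a := by
    refine (sum4_swap34 _).trans ((sum4_swap23 _).trans ((sum4_swap12 _).trans
      ((sum4_swap23 _).trans ((sum4_swap34 _).trans (sum4_congr fun a b c d => ?_)))))
    rw [hΓ d d a]; ring
  simp only [s1, s2, s3, s4, s5]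
  ring

/-! ### Calculus of scalar functions on spacetime -/

section scalars

variable {f h : Spacetime → ℝ} {x : Spacetime}

theorem pd_fun_add (hf : DifferentiableAt ℝ f x) (hh : DifferentiableAt ℝ h x) (μ : Fin 4) :
    pd μ (fun y => f y + h y) x = pd μ f x + pd μ h x := by
  simp only [pd]; rw [fderiv_fun_add hf hh]; rfl

theorem pd_fun_sub (hf : DifferentiableAt ℝ f x) (hh : DifferentiableAt ℝ h x) (μ : Fin 4) :
    pd μ (fun y => f y - h y) x = pd μ f x - pd μ h x := by
  simp only [pd]; rw [fderiv_fun_sub hf hh]; rfl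

theorem pd_fun_mul (hf : DifferentiableAt ℝ f x) (hh : DifferentiableAt ℝ h x) (μ : Fin 4) :
    pd μ (fun y => f y * h y) x = pd μ f x * h x + f x * pd μ h x := by
  simp only [pd]; rw [fderiv_fun_mul hf hh]
  simp only [add_apply, smul_apply, smul_eq_mul]; ring

theorem pd_fun_sum {ι : Type*} {s : Finset ι} {F : ι → Spacetime → ℝ}
    (hF : ∀ i ∈ s, DifferentiableAt ℝ (F i) x) (μ : Fin 4) :
    pd μ (fun y => ∑ i ∈ s, F i y) x = ∑ i ∈ s, pd μ (F i) x := by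
  simp only [pd]; rw [fderiv_fun_sum hF]; simp

end scalars

theorem contDiff_coord {n : Type} [Fintype n] {ψ : Spacetime → n → ℝ} (h : ContDiff ℝ ∞ ψ)
    (i : n) : ContDiff ℝ ∞ (fun y => ψ y i) := contDiff_pi.mp h i

theorem contDiff_comp_field {E F : Type} [NormedAddCommGroup E] [NormedSpace ℝ E]
    [NormedAddCommGroup F] [NormedSpace ℝ F] {f : E → F} {ψ : Spacetime → E}
    (hψ : ContDiff ℝ ∞ ψ) (hf : ∀ x, ContDiffAt ℝ ∞ f (ψ x)) :
    ContDiff ℝ ∞ (fun y => f (ψ y)) :=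
  contDiff_iff_contDiffAt.mpr fun x => (hf x).comp x hψ.contDiffAt

theorem contDiff_variation1 {E : Type} [NormedAddCommGroup E] [NormedSpace ℝ E]
    {f : Jet1 E → ℝ} {φ δ : Spacetime → E} (hφ : ContDiff ℝ ∞ φ) (hδ : ContDiff ℝ ∞ δ)
    (hf : ∀ x, ContDiffAt ℝ ∞ f (jet1 φ x)) : ContDiff ℝ ∞ (variation1 f φ δ) := by
  have h1 : ContDiff ℝ ∞ (fun y => fderiv ℝ f (jet1 φ y)) :=
    contDiff_comp_field (contDiff_jet1 hφ) fun x => (hf x).fderiv_right (by simp)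
  exact h1.clm_apply (contDiff_jet1 hδ)

/-! ### Jets of the variation `δ_D g` -/

theorem deltaD_eq (ε : Spacetime → Fin 4 → ℝ) (g : Spacetime → Tensor2) (x : Spacetime) :
    deltaD ε g x = ∑ ρ, ε x ρ • pd ρ g x + glTensor (fun ρ ν => pd ν ε x ρ) (g x) := by
  funext μ ν
  simp only [deltaD, glTensor, Pi.add_apply, Finset.sum_apply, Pi.smul_apply, smul_eq_mul,
    ← Finset.sum_add_distrib, add_assoc]

theorem contDiff_comp2 {ψ : Spacetime → Tensor2} (h : ContDiff ℝ ∞ ψ) (μ ν : Fin 4) :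
    ContDiff ℝ ∞ (fun y => ψ y μ ν) := contDiff_pi.mp (contDiff_pi.mp h μ) ν

theorem pd_comp2 {ψ : Spacetime → Tensor2} (h : ContDiff ℝ ∞ ψ) (l μ ν : Fin 4) (x : Spacetime) :
    pd l (fun y => ψ y μ ν) x = pd l ψ x μ ν := by
  rw [pd_pi (h.differentiable (by simp) x),
    pd_pi ((contDiff_pi.mp h μ).differentiable (by simp) x)]

theorem contDiff_deltaD {ε : Spacetime → Fin 4 → ℝ} {g : Spacetime → Tensor2}
    (hε : ContDiff ℝ ∞ ε) (hg : ContDiff ℝ ∞ g) : ContDiff ℝ ∞ (deltaD ε g) := by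
  refine contDiff_pi.mpr fun μ => contDiff_pi.mpr fun ν => ContDiff.sum fun ρ _ => ?_
  exact (((contDiff_coord hε ρ).mul (contDiff_comp2 (contDiff_pd hg ρ) μ ν)).add
    ((contDiff_comp2 hg μ ρ).mul (contDiff_coord (contDiff_pd hε ν) ρ))).add
    ((contDiff_comp2 hg ρ ν).mul (contDiff_coord (contDiff_pd hε μ) ρ))

theorem isSym_pd {g : Spacetime → Tensor2} (hg : ContDiff ℝ ∞ g) (hs : ∀ x, IsSym (g x))
    (l : Fin 4) (x : Spacetime) : IsSym (pd l g x) := fun μ ν => by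
  rw [← pd_comp2 hg, ← pd_comp2 hg]
  have : (fun y => g y μ ν) = fun y => g y ν μ := funext fun y => hs y μ ν
  rw [this]

theorem symJet1_jet1 {g : Spacetime → Tensor2} (hg : ContDiff ℝ ∞ g) (hs : ∀ x, IsSym (g x))
    (x : Spacetime) : SymJet1 (jet1 g x) :=
  ⟨hs x, fun l => isSym_pd hg hs l x⟩

theorem symJet2_jet2 {g : Spacetime → Tensor2} (hg : ContDiff ℝ ∞ g) (hs : ∀ x, IsSym (g x))
    (x : Spacetime) : SymJet2 (jet2 g x) :=
  ⟨hs x, fun l => isSym_pd hg hs l x, fun k l => isSym_pd (contDiff_pd hg l)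
    (fun y => isSym_pd hg hs l y) k x⟩

theorem isSym_deltaD {ε : Spacetime → Fin 4 → ℝ} {g : Spacetime → Tensor2}
    (hg : ContDiff ℝ ∞ g) (hs : ∀ x, IsSym (g x)) (x : Spacetime) : IsSym (deltaD ε g x) :=
  fun μ ν => by
    simp only [deltaD]
    refine Finset.sum_congr rfl fun ρ _ => ?_
    rw [isSym_pd hg hs ρ x μ ν, hs x μ ρ, hs x ρ ν]; ring

/-- The first jet of `δ_D g` splits into the transport of the jet of `g` along `ε`, the linear
action of `∂ε`, and a contribution of the second derivatives of `ε`. -/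
theorem jet1_deltaD {ε : Spacetime → Fin 4 → ℝ} {g : Spacetime → Tensor2}
    (hε : ContDiff ℝ ∞ ε) (hg : ContDiff ℝ ∞ g) (x : Spacetime) :
    jet1 (deltaD ε g) x = ∑ ρ, ε x ρ • (pd ρ g x, fun l => pd l (pd ρ g) x)
      + glJet (fun ρ ν => pd ν ε x ρ) (jet1 g x)
      + hessJet (fun ρ μ ν => pd μ (pd ν ε) x ρ) (g x) := by
  refine Prod.ext ?_ ?_
  · simp only [jet1, glJet, hessJet, Prod.fst_add, Prod.fst_sum, Prod.smul_fst, add_zero]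
    exact deltaD_eq ε g x
  · funext l μ ν
    have d1 : ∀ ρ, DifferentiableAt ℝ (fun y => ε y ρ) x := fun ρ =>
      (contDiff_coord hε ρ).differentiable (by simp) x
    have d2 : ∀ ρ, DifferentiableAt ℝ (fun y => pd ρ g y μ ν) x := fun ρ =>
      (contDiff_comp2 (contDiff_pd hg ρ) μ ν).differentiable (by simp) x
    have d3 : ∀ a b, DifferentiableAt ℝ (fun y => g y a b) x := fun a b =>
      (contDiff_comp2 hg a b).differentiable (by simp) x
    have d4 : ∀ a ρ, DifferentiableAt ℝ (fun y => pd a ε y ρ) x := fun a ρ =>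
      (contDiff_coord (contDiff_pd hε a) ρ).differentiable (by simp) x
    have p1 : ∀ ρ, pd l (fun y => ε y ρ) x = pd l ε x ρ := fun ρ =>
      (pd_pi (hε.differentiable (by simp) x) l ρ).symm
    have p2 : ∀ ρ, pd l (fun y => pd ρ g y μ ν) x = pd l (pd ρ g) x μ ν := fun ρ =>
      pd_comp2 (contDiff_pd hg ρ) l μ ν x
    have p3 : ∀ a b, pd l (fun y => g y a b) x = pd l g x a b := fun a b => pd_comp2 hg l a b x
    have p4 : ∀ a ρ, pd l (fun y => pd a ε y ρ) x = pd l (pd a ε) x ρ := fun a ρ =>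
      (pd_pi ((contDiff_pd hε a).differentiable (by simp) x) l ρ).symm
    have e : (jet1 (deltaD ε g) x).2 l μ ν = pd l (fun y => ∑ ρ, (ε y ρ * pd ρ g y μ ν
        + g y μ ρ * pd ν ε y ρ + g y ρ ν * pd μ ε y ρ)) x :=
      (pd_comp2 (contDiff_deltaD hε hg) l μ ν x).symm
    rw [e, pd_fun_sum fun ρ _ => (((d1 ρ).fun_mul (d2 ρ)).fun_add
      ((d3 μ ρ).fun_mul (d4 ν ρ))).fun_add ((d3 ρ ν).fun_mul (d4 μ ρ))]
    simp only [jet1, glJet, hessJet, glTensor, Prod.snd_add, Prod.snd_sum, Prod.smul_snd,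
      Pi.add_apply, Finset.sum_apply, Pi.smul_apply, smul_eq_mul, ← Finset.sum_add_distrib]
    refine Finset.sum_congr rfl fun ρ _ => ?_
    rw [pd_fun_add (((d1 ρ).fun_mul (d2 ρ)).fun_add ((d3 μ ρ).fun_mul (d4 ν ρ)))
        ((d3 ρ ν).fun_mul (d4 μ ρ)),
      pd_fun_add ((d1 ρ).fun_mul (d2 ρ)) ((d3 μ ρ).fun_mul (d4 ν ρ)), pd_fun_mul (d1 ρ) (d2 ρ),
      pd_fun_mul (d3 μ ρ) (d4 ν ρ), pd_fun_mul (d3 ρ ν) (d4 μ ρ), p1, p2, p3, p3, p4, p4]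
    ring

/-! ### Variation of the Lagrangians -/

section metric

variable {g : Spacetime → Tensor2}

/-- The current `ε^μ L_Γ - √|g| g^{νσ} ∂_ν∂_σ ε^μ + √|g| g^{μσ} ∂_ν∂_σ ε^ν` of the gamma-gamma
Lagrangian. -/
def gammaCurrent (ε : Spacetime → Fin 4 → ℝ) (g : Spacetime → Tensor2) (μ : Fin 4)
    (y : Spacetime) : ℝ :=
  ε y μ * lagGamma (jet1 g y) - ∑ ν, ∑ σ, densInv ν σ (g y) * pd ν (pd σ ε) y μ
    + ∑ ν, ∑ σ, densInv μ σ (g y) * pd ν (pd σ ε) y ν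

theorem contDiff_lagGamma_jet1 (hg : IsAdmissibleMetric g) :
    ContDiff ℝ ∞ (fun y => lagGamma (jet1 g y)) :=
  contDiff_comp_field (contDiff_jet1 hg.smooth) fun x =>
    Adm.contDiffAt_lagGamma (j := jet1 g x) (hg.adm x)

theorem contDiff_densInv (hg : IsAdmissibleMetric g) (a b : Fin 4) :
    ContDiff ℝ ∞ (fun y => densInv a b (g y)) :=
  contDiff_comp_field hg.smooth fun x => (hg.adm x).contDiffAt_densInv a b

theorem contDiff_hess {ε : Spacetime → Fin 4 → ℝ} (hε : ContDiff ℝ ∞ ε) (a b ρ : Fin 4) :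
    ContDiff ℝ ∞ (fun y => pd a (pd b ε) y ρ) :=
  contDiff_coord (contDiff_pd (contDiff_pd hε b) a) ρ

theorem contDiff_gammaCurrent (hg : IsAdmissibleMetric g) {ε : Spacetime → Fin 4 → ℝ}
    (hε : ContDiff ℝ ∞ ε) (μ : Fin 4) : ContDiff ℝ ∞ (gammaCurrent ε g μ) := by
  refine (((contDiff_coord hε μ).mul (contDiff_lagGamma_jet1 hg)).sub ?_).add ?_
  · exact ContDiff.sum fun ν _ => ContDiff.sum fun σ _ =>
      (contDiff_densInv hg ν σ).mul (contDiff_hess hε ν σ μ)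
  · exact ContDiff.sum fun ν _ => ContDiff.sum fun σ _ =>
      (contDiff_densInv hg μ σ).mul (contDiff_hess hε ν σ ν)

theorem pd_gammaCurrent (hg : IsAdmissibleMetric g) {ε : Spacetime → Fin 4 → ℝ}
    (hε : ContDiff ℝ ∞ ε) (μ : Fin 4) (x : Spacetime) :
    pd μ (gammaCurrent ε g μ) x =
      pd μ ε x μ * lagGamma (jet1 g x) + ε x μ * totalDeriv1 μ lagGamma (jet2 g x)
      - ∑ ν, ∑ σ, (sqrtDet (g x) * densitizedInvDeriv μ ν σ (jet1 g x) * pd ν (pd σ ε) x μ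
        + densInv ν σ (g x) * pd μ (pd ν (pd σ ε)) x μ)
      + ∑ ν, ∑ σ, (sqrtDet (g x) * densitizedInvDeriv μ μ σ (jet1 g x) * pd ν (pd σ ε) x ν
        + densInv μ σ (g x) * pd μ (pd ν (pd σ ε)) x ν) := by
  have dε : DifferentiableAt ℝ (fun y => ε y μ) x :=
    (contDiff_coord hε μ).differentiable (by simp) x
  have dL := (contDiff_lagGamma_jet1 hg).differentiable (by simp) x
  have dD : ∀ a b, DifferentiableAt ℝ (fun y => densInv a b (g y)) x := fun a b =>
    (contDiff_densInv hg a b).differentiable (by simp) x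
  have dH : ∀ a b ρ, DifferentiableAt ℝ (fun y => pd a (pd b ε) y ρ) x := fun a b ρ =>
    (contDiff_hess hε a b ρ).differentiable (by simp) x
  have pD : ∀ a b, pd μ (fun y => densInv a b (g y)) x
      = sqrtDet (g x) * densitizedInvDeriv μ a b (jet1 g x) := by
    intro a b
    rw [pd_comp (((hg.adm x).contDiffAt_densInv a b).differentiableAt (by simp))
      (hg.smooth.differentiable (by simp) x)]
    exact Adm.fderiv_densInv_eq (j := jet1 g x) (hg.adm x) (symJet1_jet1 hg.smooth hg.symm x) μ a b
  have pH : ∀ a b ρ, pd μ (fun y => pd a (pd b ε) y ρ) x = pd μ (pd a (pd b ε)) x ρ :=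
    fun a b ρ => (pd_pi ((contDiff_pd (contDiff_pd hε b) a).differentiable (by simp) x) μ ρ).symm
  have pε : pd μ (fun y => ε y μ) x = pd μ ε x μ := (pd_pi (hε.differentiable (by simp) x) μ μ).symm
  have pL : pd μ (fun y => lagGamma (jet1 g y)) x = totalDeriv1 μ lagGamma (jet2 g x) :=
    pd_comp_jet1 hg.smooth (Adm.contDiffAt_lagGamma (j := jet1 g x) (hg.adm x)) μ
  have d1 : DifferentiableAt ℝ (fun y => ∑ ν, ∑ σ, densInv ν σ (g y) * pd ν (pd σ ε) y μ) x :=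
    DifferentiableAt.fun_sum fun ν _ => DifferentiableAt.fun_sum fun σ _ =>
      (dD ν σ).fun_mul (dH ν σ μ)
  have d2 : DifferentiableAt ℝ (fun y => ∑ ν, ∑ σ, densInv μ σ (g y) * pd ν (pd σ ε) y ν) x :=
    DifferentiableAt.fun_sum fun ν _ => DifferentiableAt.fun_sum fun σ _ =>
      (dD μ σ).fun_mul (dH ν σ ν)
  have e : gammaCurrent ε g μ = fun y => ε y μ * lagGamma (jet1 g y)
    - (∑ ν, ∑ σ, densInv ν σ (g y) * pd ν (pd σ ε) y μ)
    + ∑ ν, ∑ σ, densInv μ σ (g y) * pd ν (pd σ ε) y ν := rfl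
  rw [e, pd_fun_add ((dε.fun_mul dL).fun_sub d1) d2, pd_fun_sub (dε.fun_mul dL) d1, pd_fun_mul dε dL,
    pε, pL,
    pd_fun_sum fun ν _ => DifferentiableAt.fun_sum fun σ _ => (dD ν σ).fun_mul (dH ν σ μ),
    pd_fun_sum fun ν _ => DifferentiableAt.fun_sum fun σ _ => (dD μ σ).fun_mul (dH ν σ ν)]
  congr 1
  · congr 1
    refine Finset.sum_congr rfl fun ν _ => ?_
    rw [pd_fun_sum fun σ _ => (dD ν σ).fun_mul (dH ν σ μ)]
    refine Finset.sum_congr rfl fun σ _ => ?_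
    rw [pd_fun_mul (dD ν σ) (dH ν σ μ), pD, pH]
  · refine Finset.sum_congr rfl fun ν _ => ?_
    rw [pd_fun_sum fun σ _ => (dD μ σ).fun_mul (dH ν σ ν)]
    refine Finset.sum_congr rfl fun σ _ => ?_
    rw [pd_fun_mul (dD μ σ) (dH ν σ ν), pD, pH]

/-- Diffeomorphisms are symmetries of the gamma-gamma Lagrangian up to a divergence. -/
theorem variation1_lagGamma_deltaD (hg : IsAdmissibleMetric g) {ε : Spacetime → Fin 4 → ℝ}
    (hε : ContDiff ℝ ∞ ε) (x : Spacetime) :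
    variation1 lagGamma g (deltaD ε g) x = ∑ μ, pd μ (gammaCurrent ε g μ) x := by
  have ha : Adm (jet1 g x).1 := hg.adm x
  have hs := symJet1_jet1 hg.smooth hg.symm x
  have hT : ∀ ρ, fderiv ℝ lagGamma (jet1 g x) (pd ρ g x, fun l => pd l (pd ρ g) x)
      = totalDeriv1 ρ lagGamma (jet2 g x) := by
    intro ρ
    have : (fun l => pd l (pd ρ g) x) = fun l => pd ρ (pd l g) x :=
      funext fun l => pd_comm hg.smooth l ρ x
    rw [this]; rfl
  have hH : ∀ ρ μ ν, pd μ (pd ν ε) x ρ = pd ν (pd μ ε) x ρ := fun ρ μ ν => by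
    rw [pd_comm hε]
  have e2 := ha.fderiv_lagGamma_hessJet hs (H := fun ρ μ ν => pd μ (pd ν ε) x ρ) hH
  rw [variation1, jet1_deltaD hε hg.smooth, map_add, map_add, map_sum, ha.fderiv_lagGamma_glJet]
  simp only [map_smul, hT, smul_eq_mul, pd_gammaCurrent hg hε]
  change _ + fderiv ℝ lagGamma (jet1 g x) (hessJet _ (jet1 g x).1) = _
  rw [e2]
  -- third derivatives of `ε` cancel
  have e3 : ∑ μ, ∑ ν, ∑ σ, densInv ν σ (g x) * pd μ (pd ν (pd σ ε)) x μ
      = ∑ μ, ∑ ν, ∑ σ, densInv μ σ (g x) * pd μ (pd ν (pd σ ε)) x ν := by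
    refine (sum3_swap12 _).trans ?_
    refine Finset.sum_congr rfl fun μ _ => Finset.sum_congr rfl fun ν _ =>
      Finset.sum_congr rfl fun σ _ => ?_
    rw [pd_comm (contDiff_pd hε σ) ν μ]
  have e4 : ∑ μ, ∑ ν, ∑ σ, sqrtDet (g x) * densitizedInvDeriv μ μ σ (jet1 g x) * pd ν (pd σ ε) x ν
      = ∑ l, ∑ a, sqrtDet (jet1 g x).1 * densitizedInvDeriv l l a (jet1 g x)
        * ∑ ν, pd ν (pd a ε) x ν := by
    refine (sum3_swap23 _).trans ?_
    simp only [Finset.mul_sum]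
    rfl
  simp only [Finset.sum_add_distrib, Finset.sum_sub_distrib, e3, e4, ← Finset.sum_mul]
  simp only [jet1]
  ring

theorem IsAdmissibleMetric.adm_jet1 (hg : IsAdmissibleMetric g) (x : Spacetime) :
    Adm (jet1 g x).1 := hg.adm x

theorem IsAdmissibleMetric.adm_jet2 (hg : IsAdmissibleMetric g) (x : Spacetime) :
    Adm (jet2 g x).1 := hg.adm x

/-- Along a field the trace K Lagrangian is the gamma-gamma Lagrangian plus the divergence of the
boundary current. -/
theorem lagK_jet2_eq (hg : IsAdmissibleMetric g) (x : Spacetime) :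
    lagK (jet2 g x) = lagGamma (jet1 g x)
      + ∑ μ, pd μ (fun y => boundaryCurrent μ (jet1 g y)) x := by
  rw [(hg.adm_jet2 x).lagK_eq (symJet2_jet2 hg.smooth hg.symm x)]
  congr 1
  exact Finset.sum_congr rfl fun μ _ => (pd_comp_jet1 hg.smooth
    ((hg.adm_jet1 x).contDiffAt_boundaryCurrent μ) μ).symm

/-- Variation commutes with the divergence in the boundary terms. -/
theorem variation2_lagK (hg : IsAdmissibleMetric g) {δ : Spacetime → Tensor2}
    (hδ : ContDiff ℝ ∞ δ) (hδs : ∀ x, IsSym (δ x)) (x : Spacetime) :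
    variation2 lagK g δ x = variation1 lagGamma g δ x
      + ∑ μ, pd μ (fun y => variation1 (boundaryCurrent μ) g δ y) x := by
  have ha := hg.adm_jet2 x
  have ha1 := hg.adm_jet1 x
  have c1 : ContDiffAt ℝ ∞ (fun j : Jet2 Tensor2 => lagGamma (j.1, j.2.1)) (jet2 g x) :=
    contDiffAt_comp_jet1 ha1.contDiffAt_lagGamma
  have c2 : ∀ μ ∈ Finset.univ, ContDiffAt ℝ ∞ (totalDeriv1 μ (boundaryCurrent μ)) (jet2 g x) :=
    fun μ _ => contDiffAt_totalDeriv1 (ha1.contDiffAt_boundaryCurrent μ) μ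
  have e : variation2 lagK g δ x = fderiv ℝ (fun j : Jet2 Tensor2 => lagGamma (j.1, j.2.1)
      + ∑ μ, totalDeriv1 μ (boundaryCurrent μ) j) (jet2 g x) (jet2 δ x) :=
    ha.fderiv_congr_symJet2 (symJet2_jet2 hg.smooth hg.symm x) (symJet2_jet2 hδ hδs x)
      ha.contDiffAt_lagK (c1.add (ContDiffAt.sum c2)) fun i hi hi' => hi.lagK_eq hi'
  rw [e, fderiv_fun_add (c1.differentiableAt (by simp))
    ((ContDiffAt.sum c2).differentiableAt (by simp)), add_apply]
  congr 1
  · let π : Jet2 Tensor2 →L[ℝ] Jet1 Tensor2 := (ContinuousLinearMap.fst ℝ _ _).prod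
      ((ContinuousLinearMap.fst ℝ _ _).comp (ContinuousLinearMap.snd ℝ _ _))
    have h1 : HasFDerivAt (fun j : Jet2 Tensor2 => lagGamma (π j))
        ((fderiv ℝ lagGamma (jet1 g x)).comp π) (jet2 g x) :=
      HasFDerivAt.comp (f := π) (jet2 g x)
        (ha1.contDiffAt_lagGamma.differentiableAt (by simp)).hasFDerivAt π.hasFDerivAt
    change fderiv ℝ (fun j : Jet2 Tensor2 => lagGamma (π j)) _ _ = _
    rw [h1.fderiv]
    rfl
  · rw [fderiv_fun_sum fun μ hμ => (c2 μ hμ).differentiableAt (by simp)]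
    rw [sum_apply]
    exact Finset.sum_congr rfl fun μ _ =>
      variation2_totalDeriv1 hg.smooth hδ (ha1.contDiffAt_boundaryCurrent μ) μ

theorem noetherF_eq (hg : IsAdmissibleMetric g) (ε : Spacetime → Fin 4 → ℝ) (x : Spacetime)
    (μ : Fin 4) : noetherF ε g x μ
      = gammaCurrent ε g μ x + variation1 (boundaryCurrent μ) g (deltaD ε g) x := by
  have ha := hg.adm_jet1 x
  have e : variation1 (boundaryCurrent μ) g (deltaD ε g) x
      = -variation1 (angleTerm μ) g (deltaD ε g) x
        + variation1 (normalTerm μ) g (deltaD ε g) x := by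
    have e1 : boundaryCurrent μ = fun j => -angleTerm μ j + normalTerm μ j := rfl
    simp only [variation1]
    rw [e1, fderiv_fun_add ((ha.contDiffAt_angleTerm μ).neg.differentiableAt (by simp))
      ((ha.contDiffAt_normalTerm μ).differentiableAt (by simp)), fderiv_fun_neg]
    rfl
  rw [e, noetherF, gammaCurrent]
  simp only [densInv]
  ring

theorem contDiff_noetherF (hg : IsAdmissibleMetric g) {ε : Spacetime → Fin 4 → ℝ}
    (hε : ContDiff ℝ ∞ ε) (μ : Fin 4) : ContDiff ℝ ∞ (fun y => noetherF ε g y μ) := by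
  simp only [noetherF_eq hg]
  exact (contDiff_gammaCurrent hg hε μ).add (contDiff_variation1 hg.smooth
    (contDiff_deltaD hε hg.smooth) fun x => (hg.adm_jet1 x).contDiffAt_boundaryCurrent μ)

/-- Diffeomorphisms are symmetries of the trace K Lagrangian up to a divergence. -/
theorem variation2_lagK_deltaD (hg : IsAdmissibleMetric g) {ε : Spacetime → Fin 4 → ℝ}
    (hε : ContDiff ℝ ∞ ε) (x : Spacetime) :
    variation2 lagK g (deltaD ε g) x = ∑ μ, pd μ (fun y => noetherF ε g y μ) x := by
  have hδ := contDiff_deltaD hε hg.smooth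
  rw [variation2_lagK hg hδ (isSym_deltaD hg.smooth hg.symm), variation1_lagGamma_deltaD hg hε,
    ← Finset.sum_add_distrib]
  refine Finset.sum_congr rfl fun μ _ => ?_
  simp only [noetherF_eq hg]
  rw [pd_fun_add ((contDiff_gammaCurrent hg hε μ).differentiable (by simp) x)
    ((contDiff_variation1 hg.smooth hδ fun x =>
      (hg.adm_jet1 x).contDiffAt_boundaryCurrent μ).differentiable (by simp) x)]

theorem contDiff_lagK_jet2 (hg : IsAdmissibleMetric g) :
    ContDiff ℝ ∞ (fun y => lagK (jet2 g y)) :=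
  contDiff_comp_field (contDiff_jet2 hg.smooth) fun x => (hg.adm_jet2 x).contDiffAt_lagK

theorem deltaD_const (a : Fin 4 → ℝ) (g : Spacetime → Tensor2) :
    deltaD (fun _ => a) g = fun x => ∑ ρ, a ρ • pd ρ g x := by
  funext x
  have : ∀ ν, pd ν (fun _ : Spacetime => a) x = 0 := fun ν => by simp [pd]
  rw [deltaD_eq]
  simp only [this, Pi.zero_apply]
  have h0 : glTensor (fun _ _ => 0) (g x) = 0 := by
    funext μ ν; simp [glTensor]
  rw [h0, add_zero]

theorem pd_fun_smul_sum {E : Type} [NormedAddCommGroup E] [NormedSpace ℝ E] (a : Fin 4 → ℝ)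
    {F : Fin 4 → Spacetime → E} {x : Spacetime} (hF : ∀ i, DifferentiableAt ℝ (F i) x)
    (μ : Fin 4) : pd μ (fun y => ∑ i, a i • F i y) x = ∑ i, a i • pd μ (F i) x := by
  simp only [pd]
  rw [fderiv_fun_sum fun i _ => (hF i).fun_const_smul (a i)]
  simp only [sum_apply]
  refine Finset.sum_congr rfl fun i _ => ?_
  rw [fderiv_fun_const_smul (hF i)]
  rfl

/-- For translations the transported Lagrangian itself is a possible current. -/
theorem variation2_lagK_translation (hg : IsAdmissibleMetric g) (a : Fin 4 → ℝ) (x : Spacetime) :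
    variation2 lagK g (deltaD (fun _ => a) g) x
      = ∑ μ, pd μ (fun y => a μ * lagK (jet2 g y)) x := by
  have hL := (hg.adm_jet2 x).contDiffAt_lagK.differentiableAt (by simp : (∞ : WithTop ℕ∞) ≠ 0)
  have hj := (contDiff_jet2 hg.smooth).differentiable (by simp) x
  have d0 : ∀ ρ, ContDiff ℝ ∞ (pd ρ g) := fun ρ => contDiff_pd hg.smooth ρ
  have d1 : ∀ ρ σ, ContDiff ℝ ∞ (pd ρ (pd σ g)) := fun ρ σ => contDiff_pd (d0 σ) ρ
  have pj : ∀ ρ, pd ρ (jet2 g) x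
      = (pd ρ g x, (fun μ => pd ρ (pd μ g) x), fun μ ν => pd ρ (pd μ (pd ν g)) x) := by
    intro ρ
    have h1 : HasFDerivAt (jet2 g) ((fderiv ℝ g x).prod
        ((ContinuousLinearMap.pi fun μ => fderiv ℝ (pd μ g) x).prod
          (ContinuousLinearMap.pi fun μ => ContinuousLinearMap.pi fun ν =>
            fderiv ℝ (pd μ (pd ν g)) x))) x :=
      ((hg.smooth.differentiable (by simp) x).hasFDerivAt).prodMk
        ((hasFDerivAt_pi.mpr fun μ => ((d0 μ).differentiable (by simp) x).hasFDerivAt).prodMk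
          (hasFDerivAt_pi.mpr fun μ => hasFDerivAt_pi.mpr fun ν =>
            ((d1 μ ν).differentiable (by simp) x).hasFDerivAt))
    rw [pd, h1.fderiv]
    rfl
  have e1 : ∀ μ, pd μ (deltaD (fun _ => a) g) = fun y => ∑ ρ, a ρ • pd ρ (pd μ g) y := by
    intro μ
    funext y
    rw [deltaD_const, pd_fun_smul_sum a fun i => (d0 i).differentiable (by simp) y]
    exact Finset.sum_congr rfl fun ρ _ => by rw [pd_comm hg.smooth]
  have e2 : ∀ μ ν, pd μ (pd ν (deltaD (fun _ => a) g)) x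
      = ∑ ρ, a ρ • pd ρ (pd μ (pd ν g)) x := by
    intro μ ν
    rw [e1, pd_fun_smul_sum a fun i => (d1 i ν).differentiable (by simp) x]
    exact Finset.sum_congr rfl fun ρ _ => by rw [pd_comm (d0 ν)]
  have e : jet2 (deltaD (fun _ => a) g) x = ∑ ρ, a ρ • pd ρ (jet2 g) x := by
    simp only [jet2, e2, pj]
    refine Prod.ext ?_ (Prod.ext ?_ ?_)
    · simp only [Prod.fst_sum, Prod.smul_fst]
      rw [deltaD_const]
    · funext μ
      simp only [Prod.fst_sum, Prod.snd_sum, Prod.smul_fst, Prod.smul_snd, Finset.sum_apply,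
        Pi.smul_apply]
      rw [e1]
    · funext μ ν
      simp only [Prod.snd_sum, Prod.smul_snd, Finset.sum_apply, Pi.smul_apply]
  rw [variation2, e, map_sum]
  refine Finset.sum_congr rfl fun μ _ => ?_
  have h2 : pd μ (fun y => lagK (jet2 g y)) x = fderiv ℝ lagK (jet2 g x) (pd μ (jet2 g) x) :=
    pd_comp hL hj μ
  have h3 : DifferentiableAt ℝ (fun y => lagK (jet2 g y)) x :=
    (contDiff_lagK_jet2 hg).differentiable (by simp) x
  rw [map_smul, ← h2, smul_eq_mul, pd_fun_mul (differentiableAt_const _) h3]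
  simp [pd]

end metric

/-! ### Parametric integrals -/

theorem exists_bound_compact {K : Type*} [TopologicalSpace K] {C : Set K} (hC : IsCompact C)
    {f : ℝ → K → ℝ} (hf : Continuous fun p : ℝ × K => f p.1 p.2) (s : ℝ) :
    ∃ B, ∀ s' ∈ Metric.closedBall s 1, ∀ k ∈ C, ‖f s' k‖ ≤ B := by
  obtain ⟨B, hB⟩ := ((isCompact_closedBall s 1).prod hC).exists_bound_of_continuousOn
    hf.continuousOn
  exact ⟨B, fun s' hs' k hk => hB (s', k) ⟨hs', hk⟩⟩

section parametric

variable {K : Type*} [PseudoMetricSpace K] [MeasurableSpace K]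
  [BorelSpace K] {μ : Measure K} [IsFiniteMeasure μ] {C : Set K}

theorem continuous_integral_compact (hC : IsCompact C) (hμC : ∀ᵐ k ∂μ, k ∈ C)
    {f : ℝ → K → ℝ} (hf : Continuous fun p : ℝ × K => f p.1 p.2) :
    Continuous fun s => ∫ k, f s k ∂μ := by
  refine continuous_iff_continuousAt.mpr fun s => ?_
  obtain ⟨B, hB⟩ := exists_bound_compact hC hf s
  refine continuousAt_of_dominated (bound := fun _ => B) ?_ ?_ (integrable_const B) ?_
  · exact Eventually.of_forall fun s' =>
      (hf.comp (by fun_prop : Continuous fun k => (s', k))).aestronglyMeasurable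
  · filter_upwards [Metric.closedBall_mem_nhds s one_pos] with s' hs'
    filter_upwards [hμC] with k hk using hB s' hs' k hk
  · exact Eventually.of_forall fun k =>
      (hf.comp (by fun_prop : Continuous fun s' => (s', k))).continuousAt

theorem hasDerivAt_integral_compact (hC : IsCompact C) (hμC : ∀ᵐ k ∂μ, k ∈ C)
    {f f' : ℝ → K → ℝ} (hf : Continuous fun p : ℝ × K => f p.1 p.2)
    (hf' : Continuous fun p : ℝ × K => f' p.1 p.2)
    (h : ∀ s k, HasDerivAt (fun s => f s k) (f' s k) s) (s : ℝ) :
    HasDerivAt (fun s => ∫ k, f s k ∂μ) (∫ k, f' s k ∂μ) s := by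
  obtain ⟨B, hB⟩ := exists_bound_compact hC hf' s
  obtain ⟨B₀, hB₀⟩ := exists_bound_compact hC hf s
  have hm : ∀ (F : ℝ → K → ℝ), (Continuous fun p : ℝ × K => F p.1 p.2) → ∀ s',
      AEStronglyMeasurable (F s') μ := fun F hF s' =>
    (hF.comp (by fun_prop : Continuous fun k => (s', k))).aestronglyMeasurable
  refine (hasDerivAt_integral_of_dominated_loc_of_deriv_le (bound := fun _ => B)
    (Metric.closedBall_mem_nhds s one_pos) (Eventually.of_forall (hm f hf)) ?_ (hm f' hf' s) ?_
    (integrable_const B) (Eventually.of_forall fun k s' _ => h s' k)).2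
  · refine Integrable.mono' (integrable_const B₀) (hm f hf s) ?_
    filter_upwards [hμC] with k hk using hB₀ s (Metric.mem_closedBall_self zero_le_one) k hk
  · filter_upwards [hμC] with k hk s' hs' using hB s' hs' k hk

end parametric

/-! ### The divergence theorem for balls -/

/-- Euclidean space at a fixed time. -/
abbrev Space := EuclideanSpace ℝ (Fin 3)

/-- The surface measure of the unit sphere. -/
abbrev sphereMeasure : Measure (Metric.sphere (0 : Space) 1) := (volume : Measure Space).toSphere

/-- Integration in polar coordinates. -/
theorem integral_polar {f : Space → ℝ} (hf : Integrable f) :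
    ∫ y, f y = ∫ ρ in Set.Ioi (0 : ℝ), ρ ^ 2 * ∫ n, f (ρ • (n : Space)) ∂sphereMeasure := by
  have hd : Module.finrank ℝ Space - 1 = 2 := by simp
  have hmp := (volume : Measure Space).measurePreserving_homeomorphUnitSphereProd
  have hemb := Homeomorph.measurableEmbedding (homeomorphUnitSphereProd Space)
  rw [hd] at hmp
  let h : Metric.sphere (0 : Space) 1 × Set.Ioi (0 : ℝ) → ℝ := fun p => f (p.2.1 • (p.1 : Space))
  have hh : h ∘ homeomorphUnitSphereProd Space = fun y => f y.1 := by
    funext y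
    have : (((homeomorphUnitSphereProd Space).symm ((homeomorphUnitSphereProd Space) y) :
        ({(0 : Space)}ᶜ : Set Space)) : Space) = y := by
      rw [Homeomorph.symm_apply_apply]
    rw [homeomorphUnitSphereProd_symm_apply_coe] at this
    simp only [h, Function.comp_apply, this]
  have hint : Integrable h (sphereMeasure.prod (.volumeIoiPow 2)) := by
    rw [← hmp.integrable_comp_emb hemb, hh]
    have := hf.integrableOn (s := ({(0 : Space)}ᶜ))
    rwa [integrableOn_iff_comap_subtypeVal (measurableSet_singleton _).compl] at this
  calc ∫ y, f y = ∫ y : ({(0 : Space)}ᶜ : Set Space), f y.1 ∂(volume.comap Subtype.val) := by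
        rw [integral_subtype_comap (measurableSet_singleton _).compl f, restrict_compl_singleton]
    _ = ∫ p, h p ∂(sphereMeasure.prod (.volumeIoiPow 2)) := by
        rw [← hmp.integral_comp hemb h]
        exact integral_congr_ae (Eventually.of_forall fun y => (congrFun hh y).symm)
    _ = ∫ ρ : Set.Ioi (0 : ℝ), ∫ n, f (ρ.1 • (n : Space)) ∂sphereMeasure ∂(.volumeIoiPow 2) :=
        integral_prod_symm _ hint
    _ = _ := by
        simp only [Measure.volumeIoiPow, ENNReal.ofReal]
        rw [integral_withDensity_eq_integral_smul,
          integral_subtype_comap measurableSet_Ioi fun ρ : ℝ =>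
            Real.toNNReal (ρ ^ 2) • ∫ n, f (ρ • (n : Space)) ∂sphereMeasure]
        · refine setIntegral_congr_fun measurableSet_Ioi fun x hx => ?_
          simp only [NNReal.smul_def, smul_eq_mul]
          rw [Real.coe_toNNReal _ (by positivity)]
        · exact (measurable_subtype_coe.pow_const _).real_toNNReal

theorem norm_smul_sphere {ρ : ℝ} (hρ : 0 < ρ) (n : Metric.sphere (0 : Space) 1) :
    ‖ρ • (n : Space)‖ = ρ := by
  rw [norm_smul, Real.norm_of_nonneg hρ.le, norm_eq_of_mem_sphere, mul_one]

theorem setIntegral_ball_polar {h : Space → ℝ} (hh : Continuous h) {r : ℝ} :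
    ∫ y in Metric.ball (0 : Space) r, h y
      = ∫ ρ in Set.Ioo 0 r, ρ ^ 2 * ∫ n, h (ρ • (n : Space)) ∂sphereMeasure := by
  have hi : IntegrableOn h (Metric.ball 0 r) :=
    (hh.continuousOn.integrableOn_compact (isCompact_closedBall 0 r)).mono_set
      Metric.ball_subset_closedBall
  rw [← integral_indicator measurableSet_ball,
    integral_polar ((integrable_indicator_iff measurableSet_ball).mpr hi),
    ← Set.Ioi_inter_Iio, ← setIntegral_indicator measurableSet_Iio]
  refine setIntegral_congr_fun measurableSet_Ioi fun ρ hρ => ?_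
  have hn := norm_smul_sphere (Set.mem_Ioi.mp hρ)
  by_cases hr : ρ < r
  · simp [Set.indicator, hn, hr]
  · simp [Set.indicator, hn, hr]

/-- The flux of a vector field on space through the sphere of radius `ρ`. -/
def sphereFlux (W : Fin 3 → Space → ℝ) (ρ : ℝ) : ℝ :=
  ∫ n, ρ ^ 2 * ∑ i, W i (ρ • (n : Space)) * (n : Space) i ∂sphereMeasure

/-- The divergence of a vector field on space. -/
def spaceDiv (W : Fin 3 → Space → ℝ) (y : Space) : ℝ :=
  ∑ i, fderiv ℝ (W i) y (EuclideanSpace.single i 1)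

theorem continuous_spaceDiv {W : Fin 3 → Space → ℝ} (hW : ∀ i, ContDiff ℝ 1 (W i)) :
    Continuous (spaceDiv W) := by
  refine continuous_finsetSum _ fun i _ => ?_
  exact ((hW i).continuous_fderiv (by simp)).clm_apply continuous_const

/-- The radial derivative of the integrand of `sphereFlux`. -/
theorem exists_continuous_deriv_sphereFlux {W : Fin 3 → Space → ℝ}
    (hW : ∀ i, ContDiff ℝ 1 (W i)) :
    ∃ Φ' : ℝ → ℝ, Continuous Φ' ∧ ∀ ρ, HasDerivAt (sphereFlux W) (Φ' ρ) ρ := by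
  let f : ℝ → Metric.sphere (0 : Space) 1 → ℝ := fun ρ n =>
    ρ ^ 2 * ∑ i, W i (ρ • (n : Space)) * (n : Space) i
  let f' : ℝ → Metric.sphere (0 : Space) 1 → ℝ := fun ρ n =>
    2 * ρ * (∑ i, W i (ρ • (n : Space)) * (n : Space) i)
      + ρ ^ 2 * ∑ i, fderiv ℝ (W i) (ρ • (n : Space)) n * (n : Space) i
  have hWc : ∀ i, Continuous (W i) := fun i => (hW i).continuous
  have hWd : ∀ i, Continuous (fderiv ℝ (W i)) := fun i => (hW i).continuous_fderiv (by simp)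
  have hf : Continuous fun p : ℝ × Metric.sphere (0 : Space) 1 => f p.1 p.2 := by
    simp only [f]; fun_prop
  have hf' : Continuous fun p : ℝ × Metric.sphere (0 : Space) 1 => f' p.1 p.2 := by
    simp only [f']
    refine Continuous.add (by fun_prop) (Continuous.mul (by fun_prop) ?_)
    refine continuous_finsetSum _ fun i _ => Continuous.mul ?_ (by fun_prop)
    exact Continuous.clm_apply (by fun_prop) (by fun_prop)
  have hd : ∀ s n, HasDerivAt (fun s => f s n) (f' s n) s := by
    intro s n
    have h1 : ∀ i, HasDerivAt (fun s : ℝ => W i (s • (n : Space)))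
        (fderiv ℝ (W i) (s • (n : Space)) n) s := by
      intro i
      have h2 : HasDerivAt (fun s : ℝ => s • (n : Space)) ((1 : ℝ) • (n : Space)) s :=
        (hasDerivAt_id s).smul_const _
      rw [one_smul] at h2
      exact ((hW i).differentiable (by simp) _).hasFDerivAt.comp_hasDerivAt s h2
    have h3 := (hasDerivAt_pow 2 s).fun_mul (HasDerivAt.fun_sum (u := Finset.univ) fun i _ =>
      (h1 i).mul_const ((n : Space) i))
    refine h3.congr_deriv ?_
    simp [f']
  refine ⟨fun ρ => ∫ n, f' ρ n ∂sphereMeasure,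
    continuous_integral_compact isCompact_univ (Eventually.of_forall fun _ => Set.mem_univ _) hf',
    fun ρ => hasDerivAt_integral_compact isCompact_univ (Eventually.of_forall fun _ => Set.mem_univ _) hf hf'
      hd ρ⟩

/-- Radial cutoffs supported away from the origin are smooth. -/
theorem contDiff_radial {χ : ℝ → ℝ} (hχ : ContDiff ℝ ∞ χ) (hs : tsupport χ ⊆ Set.Ioi 0) :
    ContDiff ℝ ∞ (fun y : Space => χ ‖y‖) := by
  refine contDiff_iff_contDiffAt.mpr fun y => ?_
  by_cases hy : y = 0
  · have h0 : (0 : ℝ) ∉ tsupport χ := fun h => lt_irrefl (0 : ℝ) (hs h)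
    have h1 : χ =ᶠ[𝓝 0] 0 := notMem_tsupport_iff_eventuallyEq.mp h0
    have h2 : Tendsto (fun y : Space => ‖y‖) (𝓝 y) (𝓝 0) := by
      rw [hy]; simpa using (continuous_norm (E := Space)).tendsto 0
    have h3 : (fun y : Space => χ ‖y‖) =ᶠ[𝓝 y] fun _ => 0 := h2.eventually h1
    exact contDiffAt_const.congr_of_eventuallyEq h3
  · exact hχ.contDiffAt.comp y (contDiffAt_norm ℝ hy)

theorem hasCompactSupport_radial {χ : ℝ → ℝ} (hc : HasCompactSupport χ) :
    HasCompactSupport (fun y : Space => χ ‖y‖) := by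
  obtain ⟨R, hR⟩ := hc.isCompact.isBounded.subset_closedBall (0 : ℝ)
  refine HasCompactSupport.intro (isCompact_closedBall (0 : Space) R) fun y hy => ?_
  by_contra h
  have h1 := hR (subset_tsupport χ h)
  simp only [Metric.mem_closedBall, dist_zero_right, norm_norm] at h1 hy
  exact hy h1

theorem fderiv_radial {χ : ℝ → ℝ} (hχ : ContDiff ℝ ∞ χ) {y : Space} (hy : y ≠ 0) (i : Fin 3) :
    fderiv ℝ (fun y : Space => χ ‖y‖) y (EuclideanSpace.single i 1)
      = deriv χ ‖y‖ * (y i / ‖y‖) := by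
  have hn : ‖y‖ ≠ 0 := norm_ne_zero_iff.mpr hy
  have h1 : HasFDerivAt (fun y : Space => ‖y‖ ^ 2) (2 • innerSL ℝ y) y :=
    (hasStrictFDerivAt_norm_sq y).hasFDerivAt
  have h2 := h1.sqrt (by positivity)
  have h3 : (fun y : Space => √(‖y‖ ^ 2)) = fun y => ‖y‖ := by
    funext z; exact Real.sqrt_sq (norm_nonneg z)
  rw [h3, Real.sqrt_sq (norm_nonneg y)] at h2
  have h4 := ((hχ.differentiable (by simp) ‖y‖).hasDerivAt).comp_hasFDerivAt y h2
  have h5 : (χ ∘ fun y : Space => ‖y‖) = fun y => χ ‖y‖ := rfl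
  rw [h5] at h4
  rw [h4.fderiv]
  have h6 : innerSL ℝ y (EuclideanSpace.single i 1) = y i := by
    simp [EuclideanSpace.inner_single_right]
  simp only [smul_apply, smul_eq_mul, h6, nsmul_eq_mul]
  field_simp
  simp

/-- Integration by parts against a radial cutoff: in the sense of distributions, the derivative of
`sphereFlux` is the integral of the divergence over the sphere. -/
theorem integral_cutoff_mul_spaceDiv {W : Fin 3 → Space → ℝ} (hW : ∀ i, ContDiff ℝ 1 (W i))
    {χ : ℝ → ℝ} (hχ : ContDiff ℝ ∞ χ) (hc : HasCompactSupport χ) (hs : tsupport χ ⊆ Set.Ioi 0) :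
    ∫ ρ in Set.Ioi (0 : ℝ), χ ρ * (ρ ^ 2 * ∫ n, spaceDiv W (ρ • (n : Space)) ∂sphereMeasure)
      = -∫ ρ in Set.Ioi (0 : ℝ), deriv χ ρ * sphereFlux W ρ := by
  have hc1 := contDiff_radial hχ hs
  have hc2 := hasCompactSupport_radial hc
  have hcc : Continuous fun y : Space => χ ‖y‖ := hc1.continuous
  have hcd : Continuous (fderiv ℝ fun y : Space => χ ‖y‖) := hc1.continuous_fderiv (by simp)
  have hWd : ∀ i, Continuous (fderiv ℝ (W i)) := fun i => (hW i).continuous_fderiv (by simp)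
  have i1 : ∀ i, Integrable fun y : Space =>
      χ ‖y‖ * fderiv ℝ (W i) y (EuclideanSpace.single i 1) := fun i =>
    (hcc.mul ((hWd i).clm_apply continuous_const)).integrable_of_hasCompactSupport hc2.mul_right
  have hds : ∀ i, HasCompactSupport fun y : Space =>
      fderiv ℝ (fun y : Space => χ ‖y‖) y (EuclideanSpace.single i 1) := fun i =>
    hc2.fderiv_apply (𝕜 := ℝ) _
  have i2 : ∀ i, Integrable fun y : Space =>
      fderiv ℝ (fun y : Space => χ ‖y‖) y (EuclideanSpace.single i 1) * W i y := fun i =>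
    ((hcd.clm_apply continuous_const).mul (hW i).continuous).integrable_of_hasCompactSupport
      (hds i).mul_right
  have i3 : ∀ i, Integrable fun y : Space => χ ‖y‖ * W i y := fun i =>
    (hcc.mul (hW i).continuous).integrable_of_hasCompactSupport hc2.mul_right
  have key : ∫ y : Space, χ ‖y‖ * spaceDiv W y
      = -∫ y : Space, ∑ i,
        fderiv ℝ (fun y : Space => χ ‖y‖) y (EuclideanSpace.single i 1) * W i y := by
    simp only [spaceDiv, Finset.mul_sum]
    rw [integral_finsetSum _ fun i _ => i1 i, integral_finsetSum _ fun i _ => i2 i,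
      ← Finset.sum_neg_distrib]
    refine Finset.sum_congr rfl fun i _ => ?_
    exact integral_mul_fderiv_eq_neg_fderiv_mul_of_integrable (i2 i) (i1 i) (i3 i)
      (fun x _ => hc1.differentiable (by simp) x) (fun x _ => (hW i).differentiable (by simp) x)
  have e1 : Integrable fun y : Space => χ ‖y‖ * spaceDiv W y := by
    simp only [spaceDiv, Finset.mul_sum]; exact integrable_finsetSum _ fun i _ => i1 i
  rw [integral_polar e1, integral_polar (integrable_finsetSum _ fun i _ => i2 i)] at key
  calc _ = ∫ ρ in Set.Ioi (0 : ℝ), ρ ^ 2 * ∫ n, χ ‖ρ • (n : Space)‖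
            * spaceDiv W (ρ • (n : Space)) ∂sphereMeasure := by
        refine setIntegral_congr_fun measurableSet_Ioi fun ρ hρ => ?_
        simp only [norm_smul_sphere (Set.mem_Ioi.mp hρ)]
        rw [integral_const_mul]; ring
    _ = _ := by
        rw [key]
        congr 1
        refine setIntegral_congr_fun measurableSet_Ioi fun ρ hρ => ?_
        have hρ' : 0 < ρ := hρ
        have hne : ∀ n : Metric.sphere (0 : Space) 1, ρ • (n : Space) ≠ 0 := fun n h0 => by
          have := norm_smul_sphere hρ' n
          rw [h0, norm_zero] at this; exact hρ'.ne this
        simp only [sphereFlux]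
        rw [← integral_const_mul, ← integral_const_mul]
        refine integral_congr_ae (Eventually.of_forall fun n => ?_)
        simp only [fderiv_radial hχ (hne n), norm_smul_sphere hρ', PiLp.smul_apply, smul_eq_mul,
          Finset.mul_sum]
        refine Finset.sum_congr rfl fun i _ => ?_
        field_simp

/-- The divergence theorem for balls. By `integral_cutoff_mul_spaceDiv` the radial derivative of the
flux is almost everywhere the integral of the divergence over the sphere. -/
theorem setIntegral_ball_spaceDiv {W : Fin 3 → Space → ℝ} (hW : ∀ i, ContDiff ℝ 1 (W i))
    {r : ℝ} (hr : 0 < r) :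
    ∫ y in Metric.ball (0 : Space) r, spaceDiv W y = sphereFlux W r := by
  obtain ⟨Φ', hΦc, hΦ⟩ := exists_continuous_deriv_sphereFlux hW
  have hdiv := continuous_spaceDiv hW
  let D : ℝ → ℝ := fun ρ => ρ ^ 2 * ∫ n, spaceDiv W (ρ • (n : Space)) ∂sphereMeasure
  have hD : Continuous D := by
    refine (continuous_pow 2).mul (continuous_integral_compact isCompact_univ
      (Eventually.of_forall fun _ => Set.mem_univ _) ?_)
    exact hdiv.comp (by fun_prop)
  have hΦcont : Continuous (sphereFlux W) :=
    continuous_iff_continuousAt.mpr fun ρ => (hΦ ρ).continuousAt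
  have hae : ∀ᵐ ρ : ℝ, ρ ∈ Set.Ioi (0 : ℝ) → D ρ - Φ' ρ = 0 := by
    refine isOpen_Ioi.ae_eq_zero_of_integral_contDiff_smul_eq_zero
      ((hD.sub hΦc).locallyIntegrable.locallyIntegrableOn _) fun χ hχ hc hs => ?_
    have h1 := integral_cutoff_mul_spaceDiv hW hχ hc hs
    have hcχ : Continuous χ := hχ.continuous
    have hcχ' : Continuous (deriv χ) := hχ.continuous_deriv (by simp)
    have s1 : ∫ ρ in Set.Ioi (0 : ℝ), χ ρ * D ρ = ∫ ρ, χ ρ * D ρ := by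
      refine setIntegral_eq_integral_of_forall_compl_eq_zero fun ρ hρ => ?_
      rw [image_eq_zero_of_notMem_tsupport fun h => hρ (hs h), zero_mul]
    have s2 : ∫ ρ in Set.Ioi (0 : ℝ), deriv χ ρ * sphereFlux W ρ
        = ∫ ρ, deriv χ ρ * sphereFlux W ρ := by
      refine setIntegral_eq_integral_of_forall_compl_eq_zero fun ρ hρ => ?_
      have h2 : ρ ∉ tsupport (deriv χ) := fun h => hρ (hs (tsupport_deriv_subset h))
      rw [image_eq_zero_of_notMem_tsupport h2, zero_mul]
    have i1 : Integrable (fun ρ => χ ρ * D ρ) :=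
      (hcχ.mul hD).integrable_of_hasCompactSupport hc.mul_right
    have i2 : Integrable (fun ρ => χ ρ * Φ' ρ) :=
      (hcχ.mul hΦc).integrable_of_hasCompactSupport hc.mul_right
    have i3 : Integrable (fun ρ => deriv χ ρ * sphereFlux W ρ) :=
      (hcχ'.mul hΦcont).integrable_of_hasCompactSupport hc.deriv.mul_right
    have i4 : Integrable (fun ρ => χ ρ * sphereFlux W ρ) :=
      (hcχ.mul hΦcont).integrable_of_hasCompactSupport hc.mul_right
    have parts : ∫ ρ, χ ρ * Φ' ρ = -∫ ρ, deriv χ ρ * sphereFlux W ρ :=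
      integral_mul_deriv_eq_deriv_mul_of_integrable
        (fun ρ _ => (hχ.differentiable (by simp) ρ).hasDerivAt) (fun ρ _ => hΦ ρ) i2 i3 i4
    simp only [smul_eq_mul, mul_sub]
    rw [integral_sub i1 i2, parts, ← s1, ← s2]
    exact sub_eq_zero.mpr h1
  rw [setIntegral_ball_polar hdiv, ← integral_Ioc_eq_integral_Ioo]
  have h0 : sphereFlux W 0 = 0 := by simp [sphereFlux]
  have ftc : ∫ ρ in (0 : ℝ)..r, Φ' ρ = sphereFlux W r - sphereFlux W 0 :=
    intervalIntegral.integral_eq_sub_of_hasDerivAt (fun ρ _ => hΦ ρ) (hΦc.intervalIntegrable _ _)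
  rw [h0, sub_zero, intervalIntegral.integral_of_le hr.le] at ftc
  rw [← ftc]
  refine setIntegral_congr_ae measurableSet_Ioc ?_
  filter_upwards [hae] with ρ hρ hmem
  exact sub_eq_zero.mp (hρ hmem.1)

/-! ### Charges and fluxes -/

theorem contDiff_pt : ContDiff ℝ ∞ (fun p : ℝ × Space => pt p.1 p.2) := by
  refine contDiff_pi.mpr fun i => ?_
  refine Fin.cases ?_ (fun j => ?_) i
  · simp only [pt, Fin.cons_zero]; fun_prop
  · simp only [pt, Fin.cons_succ]; fun_prop

theorem contDiff_pt_right (t : ℝ) : ContDiff ℝ ∞ (pt t) :=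
  contDiff_pt.comp (contDiff_const.prodMk contDiff_id)

theorem continuous_pt : Continuous (fun p : ℝ × Space => pt p.1 p.2) := contDiff_pt.continuous

theorem hasDerivAt_pt (t : ℝ) (y : Space) :
    HasDerivAt (fun s => pt s y) (Pi.single 0 1) t := by
  refine hasDerivAt_pi.mpr fun i => ?_
  refine Fin.cases ?_ (fun j => ?_) i
  · simp only [pt, Fin.cons_zero, Pi.single_eq_same]
    exact hasDerivAt_id' t
  · simpa [pt] using hasDerivAt_const t (y j)

theorem hasDerivAt_comp_pt {f : Spacetime → ℝ} (hf : ContDiff ℝ ∞ f) (t : ℝ) (y : Space) :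
    HasDerivAt (fun s => f (pt s y)) (pd 0 f (pt t y)) t :=
  (hf.differentiable (by simp) (pt t y)).hasFDerivAt.comp_hasDerivAt t (hasDerivAt_pt t y)

theorem fderiv_comp_pt {f : Spacetime → ℝ} (hf : ContDiff ℝ ∞ f) (t : ℝ) (y : Space) (i : Fin 3) :
    fderiv ℝ (fun z => f (pt t z)) y (EuclideanSpace.single i 1) = pd i.succ f (pt t y) := by
  have h1 : HasLineDerivAt ℝ (pt t) (Pi.single i.succ 1) y (EuclideanSpace.single i 1) := by
    refine hasDerivAt_pi.mpr fun k => ?_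
    refine Fin.cases ?_ (fun j => ?_) k
    · simpa [pt] using hasDerivAt_const (0 : ℝ) t
    · by_cases hij : j = i
      · subst hij
        simpa [pt] using (hasDerivAt_id (0 : ℝ)).const_add (y j)
      · have : (Fin.succ j) ≠ i.succ := fun h => hij (Fin.succ_inj.mp h)
        simpa [pt, hij, this] using hasDerivAt_const (0 : ℝ) (y j)
  have h2 := ((contDiff_pt_right t).differentiable (by simp) y).hasFDerivAt
  have h3 : fderiv ℝ (pt t) y (EuclideanSpace.single i 1) = Pi.single i.succ 1 :=
    (h2.hasLineDerivAt _).unique h1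
  have h4 := ((hf.differentiable (by simp) (pt t y)).hasFDerivAt.comp y h2).fderiv
  rw [show (fun z => f (pt t z)) = f ∘ pt t from rfl, h4, ContinuousLinearMap.comp_apply, h3]
  rfl

theorem flux_eq_sphereFlux (V : Spacetime → Fin 3 → ℝ) (r t : ℝ) :
    flux V r t = sphereFlux (fun i y => V (pt t y) i) r := rfl

/-- The divergence theorem for the ball of radius `r` at time `t`. -/
theorem setIntegral_ball_divergence {V : Fin 3 → Spacetime → ℝ} (hV : ∀ i, ContDiff ℝ ∞ (V i))
    {r : ℝ} (hr : 0 < r) (t : ℝ) :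
    ∫ y in Metric.ball (0 : Space) r, ∑ i, pd i.succ (V i) (pt t y)
      = flux (fun x i => V i x) r t := by
  have h := setIntegral_ball_spaceDiv (W := fun i y => V i (pt t y)) (fun i =>
    ((hV i).comp (contDiff_pt_right t)).of_le (by simp)) hr
  rw [flux_eq_sphereFlux, ← h]
  refine integral_congr_ae (Eventually.of_forall fun y => ?_)
  exact Finset.sum_congr rfl fun i _ => (fderiv_comp_pt (hV i) t y i).symm

theorem hasDerivAt_setIntegral_ball {f : Spacetime → ℝ} (hf : ContDiff ℝ ∞ f) (r t : ℝ) :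
    HasDerivAt (fun t => ∫ y in Metric.ball (0 : Space) r, f (pt t y))
      (∫ y in Metric.ball (0 : Space) r, pd 0 f (pt t y)) t := by
  have : IsFiniteMeasure ((volume : Measure Space).restrict (Metric.ball 0 r)) :=
    ⟨by rw [Measure.restrict_apply_univ]; exact measure_ball_lt_top⟩
  refine hasDerivAt_integral_compact (isCompact_closedBall (0 : Space) r) ?_ ?_ ?_
    (fun s y => hasDerivAt_comp_pt hf s y) t
  · filter_upwards [ae_restrict_mem measurableSet_ball] with y hy
      using Metric.ball_subset_closedBall hy
  · exact hf.continuous.comp continuous_pt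
  · exact (contDiff_pd hf 0).continuous.comp continuous_pt

theorem hasDerivAt_flux {V : Fin 3 → Spacetime → ℝ} (hV : ∀ i, ContDiff ℝ ∞ (V i)) (r t : ℝ) :
    HasDerivAt (fun t => flux (fun x i => V i x) r t) (flux (fun x i => pd 0 (V i) x) r t) t := by
  have hp : Continuous fun p : ℝ × Metric.sphere (0 : Space) 1 => pt p.1 (r • (p.2 : Space)) :=
    continuous_pt.comp (by fun_prop : Continuous fun p : ℝ × Metric.sphere (0 : Space) 1 =>
      (p.1, r • (p.2 : Space)))
  have hc : ∀ U : Fin 3 → Spacetime → ℝ, (∀ i, Continuous (U i)) →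
      Continuous fun p : ℝ × Metric.sphere (0 : Space) 1 =>
        r ^ 2 * ∑ i, U i (pt p.1 (r • (p.2 : Space))) * (p.2 : Space) i := fun U hU => by
    refine continuous_const.mul (continuous_finsetSum _ fun i _ => Continuous.mul ?_ (by fun_prop))
    exact (hU i).comp hp
  refine hasDerivAt_integral_compact
    (f := fun t (n : Metric.sphere (0 : Space) 1) =>
      r ^ 2 * ∑ i, V i (pt t (r • (n : Space))) * (n : Space) i)
    (f' := fun t n => r ^ 2 * ∑ i, pd 0 (V i) (pt t (r • (n : Space))) * (n : Space) i)
    isCompact_univ (Eventually.of_forall fun _ => Set.mem_univ _)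
    (hc V fun i => (hV i).continuous) (hc _ fun i => (contDiff_pd (hV i) 0).continuous)
    (fun s n => ?_) t
  refine HasDerivAt.const_mul _ (HasDerivAt.fun_sum fun i _ => ?_)
  exact (hasDerivAt_comp_pt (hV i) s _).mul_const _

theorem flux_add {V U : Fin 3 → Spacetime → ℝ} (hV : ∀ i, ContDiff ℝ ∞ (V i))
    (hU : ∀ i, ContDiff ℝ ∞ (U i)) (r t : ℝ) :
    flux (fun x i => V i x + U i x) r t
      = flux (fun x i => V i x) r t + flux (fun x i => U i x) r t := by
  have hc : ∀ V : Fin 3 → Spacetime → ℝ, (∀ i, ContDiff ℝ ∞ (V i)) →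
      Integrable (fun n : Metric.sphere (0 : Space) 1 =>
        r ^ 2 * ∑ i, V i (pt t (r • (n : Space))) * (n : Space) i) sphereMeasure := by
    intro V hV
    have : Continuous (fun n : Metric.sphere (0 : Space) 1 =>
        r ^ 2 * ∑ i, V i (pt t (r • (n : Space))) * (n : Space) i) := by
      refine continuous_const.mul
        (continuous_finsetSum _ fun i _ => Continuous.mul ?_ (by fun_prop))
      exact (hV i).continuous.comp ((contDiff_pt_right t).continuous.comp (by fun_prop))
    rw [← integrableOn_univ]
    exact this.continuousOn.integrableOn_compact isCompact_univ
  simp only [flux]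
  rw [← integral_add (hc V hV) (hc U hU)]
  refine integral_congr_ae (Eventually.of_forall fun n => ?_)
  simp only [add_mul, Finset.sum_add_distrib, mul_add]

/-- The balance law for a charge with bulk density `f⁰` and surface density `-2 s^{0i}`, where
`∂_μ f^μ = ∂_μ∂_ν s^{μν}` and `s^{00} = 0`. -/
theorem hasDerivAt_charge {f : Fin 4 → Spacetime → ℝ} {s : Fin 4 → Fin 4 → Spacetime → ℝ}
    (hf : ∀ μ, ContDiff ℝ ∞ (f μ)) (hs : ∀ μ ν, ContDiff ℝ ∞ (s μ ν))
    (hsymm : ∀ μ ν, s μ ν = s ν μ) (h00 : s 0 0 = 0)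
    (hdiv : ∀ x, ∑ μ, pd μ (f μ) x = ∑ μ, ∑ ν, pd μ (pd ν (s μ ν)) x) {r : ℝ} (hr : 0 < r)
    (t : ℝ) :
    HasDerivAt (fun t => (∫ y in Metric.ball (0 : Space) r, f 0 (pt t y))
        - flux (fun x i => 2 * s 0 i.succ x) r t)
      (flux (fun x i => -f i.succ x + ∑ j : Fin 3, pd j.succ (s i.succ j.succ) x) r t) t := by
  have h2s : ∀ i : Fin 3, ContDiff ℝ ∞ (fun x => 2 * s 0 i.succ x) := fun i =>
    contDiff_const.mul (hs _ _)
  have hd := (hasDerivAt_setIntegral_ball (hf 0) r t).sub (hasDerivAt_flux h2s r t)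
  refine hd.congr_deriv ?_
  let V : Fin 3 → Spacetime → ℝ := fun i x =>
    -f i.succ x + ∑ j : Fin 3, pd j.succ (s i.succ j.succ) x
  have hV : ∀ i, ContDiff ℝ ∞ (V i) := fun i =>
    (hf _).neg.add (ContDiff.sum fun j _ => contDiff_pd (hs _ _) _)
  have hW : ∀ i : Fin 3, ContDiff ℝ ∞ (pd 0 fun x => 2 * s 0 i.succ x) := fun i =>
    contDiff_pd (h2s i) 0
  have key : ∀ x, pd 0 (f 0) x
      = ∑ i : Fin 3, pd i.succ (fun x => V i x + pd 0 (fun x => 2 * s 0 i.succ x) x) x := by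
    intro x
    have h1 := hdiv x
    rw [Fin.sum_univ_succ] at h1
    simp only [Fin.sum_univ_succ (n := 3)] at h1
    have e00 : pd 0 (pd 0 (s 0 0)) x = 0 := by
      rw [h00]
      have : pd 0 (0 : Spacetime → ℝ) = fun _ => 0 := by funext y; simp [pd]
      rw [this]; simp [pd]
    have e1 : ∀ i : Fin 3, pd i.succ (fun x => V i x + pd 0 (fun x => 2 * s 0 i.succ x) x) x
        = -pd i.succ (f i.succ) x + (∑ j : Fin 3, pd i.succ (pd j.succ (s i.succ j.succ)) x)
          + 2 * pd 0 (pd i.succ (s 0 i.succ)) x := by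
      intro i
      have d1 : DifferentiableAt ℝ (fun y => -f i.succ y) x :=
        ((hf _).neg).differentiable (by simp) x
      have d2 : ∀ j : Fin 3, DifferentiableAt ℝ (pd j.succ (s i.succ j.succ)) x := fun j =>
        (contDiff_pd (hs _ _) _).differentiable (by simp) x
      rw [pd_fun_add ((hV i).differentiable (by simp) x) ((hW i).differentiable (by simp) x),
        pd_fun_add d1 (DifferentiableAt.fun_sum fun j _ => d2 j), pd_fun_sum fun j _ => d2 j]
      congr 1
      · congr 1
        simp [pd, fderiv_fun_neg]
      · have : pd 0 (fun x => 2 * s 0 i.succ x) = fun x => 2 * pd 0 (s 0 i.succ) x := by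
          funext y
          rw [pd_fun_mul (differentiableAt_const _) ((hs _ _).differentiable (by simp) y)]
          simp [pd]
        rw [this, pd_fun_mul (differentiableAt_const _)
          ((contDiff_pd (hs _ _) 0).differentiable (by simp) x), pd_comm (hs _ _)]
        simp [pd]
    have e2 : ∀ i : Fin 3, pd i.succ (pd 0 (s i.succ 0)) x = pd 0 (pd i.succ (s 0 i.succ)) x := by
      intro i; rw [hsymm i.succ 0, pd_comm (hs _ _)]
    simp only [e1, Finset.sum_add_distrib, Finset.sum_neg_distrib]
    simp only [e00, e2, Finset.sum_add_distrib, zero_add] at h1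
    rw [← Finset.mul_sum]
    linarith
  have e3 : ∫ y in Metric.ball (0 : Space) r, pd 0 (f 0) (pt t y)
      = flux (fun x i => V i x + pd 0 (fun x => 2 * s 0 i.succ x) x) r t := by
    simp only [key]
    exact setIntegral_ball_divergence (V := fun i x => V i x + pd 0 (fun x => 2 * s 0 i.succ x) x)
      (fun i => (hV i).add (hW i)) hr t
  rw [e3, flux_add hV hW]
  ring

/-! ### Decay at space infinity -/

theorem DecaysLike.mono {V : Type} [NormedAddCommGroup V] {f : Spacetime → V} {p q : ℝ}
    (hf : DecaysLike f p) (hq : q ≤ p) : DecaysLike f q := by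
  intro T
  obtain ⟨C, R, hR, h⟩ := hf T
  refine ⟨|C|, max R 1, by positivity, fun x hx hr => ?_⟩
  have h1 : 1 ≤ radius x := le_trans (le_max_right _ _) hr
  have h0 : 0 < radius x := by linarith
  calc ‖f x‖ ≤ C / radius x ^ p := h x hx (le_trans (le_max_left _ _) hr)
    _ ≤ |C| / radius x ^ p := by gcongr; exact le_abs_self C
    _ ≤ |C| / radius x ^ q := by
        gcongr

theorem radius_pt (t : ℝ) (y : Space) : radius (pt t y) = ‖y‖ := by
  rw [radius, EuclideanSpace.norm_eq]
  simp [pt]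

theorem abs_coord_le_one (n : Metric.sphere (0 : Space) 1) (i : Fin 3) : |(n : Space) i| ≤ 1 := by
  have := PiLp.norm_apply_le (n : Space) i
  rwa [norm_eq_of_mem_sphere] at this

/-- Uniform bound on the flux of a decaying current. -/
theorem exists_flux_bound {V : Spacetime → Fin 3 → ℝ} {p : ℝ}
    (hV : ∀ i, DecaysLike (fun x => V x i) p) (T : ℝ) :
    ∃ C R : ℝ, 0 < R ∧ ∀ r t, R ≤ r → |t| ≤ T → |flux V r t| ≤ C * r ^ (2 - p) := by
  choose C R hR h using fun i => hV i T
  let R₀ := ∑ i, R i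
  have hR₀ : ∀ i, R i ≤ R₀ := fun i =>
    Finset.single_le_sum (f := R) (fun j _ => (hR j).le) (Finset.mem_univ i)
  have hpos : 0 < R₀ := lt_of_lt_of_le (hR 0) (hR₀ 0)
  refine ⟨(∑ i, |C i|) * sphereMeasure.real Set.univ, R₀, hpos, fun r t hr ht => ?_⟩
  have hr0 : 0 < r := lt_of_lt_of_le hpos hr
  have hb : ∀ n : Metric.sphere (0 : Space) 1,
      ‖r ^ 2 * ∑ i, V (pt t (r • (n : Space))) i * (n : Space) i‖
        ≤ (∑ i, |C i|) * r ^ (2 - p) := by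
    intro n
    have hrad : radius (pt t (r • (n : Space))) = r := by
      rw [radius_pt, norm_smul_sphere hr0]
    have h1 : ∀ i, |V (pt t (r • (n : Space))) i * (n : Space) i| ≤ |C i| / r ^ p := by
      intro i
      have h2 := h i (pt t (r • (n : Space))) (by simpa [pt] using ht)
        (by rw [hrad]; exact (hR₀ i).trans hr)
      rw [hrad, Real.norm_eq_abs] at h2
      rw [abs_mul]
      calc _ ≤ (C i / r ^ p) * 1 := mul_le_mul h2 (abs_coord_le_one n i) (abs_nonneg _)
              ((abs_nonneg _).trans h2)
        _ ≤ |C i| / r ^ p := by rw [mul_one]; gcongr; exact le_abs_self _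
    rw [Real.norm_eq_abs, abs_mul, abs_of_nonneg (by positivity : (0 : ℝ) ≤ r ^ 2)]
    calc r ^ 2 * |∑ i, V (pt t (r • (n : Space))) i * (n : Space) i|
        ≤ r ^ 2 * ∑ i, |C i| / r ^ p := by
          gcongr
          exact (Finset.abs_sum_le_sum_abs _ _).trans (Finset.sum_le_sum fun i _ => h1 i)
      _ = (∑ i, |C i|) * r ^ (2 - p) := by
          rw [← Finset.sum_div, Real.rpow_sub hr0, Real.rpow_two]; ring
  have h3 := norm_integral_le_of_norm_le_const (μ := sphereMeasure)
    (Eventually.of_forall hb)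
  rw [Real.norm_eq_abs] at h3
  calc |flux V r t| ≤ (∑ i, |C i|) * r ^ (2 - p) * sphereMeasure.real Set.univ := h3
    _ = _ := by ring

theorem tendsto_flux_zero {V : Spacetime → Fin 3 → ℝ} {p : ℝ} (hp : 2 < p)
    (hV : ∀ i, DecaysLike (fun x => V x i) p) (t : ℝ) :
    Tendsto (fun r => flux V r t) atTop (𝓝 0) := by
  obtain ⟨C, R, hR, h⟩ := exists_flux_bound hV |t|
  have h1 : Tendsto (fun r : ℝ => C * r ^ (2 - p)) atTop (𝓝 0) := by
    have := (tendsto_rpow_neg_atTop (by linarith : 0 < p - 2)).const_mul C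
    simpa [neg_sub] using this
  refine squeeze_zero_norm' ?_ h1
  filter_upwards [eventually_ge_atTop R] with r hr using h r t hr le_rfl

/-- A charge whose time derivative is the flux of a current that decays faster than `r⁻²` is
conserved in the limit of infinite radius. -/
theorem conservedAtInfinity_of_flux {Q : ℝ → ℝ → ℝ} {V : Spacetime → Fin 3 → ℝ} {p : ℝ}
    (hp : 2 < p) (hV : ∀ i, DecaysLike (fun x => V x i) p)
    (hQ : ∀ r, 0 < r → ∀ t, HasDerivAt (Q r) (flux V r t) t) : ConservedAtInfinity Q := by
  have hdiff : ∀ t₀ t₁, Tendsto (fun r => Q r t₁ - Q r t₀) atTop (𝓝 0) := by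
    intro t₀ t₁
    obtain ⟨C, R, hR, h⟩ := exists_flux_bound hV (max |t₀| |t₁|)
    have h1 : Tendsto (fun r : ℝ => C * r ^ (2 - p) * |t₁ - t₀|) atTop (𝓝 0) := by
      have := ((tendsto_rpow_neg_atTop (by linarith : 0 < p - 2)).const_mul C).mul_const |t₁ - t₀|
      simpa [neg_sub] using this
    refine squeeze_zero_norm' ?_ h1
    filter_upwards [eventually_ge_atTop R] with r hr
    -- mean value inequality on the interval between the two times
    have hconv : Convex ℝ (Set.uIcc t₀ t₁) := convex_uIcc t₀ t₁
    refine hconv.norm_image_sub_le_of_norm_hasDerivWithin_le (f := Q r)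
      (f' := fun t => flux V r t)
      (fun t _ => (hQ r (hR.trans_le hr) t).hasDerivWithinAt) (fun t ht => ?_)
      Set.left_mem_uIcc Set.right_mem_uIcc
    refine h r t hr ?_
    rcases Set.mem_uIcc.mp ht with ⟨ha, hb⟩ | ⟨ha, hb⟩
    · exact (abs_le_max_abs_abs ha hb)
    · exact (abs_le_max_abs_abs ha hb).trans (max_comm _ _).le
  refine ⟨fun r hr t => (hQ r hr t).differentiableAt, fun t => ?_, hdiff, fun t₀ q hq t => ?_⟩
  · refine (tendsto_flux_zero hp hV t).congr' ?_
    filter_upwards [eventually_gt_atTop 0] with r hr using (hQ r hr t).deriv.symm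
  · simpa using (hdiff t₀ t).add hq

/-! ### Noether's theorem for second order Lagrangians -/

section noether

variable {E : Type} [NormedAddCommGroup E] [NormedSpace ℝ E]

theorem pd_clm_apply {A : Spacetime → E →L[ℝ] ℝ} {δ : Spacetime → E} (hA : ContDiff ℝ ∞ A)
    (hδ : ContDiff ℝ ∞ δ) (μ : Fin 4) (x : Spacetime) :
    pd μ (fun y => A y (δ y)) x = pd μ A x (δ x) + A x (pd μ δ x) := by
  have h := (hA.differentiable (by simp) x).hasFDerivAt.clm_apply
    (hδ.differentiable (by simp) x).hasFDerivAt
  simp only [pd]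
  rw [h.fderiv]
  simp [add_comm]

theorem pd_clm_apply_const {A : Spacetime → E →L[ℝ] ℝ} (hA : ContDiff ℝ ∞ A) (e : E) (μ : Fin 4)
    (x : Spacetime) : pd μ (fun y => A y e) x = pd μ A x e := by
  rw [pd_clm_apply hA contDiff_const]
  simp [pd]

/-- The inclusion of first derivatives `φ_μ` in second jets. -/
def jetInl (μ : Fin 4) : E →L[ℝ] Jet2 E :=
  (ContinuousLinearMap.inr ℝ E ((Fin 4 → E) × (Fin 4 → Fin 4 → E))).comp
    ((ContinuousLinearMap.inl ℝ (Fin 4 → E) (Fin 4 → Fin 4 → E)).comp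
      (ContinuousLinearMap.single ℝ (fun _ => E) μ))

/-- The inclusion of second derivatives `φ_{μν}` in second jets. -/
def jetInr (μ ν : Fin 4) : E →L[ℝ] Jet2 E :=
  (ContinuousLinearMap.inr ℝ E ((Fin 4 → E) × (Fin 4 → Fin 4 → E))).comp
    ((ContinuousLinearMap.inr ℝ (Fin 4 → E) (Fin 4 → Fin 4 → E)).comp
      ((ContinuousLinearMap.single ℝ (fun _ => Fin 4 → E) μ).comp
        (ContinuousLinearMap.single ℝ (fun _ => E) ν)))

theorem jet2_decomp (j : Jet2 E) : j = (j.1, 0, 0) + ∑ μ, jetInl μ (j.2.1 μ)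
    + ∑ μ, ∑ ν, jetInr μ ν (j.2.2 μ ν) := by
  refine Prod.ext ?_ (Prod.ext ?_ ?_)
  · simp [jetInl, jetInr, Prod.fst_sum]
  · simp [jetInl, jetInr, Prod.fst_sum, Prod.snd_sum, Finset.univ_sum_single]
  · simp only [jetInl, jetInr, Prod.snd_add, Prod.snd_sum, ContinuousLinearMap.comp_apply,
      ContinuousLinearMap.inr_apply, ContinuousLinearMap.inl_apply,
      ContinuousLinearMap.single_apply, Finset.sum_const_zero, zero_add]
    have : ∀ μ, ∑ ν, (Pi.single μ (Pi.single ν (j.2.2 μ ν)) : Fin 4 → Fin 4 → E)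
        = Pi.single μ (j.2.2 μ) := fun μ => by
      have h := map_sum (ContinuousLinearMap.single ℝ (fun _ : Fin 4 => Fin 4 → E) μ)
        (fun ν => (Pi.single ν (j.2.2 μ ν) : Fin 4 → E)) Finset.univ
      rw [Finset.univ_sum_single] at h
      exact h.symm
    simp only [this, Finset.univ_sum_single]

variable {L : Jet2 E → ℝ} {φ δ : Spacetime → E}

/-- The algebra behind Noether's theorem: the variation of `L` is the Euler-Lagrange term plus a
divergence. -/
theorem variation2_eq_eulerLagrange_add (hφ : ContDiff ℝ ∞ φ) (hδ : ContDiff ℝ ∞ δ)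
    (hL : ∀ x, ContDiffAt ℝ ∞ L (jet2 φ x)) :
    (∀ μ, ContDiff ℝ ∞ fun x => momentum1 L φ μ (δ x) x) ∧
    (∀ μ ν, ContDiff ℝ ∞ fun x => partialL2 L φ μ ν (δ x) x) ∧
    ∀ x, variation2 L φ δ x = eulerLagrange L φ (δ x) x
      + ∑ μ, pd μ (fun y => momentum1 L φ μ (δ y) y) x
      + ∑ μ, ∑ ν, pd μ (pd ν fun y =>
          (1 / 2) * (partialL2 L φ μ ν (δ y) y + partialL2 L φ ν μ (δ y) y)) x := by
  have hD : ContDiff ℝ ∞ (fun x => fderiv ℝ L (jet2 φ x)) :=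
    contDiff_comp_field (contDiff_jet2 hφ) fun x => (hL x).fderiv_right (by simp)
  let P₀ : Spacetime → E →L[ℝ] ℝ := fun x =>
    (fderiv ℝ L (jet2 φ x)).comp (ContinuousLinearMap.inl ℝ E _)
  let P₁ : Fin 4 → Spacetime → E →L[ℝ] ℝ := fun μ x => (fderiv ℝ L (jet2 φ x)).comp (jetInl μ)
  let P₂ : Fin 4 → Fin 4 → Spacetime → E →L[ℝ] ℝ := fun μ ν x =>
    (fderiv ℝ L (jet2 φ x)).comp (jetInr μ ν)
  let S : Fin 4 → Fin 4 → Spacetime → E →L[ℝ] ℝ := fun μ ν x =>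
    (1 / 2 : ℝ) • (P₂ μ ν x + P₂ ν μ x)
  have h₁ : ∀ μ, ContDiff ℝ ∞ (P₁ μ) := fun μ => hD.clm_comp contDiff_const
  have h₂ : ∀ μ ν, ContDiff ℝ ∞ (P₂ μ ν) := fun μ ν => hD.clm_comp contDiff_const
  have hS : ∀ μ ν, ContDiff ℝ ∞ (S μ ν) := fun μ ν => ((h₂ μ ν).add (h₂ ν μ)).const_smul _
  have hSsymm : ∀ μ ν, S μ ν = S ν μ := fun μ ν => by
    funext x; simp only [S]; rw [add_comm]
  let M : Fin 4 → Spacetime → E →L[ℝ] ℝ := fun μ x =>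
    P₁ μ x - ∑ ν, (2 : ℝ) • pd ν (S μ ν) x
  have hM : ∀ μ, ContDiff ℝ ∞ (M μ) := fun μ =>
    (h₁ μ).sub (ContDiff.sum fun ν _ => (contDiff_pd (hS μ ν) ν).const_smul _)
  have eM : ∀ μ e x, momentum1 L φ μ e x = M μ x e := by
    intro μ e x
    have e1 : ∀ ν, pd ν (fun y => partialL2 L φ μ ν e y + partialL2 L φ ν μ e y) x
        = 2 * pd ν (S μ ν) x e := by
      intro ν
      have : (fun y => partialL2 L φ μ ν e y + partialL2 L φ ν μ e y)
          = fun y => 2 * (fun y => S μ ν y e) y := by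
        funext y
        change P₂ μ ν y e + P₂ ν μ y e = 2 * ((1 / 2 : ℝ) * (P₂ μ ν y e + P₂ ν μ y e))
        ring
      rw [this, pd_fun_mul (differentiableAt_const _)
        (((hS μ ν).clm_apply contDiff_const).differentiable (by simp) x),
        pd_clm_apply_const (hS μ ν)]
      simp [pd]
    simp only [momentum1, e1, M, sub_apply, sum_apply, smul_apply, smul_eq_mul]
    rfl
  have eS : ∀ μ ν, (fun y => (1 / 2) * (partialL2 L φ μ ν (δ y) y + partialL2 L φ ν μ (δ y) y))
      = fun y => S μ ν y (δ y) := fun μ ν => rfl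
  refine ⟨fun μ => ?_, fun μ ν => (h₂ μ ν).clm_apply hδ, fun x => ?_⟩
  · simp only [eM]; exact (hM μ).clm_apply hδ
  have hd : ∀ μ, ContDiff ℝ ∞ (pd μ δ) := fun μ => contDiff_pd hδ μ
  -- second derivatives of the symmetrized coefficients
  have eSS : ∀ μ ν, pd μ (pd ν fun y => S μ ν y (δ y)) x
      = pd μ (pd ν (S μ ν)) x (δ x) + pd ν (S μ ν) x (pd μ δ x)
        + (pd μ (S μ ν) x (pd ν δ x) + S μ ν x (pd μ (pd ν δ) x)) := by
    intro μ ν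
    have : (pd ν fun y => S μ ν y (δ y))
        = fun y => pd ν (S μ ν) y (δ y) + S μ ν y (pd ν δ y) := by
      funext y; exact pd_clm_apply (hS μ ν) hδ ν y
    rw [this, pd_fun_add
      (((contDiff_pd (hS μ ν) ν).clm_apply hδ).differentiable (by simp) x)
      (((hS μ ν).clm_apply (hd ν)).differentiable (by simp) x),
      pd_clm_apply (contDiff_pd (hS μ ν) ν) hδ, pd_clm_apply (hS μ ν) (hd ν)]
  have eMM : ∀ μ, pd μ (M μ) x = pd μ (P₁ μ) x - ∑ ν, (2 : ℝ) • pd μ (pd ν (S μ ν)) x := by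
    intro μ
    have d1 := (h₁ μ).differentiable (by simp) x
    have d2 : ∀ ν, DifferentiableAt ℝ (pd ν (S μ ν)) x := fun ν =>
      (contDiff_pd (hS μ ν) ν).differentiable (by simp) x
    change fderiv ℝ (fun x => P₁ μ x - ∑ ν, (2 : ℝ) • pd ν (S μ ν) x) x _ = _
    rw [fderiv_fun_sub d1 (DifferentiableAt.fun_sum fun ν _ => (d2 ν).fun_const_smul _),
      fderiv_fun_sum fun ν _ => (d2 ν).fun_const_smul _]
    simp only [sub_apply, sum_apply]
    congr 1
    refine Finset.sum_congr rfl fun ν _ => ?_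
    rw [fderiv_fun_const_smul (d2 ν)]
    rfl
  -- the Euler-Lagrange expression in terms of the symmetrized coefficients
  have eEL : eulerLagrange L φ (δ x) x = P₀ x (δ x) - ∑ μ, pd μ (P₁ μ) x (δ x)
      + ∑ μ, ∑ ν, pd μ (pd ν (S μ ν)) x (δ x) := by
    have e1 : ∀ μ, pd μ (partialL1 L φ μ (δ x)) x = pd μ (P₁ μ) x (δ x) := fun μ =>
      pd_clm_apply_const (h₁ μ) (δ x) μ x
    have e2 : ∀ μ ν, pd ν (pd μ (partialL2 L φ μ ν (δ x))) x
        = pd ν (pd μ (P₂ μ ν)) x (δ x) := by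
      intro μ ν
      have : pd μ (partialL2 L φ μ ν (δ x)) = fun y => pd μ (P₂ μ ν) y (δ x) := by
        funext y; exact pd_clm_apply_const (h₂ μ ν) (δ x) μ y
      rw [this, pd_clm_apply_const (contDiff_pd (h₂ μ ν) μ)]
    have e3 : ∀ μ ν, pd μ (pd ν (S μ ν)) x (δ x)
        = (1 / 2) * (pd μ (pd ν (P₂ μ ν)) x (δ x) + pd μ (pd ν (P₂ ν μ)) x (δ x)) := by
      intro μ ν
      have l1 : pd ν (S μ ν) = fun y => (1 / 2 : ℝ) • (pd ν (P₂ μ ν) y + pd ν (P₂ ν μ) y) := by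
        funext y
        have d1 := (h₂ μ ν).differentiable (by simp) y
        have d2 := (h₂ ν μ).differentiable (by simp) y
        simp only [pd, S]
        rw [fderiv_fun_const_smul (d1.fun_add d2), fderiv_fun_add d1 d2]
        rfl
      have d1 := (contDiff_pd (h₂ μ ν) ν).differentiable (by simp) x
      have d2 := (contDiff_pd (h₂ ν μ) ν).differentiable (by simp) x
      rw [l1, pd, fderiv_fun_const_smul (d1.fun_add d2), fderiv_fun_add d1 d2]
      rfl
    have e4 : ∑ μ, ∑ ν, pd μ (pd ν (P₂ μ ν)) x (δ x) = ∑ μ, ∑ ν, pd ν (pd μ (P₂ μ ν)) x (δ x) :=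
      Finset.sum_congr rfl fun μ _ => Finset.sum_congr rfl fun ν _ => by
        rw [pd_comm (h₂ μ ν)]
    have e5 : ∑ μ, ∑ ν, pd μ (pd ν (P₂ ν μ)) x (δ x) = ∑ μ, ∑ ν, pd ν (pd μ (P₂ μ ν)) x (δ x) :=
      Finset.sum_comm
    simp only [eulerLagrange, e1, e2, e3, ← Finset.mul_sum, Finset.sum_add_distrib, e4, e5]
    change P₀ x (δ x) - _ + _ = _
    ring
  have eV : variation2 L φ δ x = P₀ x (δ x) + ∑ μ, P₁ μ x (pd μ δ x)
      + ∑ μ, ∑ ν, S μ ν x (pd μ (pd ν δ) x) := by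
    have e1 : variation2 L φ δ x = P₀ x (δ x) + ∑ μ, P₁ μ x (pd μ δ x)
        + ∑ μ, ∑ ν, P₂ μ ν x (pd μ (pd ν δ) x) := by
      rw [variation2, jet2_decomp (jet2 δ x)]
      simp only [map_add, map_sum]
      rfl
    have e2 : ∀ μ ν, S μ ν x (pd μ (pd ν δ) x)
        = (1 / 2) * (P₂ μ ν x (pd μ (pd ν δ) x) + P₂ ν μ x (pd ν (pd μ δ) x)) := by
      intro μ ν
      rw [pd_comm hδ ν μ]
      rfl
    have e3 : ∑ μ, ∑ ν, P₂ ν μ x (pd ν (pd μ δ) x) = ∑ μ, ∑ ν, P₂ μ ν x (pd μ (pd ν δ) x) :=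
      Finset.sum_comm
    rw [e1]
    simp only [e2, ← Finset.mul_sum, Finset.sum_add_distrib, e3]
    ring
  have e6 : ∑ μ, ∑ ν, pd μ (S μ ν) x (pd ν δ x) = ∑ μ, ∑ ν, pd ν (S μ ν) x (pd μ δ x) := by
    rw [Finset.sum_comm]
    refine Finset.sum_congr rfl fun μ _ => Finset.sum_congr rfl fun ν _ => ?_
    rw [hSsymm]
  simp only [eS, eM, eSS, eEL, eV]
  simp only [fun μ => pd_clm_apply (hM μ) hδ μ x, eMM]
  simp only [M, sub_apply, sum_apply, smul_apply, smul_eq_mul, Finset.sum_add_distrib,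
    Finset.sum_sub_distrib, ← Finset.mul_sum, e6]
  ring

/-- On shell the time derivative of the Noether charge in a ball is a flux through its boundary. -/
theorem hasDerivAt_noetherCharge {F : Spacetime → Fin 4 → ℝ} (hφ : ContDiff ℝ ∞ φ)
    (hδ : ContDiff ℝ ∞ δ) (hL : ∀ x, ContDiffAt ℝ ∞ L (jet2 φ x))
    (hF : ∀ μ, ContDiff ℝ ∞ fun x => F x μ)
    (hdiv : ∀ x, variation2 L φ δ x = ∑ μ, pd μ (fun y => F y μ) x)
    (hEL : ∀ x, eulerLagrange L φ (δ x) x = 0) (h00 : ∀ x, partialL2 L φ 0 0 (δ x) x = 0)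
    {r : ℝ} (hr : 0 < r) (t : ℝ) :
    HasDerivAt (noetherCharge L φ δ F r)
      (flux (fun x i => -(F x i.succ - momentum1 L φ i.succ (δ x) x) + ∑ j : Fin 3, pd j.succ
        (fun y => (1 / 2) * (partialL2 L φ i.succ j.succ (δ y) y
          + partialL2 L φ j.succ i.succ (δ y) y)) x) r t) t := by
  obtain ⟨hM, hP, hV⟩ := variation2_eq_eulerLagrange_add hφ hδ hL
  have h := hasDerivAt_charge (f := fun μ x => F x μ - momentum1 L φ μ (δ x) x)
    (s := fun μ ν x => (1 / 2) * (partialL2 L φ μ ν (δ x) x + partialL2 L φ ν μ (δ x) x))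
    (fun μ => (hF μ).sub (hM μ)) (fun μ ν => contDiff_const.mul ((hP μ ν).add (hP ν μ)))
    (fun μ ν => by funext x; rw [add_comm]) (by funext x; simp [h00])
    (fun x => by
      have h1 := hV x
      rw [hdiv, hEL, zero_add] at h1
      simp only [fun μ => pd_fun_sub ((hF μ).differentiable (by simp) x)
        ((hM μ).differentiable (by simp) x) μ, Finset.sum_sub_distrib]
      linarith) hr t
  refine h.congr_of_eventuallyEq (Eventually.of_forall fun t => ?_)
  simp only [noetherCharge]
  congr 1
  refine congrArg (fun V => flux V r t) ?_
  funext x i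
  ring

end noether

/-! ### Rates of decay -/

/-- The filter of events at spatial infinity with `|t| ≤ T`. -/
def spatialInfinity (T : ℝ) : Filter Spacetime := comap radius atTop ⊓ 𝓟 {x | |x 0| ≤ T}

theorem eventually_spatialInfinity {T : ℝ} {P : Spacetime → Prop} :
    (∀ᶠ x in spatialInfinity T, P x) ↔
      ∃ R : ℝ, 0 < R ∧ ∀ x : Spacetime, |x 0| ≤ T → R ≤ radius x → P x := by
  rw [spatialInfinity, eventually_inf_principal, eventually_comap]
  constructor
  · intro h
    obtain ⟨R, hR⟩ := eventually_atTop.mp h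
    exact ⟨max R 1, by positivity, fun x hx hr => hR _ ((le_max_left _ _).trans hr) x rfl hx⟩
  · rintro ⟨R, -, hR⟩
    filter_upwards [eventually_ge_atTop R] with r hr x hx hT
    exact hR x hT (hx ▸ hr)

theorem eventually_le_radius (T R : ℝ) : ∀ᶠ x in spatialInfinity T, R ≤ radius x :=
  eventually_spatialInfinity.mpr ⟨max R 1, by positivity, fun _ _ h => (le_max_left _ _).trans h⟩

section decay

variable {V W G : Type} [NormedAddCommGroup V] [NormedAddCommGroup W] [NormedAddCommGroup G]
  {f f' : Spacetime → V} {p q : ℝ}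

/-- Decay as a statement about filters. -/
theorem decaysLike_iff :
    DecaysLike f p ↔ ∀ T, f =O[spatialInfinity T] fun x => radius x ^ (-p) := by
  refine forall_congr' fun T => ?_
  simp only [Asymptotics.isBigO_iff, eventually_spatialInfinity]
  refine exists_congr fun C => exists_congr fun R => and_congr_right fun hR => ?_
  refine forall_congr' fun x => forall_congr' fun _ => forall_congr' fun hr => ?_
  have h0 : 0 ≤ radius x := hR.le.trans hr
  rw [Real.norm_of_nonneg (Real.rpow_nonneg h0 _), Real.rpow_neg h0, div_eq_mul_inv]

theorem DecaysLike.add (hf : DecaysLike f p) (hf' : DecaysLike f' p) :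
    DecaysLike (fun x => f x + f' x) p :=
  decaysLike_iff.mpr fun T => (decaysLike_iff.mp hf T).add (decaysLike_iff.mp hf' T)

theorem DecaysLike.sub (hf : DecaysLike f p) (hf' : DecaysLike f' p) :
    DecaysLike (fun x => f x - f' x) p :=
  decaysLike_iff.mpr fun T => (decaysLike_iff.mp hf T).sub (decaysLike_iff.mp hf' T)

theorem DecaysLike.neg (hf : DecaysLike f p) : DecaysLike (fun x => -f x) p :=
  decaysLike_iff.mpr fun T => (decaysLike_iff.mp hf T).neg_left

theorem DecaysLike.sum {ι : Type*} {s : Finset ι} {F : ι → Spacetime → V}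
    (h : ∀ i ∈ s, DecaysLike (F i) p) : DecaysLike (fun x => ∑ i ∈ s, F i x) p :=
  decaysLike_iff.mpr fun T => Asymptotics.IsBigO.fun_sum fun i hi => decaysLike_iff.mp (h i hi) T

theorem DecaysLike.of_norm_le {h : Spacetime → W} (hf : DecaysLike f p)
    (hle : ∀ x, ‖h x‖ ≤ ‖f x‖) : DecaysLike h p :=
  decaysLike_iff.mpr fun T => (Asymptotics.isBigO_of_le _ hle).trans (decaysLike_iff.mp hf T)

/-- Rates of decay add under a product of any kind. -/
theorem DecaysLike.of_norm_le_mul {h : Spacetime → W} {k : Spacetime → G}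
    (hf : DecaysLike f p) (hh : DecaysLike h q) (hle : ∀ x, ‖k x‖ ≤ ‖f x‖ * ‖h x‖) :
    DecaysLike k (p + q) := by
  refine decaysLike_iff.mpr fun T => ?_
  have h1 := (decaysLike_iff.mp hf T).norm_left.mul (decaysLike_iff.mp hh T).norm_left
  have h2 : k =O[spatialInfinity T] fun x => ‖f x‖ * ‖h x‖ :=
    Asymptotics.isBigO_of_le _ fun x => by
      rw [Real.norm_of_nonneg (by positivity)]; exact hle x
  refine (h2.trans h1).congr' EventuallyEq.rfl ?_
  filter_upwards [eventually_le_radius T 1] with x hx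
  rw [← Real.rpow_add (by linarith)]
  ring_nf

theorem DecaysLike.mul {h k : Spacetime → ℝ} (hh : DecaysLike h p) (hk : DecaysLike k q) :
    DecaysLike (fun x => h x * k x) (p + q) :=
  hh.of_norm_le_mul hk fun _ => norm_mul_le _ _

theorem DecaysLike.smul [NormedSpace ℝ V] {h : Spacetime → ℝ} (hh : DecaysLike h p)
    (hf : DecaysLike f q) : DecaysLike (fun x => h x • f x) (p + q) :=
  hh.of_norm_le_mul hf fun _ => norm_smul_le _ _

theorem DecaysLike.clm_apply [NormedSpace ℝ V] [NormedSpace ℝ W] {A : Spacetime → V →L[ℝ] W}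
    (hA : DecaysLike A p) (hf : DecaysLike f q) : DecaysLike (fun x => A x (f x)) (p + q) :=
  hA.of_norm_le_mul hf fun x => (A x).le_opNorm (f x)

theorem decaysLike_const (v : V) : DecaysLike (fun _ => v) 0 :=
  decaysLike_iff.mpr fun T => by
    simpa using Asymptotics.isBigO_const_const v (one_ne_zero : (1 : ℝ) ≠ 0) _

theorem DecaysLike.const_mul {h : Spacetime → ℝ} (hh : DecaysLike h p) (c : ℝ) :
    DecaysLike (fun x => c * h x) p := by
  simpa using (decaysLike_const c).mul hh

theorem decaysLike_zero : DecaysLike (fun _ => (0 : V)) p :=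
  decaysLike_iff.mpr fun _ => Asymptotics.isBigO_zero _ _

theorem decaysLike_pi {n : Type} [Fintype n] {F : Spacetime → n → V}
    (h : ∀ i, DecaysLike (fun x => F x i) p) : DecaysLike F p :=
  decaysLike_iff.mpr fun T => Asymptotics.isBigO_pi.mpr fun i => decaysLike_iff.mp (h i) T

theorem DecaysLike.coord {n : Type} [Fintype n] {F : Spacetime → n → V} (h : DecaysLike F p)
    (i : n) : DecaysLike (fun x => F x i) p :=
  h.of_norm_le fun x => norm_le_pi_norm (F x) i

theorem DecaysLike.prodMk {h : Spacetime → W} (hf : DecaysLike f p) (hh : DecaysLike h p) :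
    DecaysLike (fun x => (f x, h x)) p :=
  decaysLike_iff.mpr fun T => (decaysLike_iff.mp hf T).prod_left (decaysLike_iff.mp hh T)

theorem DecaysLike.tendsto_zero (hf : DecaysLike f p) (hp : 0 < p) (T : ℝ) :
    Tendsto f (spatialInfinity T) (𝓝 0) := by
  refine (decaysLike_iff.mp hf T).trans_tendsto ?_
  exact (tendsto_rpow_neg_atTop hp).comp (tendsto_comap.mono_left inf_le_left)

theorem DecaysLike.tendsto {v : V} (hf : DecaysLike (fun x => f x - v) p) (hp : 0 < p) (T : ℝ) :
    Tendsto f (spatialInfinity T) (𝓝 v) := by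
  simpa using (hf.tendsto_zero hp T).add_const v

/-- A function of a field that tends to a constant is bounded at infinity. -/
theorem DecaysLike.comp_bounded {v : V} {F : V → W} (hf : DecaysLike (fun x => f x - v) p)
    (hp : 0 < p) (hF : ContinuousAt F v) : DecaysLike (fun x => F (f x)) 0 := by
  refine decaysLike_iff.mpr fun T => ?_
  have := (hF.tendsto.comp (hf.tendsto hp T)).isBigO_one ℝ
  simpa using this

/-- If `F` vanishes along `f'` and `f - f'` decays, then so does `F` along `f`. -/
theorem DecaysLike.comp_sub [NormedSpace ℝ V] [NormedSpace ℝ W] {v : V} {F : V → W} {s : ℝ}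
    (hf : DecaysLike (fun x => f x - v) p) (hf' : DecaysLike (fun x => f' x - v) q) (hp : 0 < p)
    (hq : 0 < q) (hs : DecaysLike (fun x => f x - f' x) s) (hF : ContDiffAt ℝ ∞ F v)
    (h0 : ∀ x, F (f' x) = 0) : DecaysLike (fun x => F (f x)) s := by
  refine decaysLike_iff.mpr fun T => ?_
  have h1 := (hF.hasStrictFDerivAt (by simp)).isBigO_sub
  have h2 : Tendsto (fun x => (f x, f' x)) (spatialInfinity T) (𝓝 (v, v)) := by
    rw [nhds_prod_eq]; exact (hf.tendsto hp T).prodMk (hf'.tendsto hq T)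
  have h3 := (h1.comp_tendsto h2).trans (decaysLike_iff.mp hs T)
  refine h3.congr_left fun x => ?_
  simp [h0]

/-- A function that vanishes at the limit of a field decays like the field. -/
theorem DecaysLike.comp_zero [NormedSpace ℝ V] [NormedSpace ℝ W] {v : V} {F : V → W}
    (hf : DecaysLike (fun x => f x - v) p) (hp : 0 < p) (hF : ContDiffAt ℝ ∞ F v)
    (h0 : F v = 0) : DecaysLike (fun x => F (f x)) p :=
  hf.comp_sub (f' := fun _ => v) (q := 1) (by simpa using decaysLike_zero) hp one_pos hf hF
    fun _ => h0

theorem DecaysLike.pd [NormedSpace ℝ V] (h : DecaysLike (fderiv ℝ f) p) (μ : Fin 4) :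
    DecaysLike (TraceK.pd μ f) p := by
  have := h.clm_apply (decaysLike_const (Pi.single μ 1))
  rwa [add_zero] at this

theorem decaysLike_iteratedFDeriv_one [NormedSpace ℝ V] (h : DecaysLike (iteratedFDeriv ℝ 1 f) p) :
    DecaysLike (fderiv ℝ f) p :=
  h.of_norm_le fun x => by
    rw [← norm_iteratedFDeriv_fderiv (n := 0), norm_iteratedFDeriv_zero]

theorem decaysLike_iteratedFDeriv_two [NormedSpace ℝ V] (h : DecaysLike (iteratedFDeriv ℝ 2 f) p) :
    DecaysLike (fderiv ℝ (fderiv ℝ f)) p :=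
  h.of_norm_le fun x => by
    rw [← norm_iteratedFDeriv_fderiv (n := 1), ← norm_iteratedFDeriv_fderiv (n := 0),
      norm_iteratedFDeriv_zero]

theorem DecaysLike.pd_pd [NormedSpace ℝ V] (h : DecaysLike (iteratedFDeriv ℝ 2 f) p)
    (hf : ContDiff ℝ ∞ f) (μ ν : Fin 4) : DecaysLike (TraceK.pd μ (TraceK.pd ν f)) p := by
  have e : TraceK.pd μ (TraceK.pd ν f)
      = fun x => fderiv ℝ (fderiv ℝ f) x (Pi.single μ 1) (Pi.single ν 1) := by
    funext x
    have hd : DifferentiableAt ℝ (fderiv ℝ f) x :=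
      (hf.fderiv_right (m := ∞) (by simp)).differentiable (by simp) x
    have h1 := hd.hasFDerivAt.clm_apply (hasFDerivAt_const (Pi.single ν 1 : Spacetime) x)
    change fderiv ℝ (fun y => fderiv ℝ f y (Pi.single ν 1)) x (Pi.single μ 1) = _
    rw [h1.fderiv]
    simp
  rw [e]
  simpa using ((decaysLike_iteratedFDeriv_two h).clm_apply
    (decaysLike_const (Pi.single μ 1))).clm_apply (decaysLike_const (Pi.single ν 1))

end decay

/-- Coordinates grow at most linearly. -/
theorem decaysLike_coordinate (μ : Fin 4) : DecaysLike (fun x : Spacetime => x μ) (-1) := by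
  refine Fin.cases ?_ (fun i => ?_) μ
  · intro T
    refine ⟨T, 1, one_pos, fun x hx hr => ?_⟩
    have h0 : 0 ≤ T := (abs_nonneg _).trans hx
    rw [Real.rpow_neg_one, div_inv_eq_mul, Real.norm_eq_abs]
    exact hx.trans (le_mul_of_one_le_right h0 hr)
  · intro T
    refine ⟨1, 1, one_pos, fun x hx hr => ?_⟩
    rw [Real.rpow_neg_one, div_inv_eq_mul, Real.norm_eq_abs, one_mul, radius]
    refine Real.abs_le_sqrt ?_
    exact Finset.single_le_sum (f := fun i : Fin 3 => x i.succ ^ 2) (fun j _ => sq_nonneg _)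
      (Finset.mem_univ i)

theorem decaysLike_affineField (w : Fin 4 → Fin 4 → ℝ) (a : Fin 4 → ℝ) :
    DecaysLike (affineField w a) (-1) := by
  refine decaysLike_pi fun μ => ?_
  have h := DecaysLike.add (p := -1)
    (DecaysLike.sum fun ν (_ : ν ∈ Finset.univ) => (decaysLike_coordinate ν).const_mul (w μ ν))
    ((decaysLike_const (a μ)).mono (by norm_num))
  exact h

/-! ### The Minkowski metric -/

theorem inv_eta : inv eta = eta := by
  have h : Matrix.of eta * Matrix.of eta = 1 := by
    rw [of_eta, Matrix.diagonal_mul_diagonal, ← Matrix.diagonal_one]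
    congr 1
    funext i
    simp only [xi]; split_ifs <;> norm_num
  funext μ ν
  rw [inv, Matrix.inv_eq_right_inv h]
  rfl

theorem adm_eta : Adm eta where
  symm μ ν := by
    simp only [eta, eq_comm (a := μ)]
    split_ifs with h
    · rw [h]
    · rfl
  det_ne h := by
    rw [of_eta, Matrix.det_diagonal, Fin.prod_univ_four] at h
    simp [xi, Fin.reduceEq] at h
  time := by rw [inv_eta]; simp [eta, xi]
  space i := by rw [inv_eta]; simp [eta, xi, Fin.succ_ne_zero]
  minor i j hij := by rw [inv_eta]; simp [eta, xi, Fin.succ_ne_zero, hij]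

/-- The angles and the off-diagonal inverse metric vanish at the Minkowski metric. -/
theorem currentCoeff_eta (μ ν : Fin 4) : currentCoeff μ ν eta = 0 := by
  by_cases h : μ = ν
  · simp [currentCoeff, h]
  · have h1 : inv eta μ ν = 0 := by rw [inv_eta]; simp [eta, h]
    have h2 : angle μ ν eta = 0 := by simp [angle, qProd, h1]
    simp [currentCoeff, h, h1, h2]

/-! ### The gamma-gamma Lagrangian is quadratic in first derivatives -/

theorem christoffel_zero (ρ μ ν : Fin 4) (u : Tensor2) : christoffel ρ μ ν (u, 0) = 0 := by
  simp [christoffel]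

/-- The gamma-gamma Lagrangian has no terms of order one in the first derivatives. -/
theorem Adm.fderiv_lagGamma_zero {u : Tensor2} (h : Adm u) (d : Jet1 Tensor2) :
    fderiv ℝ lagGamma (u, 0) d = 0 := by
  rw [Adm.fderiv_lagGamma (j := (u, 0)) h]
  simp [christoffel_zero, gammaForm, gammaFormDeriv]

/-! ### Functional derivatives of the trace K Lagrangian -/

theorem Adm.contDiffAt_reducedLag {j : Jet2 Tensor2} (h : Adm j.1) :
    ContDiffAt ℝ ∞ reducedLag j := by
  have h' : Adm (j.1, j.2.1).1 := h
  refine (contDiffAt_comp_jet1 h'.contDiffAt_lagGamma).add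
    (ContDiffAt.sum fun μ _ => ContDiffAt.sum fun ν _ => ContDiffAt.add ?_ ?_)
  · have h1 : ContDiffAt ℝ ∞ (fun k : Jet2 Tensor2 => fderiv ℝ (currentCoeff μ ν) k.1) j :=
      ((h.contDiffAt_currentCoeff μ ν).fderiv_right (by simp)).comp j contDiffAt_fst
    exact (h1.clm_apply (by fun_prop)).clm_apply (by fun_prop)
  · have h1 : ContDiffAt ℝ ∞ (fun k : Jet2 Tensor2 => currentCoeff μ ν k.1) j :=
      (h.contDiffAt_currentCoeff μ ν).comp j contDiffAt_fst
    exact h1.clm_apply (by fun_prop)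

theorem isSym_zero : IsSym 0 := fun _ _ => rfl

theorem isSym_single {e : Tensor2} (he : IsSym e) (μ ν : Fin 4) :
    IsSym ((Pi.single μ e : Fin 4 → Tensor2) ν) := by
  rcases eq_or_ne ν μ with rfl | h
  · rwa [Pi.single_eq_same]
  · rw [Pi.single_eq_of_ne h]; exact isSym_zero

section metric

variable {g : Spacetime → Tensor2}

theorem fderiv_lagK_eq (hg : IsAdmissibleMetric g) (x : Spacetime) {v : Jet2 Tensor2}
    (hv : SymJet2 v) : fderiv ℝ lagK (jet2 g x) v = fderiv ℝ reducedLag (jet2 g x) v :=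
  (hg.adm_jet2 x).fderiv_congr_symJet2 (symJet2_jet2 hg.smooth hg.symm x) hv
    (hg.adm_jet2 x).contDiffAt_lagK (hg.adm_jet2 x).contDiffAt_reducedLag
    fun _ hi hi' => hi.lagK_eq_reducedLag hi'

/-- The coefficient of second derivatives. It vanishes for `μ = ν = 0`, so that no second time
derivatives occur. -/
theorem partialL2_lagK (hg : IsAdmissibleMetric g) (μ ν : Fin 4) {e : Tensor2} (he : IsSym e)
    (x : Spacetime) : partialL2 lagK g μ ν e x = currentCoeff μ ν (g x) e := by
  have hv : SymJet2 ((0, 0, Pi.single μ (Pi.single ν e)) : Jet2 Tensor2) :=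
    ⟨isSym_zero, fun _ => isSym_zero, fun k l => by
      rcases eq_or_ne k μ with rfl | h
      · simpa using isSym_single he ν l
      · simpa [Pi.single_eq_of_ne h] using isSym_zero⟩
  rw [partialL2, fderiv_lagK_eq hg x hv]
  refine fderiv_eq_of_hasDerivAt_line
    ((hg.adm_jet2 x).contDiffAt_reducedLag.differentiableAt (by simp)) ?_
  have e1 : ∀ s : ℝ, reducedLag (jet2 g x + s • (0, 0, Pi.single μ (Pi.single ν e)))
      = reducedLag (jet2 g x) + s * currentCoeff μ ν (g x) e := by
    intro s
    have e2 : ∑ a, ∑ b, currentCoeff a b (g x)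
        ((Pi.single μ (Pi.single ν e) : Fin 4 → Fin 4 → Tensor2) a b)
          = currentCoeff μ ν (g x) e := by
      rw [Finset.sum_eq_single μ (fun a _ ha => by simp [Pi.single_eq_of_ne ha]) (by simp),
        Finset.sum_eq_single ν (fun a _ ha => by simp [Pi.single_eq_of_ne ha]) (by simp)]
      simp
    simp only [reducedLag, Prod.fst_add, Prod.snd_add, Prod.smul_fst, Prod.smul_snd, smul_zero,
      add_zero, Pi.add_apply, Pi.smul_apply, map_add, map_smul, smul_eq_mul,
      Finset.sum_add_distrib, ← Finset.mul_sum]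
    rw [← e2]
    simp only [jet2, Pi.zero_apply, map_zero, add_zero, Finset.sum_const_zero]
    ring
  simp only [e1]
  simpa using ((hasDerivAt_id (0 : ℝ)).mul_const (currentCoeff μ ν (g x) e)).const_add
    (reducedLag (jet2 g x))

theorem partialL1_lagK (hg : IsAdmissibleMetric g) (μ : Fin 4) {e : Tensor2} (he : IsSym e)
    (x : Spacetime) : partialL1 lagK g μ e x = fderiv ℝ lagGamma (jet1 g x) (0, Pi.single μ e)
      + ∑ ν, (fderiv ℝ (currentCoeff μ ν) (g x) e (pd ν g x)
        + fderiv ℝ (currentCoeff ν μ) (g x) (pd ν g x) e) := by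
  have hv : SymJet2 ((0, Pi.single μ e, 0) : Jet2 Tensor2) :=
    ⟨isSym_zero, fun l => isSym_single he μ l, fun _ _ => isSym_zero⟩
  rw [partialL1, fderiv_lagK_eq hg x hv]
  refine fderiv_eq_of_hasDerivAt_line
    ((hg.adm_jet2 x).contDiffAt_reducedLag.differentiableAt (by simp)) ?_
  have h1 : HasDerivAt (fun s : ℝ => lagGamma (jet1 g x + s • (0, Pi.single μ e)))
      (fderiv ℝ lagGamma (jet1 g x) (0, Pi.single μ e)) 0 :=
    ((hg.adm_jet1 x).contDiffAt_lagGamma.differentiableAt (by simp)).hasFDerivAt.hasLineDerivAt _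
  let v : Fin 4 → Tensor2 := Pi.single μ e
  have h2 : ∀ a, HasDerivAt (fun s : ℝ => pd a g x + s • v a) (v a) 0 := fun a => by
    simpa using ((hasDerivAt_id (0 : ℝ)).smul_const (v a)).const_add (pd a g x)
  have h3 : ∀ a b, HasDerivAt
      (fun s : ℝ => fderiv ℝ (currentCoeff a b) (g x) (pd a g x + s • v a) (pd b g x + s • v b)
        + currentCoeff a b (g x) (pd a (pd b g) x))
      (fderiv ℝ (currentCoeff a b) (g x) (v a) (pd b g x)
        + fderiv ℝ (currentCoeff a b) (g x) (pd a g x) (v b)) 0 := fun a b => by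
    have := (((fderiv ℝ (currentCoeff a b) (g x)).hasFDerivAt.comp_hasDerivAt 0
      (h2 a)).clm_apply (h2 b)).add_const (currentCoeff a b (g x) (pd a (pd b g) x))
    simpa using this
  have h4 := h1.add (HasDerivAt.fun_sum (u := Finset.univ) fun a _ =>
    HasDerivAt.fun_sum (u := Finset.univ) fun b _ => h3 a b)
  have e1 : ∑ a, ∑ b, (fderiv ℝ (currentCoeff a b) (g x) (v a) (pd b g x)
        + fderiv ℝ (currentCoeff a b) (g x) (pd a g x) (v b))
      = ∑ ν, (fderiv ℝ (currentCoeff μ ν) (g x) e (pd ν g x)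
        + fderiv ℝ (currentCoeff ν μ) (g x) (pd ν g x) e) := by
    simp only [Finset.sum_add_distrib]
    congr 1
    · rw [Finset.sum_eq_single μ (fun a _ ha => by simp [v, Pi.single_eq_of_ne ha]) (by simp)]
      simp [v]
    · refine Finset.sum_congr rfl fun a _ => ?_
      rw [Finset.sum_eq_single μ (fun b _ hb => by simp [v, Pi.single_eq_of_ne hb]) (by simp)]
      simp [v]
  rw [← e1]
  refine h4.congr_of_eventuallyEq (Eventually.of_forall fun s => ?_)
  simp [reducedLag, jet2, jet1, v]

theorem contDiff_currentCoeff (hg : IsAdmissibleMetric g) (μ ν : Fin 4) :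
    ContDiff ℝ ∞ (fun x => currentCoeff μ ν (g x)) :=
  contDiff_comp_field hg.smooth fun x => (hg.adm x).contDiffAt_currentCoeff μ ν

theorem pd_currentCoeff (hg : IsAdmissibleMetric g) (κ μ ν : Fin 4) (x : Spacetime) :
    pd κ (fun x => currentCoeff μ ν (g x)) x = fderiv ℝ (currentCoeff μ ν) (g x) (pd κ g x) :=
  pd_comp (((hg.adm x).contDiffAt_currentCoeff μ ν).differentiableAt (by simp))
    (hg.smooth.differentiable (by simp) x) κ

/-- The momentum `δS/δφ_μ` of the trace K Lagrangian as a linear functional. Second derivatives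
of the metric do not contribute. -/
def momentumField (g : Spacetime → Tensor2) (μ : Fin 4) (x : Spacetime) : Tensor2 →L[ℝ] ℝ :=
  (fderiv ℝ lagGamma (jet1 g x)).comp ((ContinuousLinearMap.inr ℝ Tensor2 (Fin 4 → Tensor2)).comp
      (ContinuousLinearMap.single ℝ (fun _ => Tensor2) μ))
    + ∑ ν, ((fderiv ℝ (currentCoeff μ ν) (g x)).flip (pd ν g x)
      - fderiv ℝ (currentCoeff μ ν) (g x) (pd ν g x))

theorem momentum1_lagK (hg : IsAdmissibleMetric g) (μ : Fin 4) {e : Tensor2} (he : IsSym e)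
    (x : Spacetime) : momentum1 lagK g μ e x = momentumField g μ x e := by
  have hc := contDiff_currentCoeff hg
  have e1 : ∀ ν, pd ν (fun y => partialL2 lagK g μ ν e y + partialL2 lagK g ν μ e y) x
      = fderiv ℝ (currentCoeff μ ν) (g x) (pd ν g x) e
        + fderiv ℝ (currentCoeff ν μ) (g x) (pd ν g x) e := by
    intro ν
    simp only [partialL2_lagK hg _ _ he]
    rw [pd_fun_add (((hc μ ν).clm_apply contDiff_const).differentiable (by simp) x)
      (((hc ν μ).clm_apply contDiff_const).differentiable (by simp) x),
      pd_clm_apply_const (hc μ ν), pd_clm_apply_const (hc ν μ), pd_currentCoeff hg,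
      pd_currentCoeff hg]
  rw [momentum1, partialL1_lagK hg μ he]
  simp only [e1, momentumField, add_apply, sum_apply, sub_apply, ContinuousLinearMap.flip_apply,
    Finset.sum_add_distrib, Finset.sum_sub_distrib]
  simp only [ContinuousLinearMap.comp_apply, ContinuousLinearMap.inr_apply,
    ContinuousLinearMap.single_apply]
  ring

/-! ### Decay of the metric and of its variations -/

theorem IsAsymptoticallyFlat.decaysLike_metric (hflat : IsAsymptoticallyFlat g) :
    DecaysLike (fun x => g x - eta) 1 := by
  have h := hflat 0
  simp only [Nat.cast_zero, zero_add] at h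
  exact h.of_norm_le fun x => by rw [norm_iteratedFDeriv_zero]

theorem IsAsymptoticallyFlat.decaysLike_pd (hflat : IsAsymptoticallyFlat g) (μ : Fin 4) :
    DecaysLike (pd μ g) 2 := by
  have h := (decaysLike_iteratedFDeriv_one (hflat 1)).pd μ
  norm_num at h
  have e : pd μ (fun x => g x - eta) = pd μ g := by
    funext x; simp only [pd, fderiv_sub_const]
  rwa [e] at h

theorem IsAsymptoticallyFlat.decaysLike_pd_pd (hflat : IsAsymptoticallyFlat g)
    (hg : IsAdmissibleMetric g) (μ ν : Fin 4) : DecaysLike (pd μ (pd ν g)) 3 := by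
  have h := (hflat 2).pd_pd (hg.smooth.sub contDiff_const) μ ν
  norm_num at h
  have e : pd ν (fun x => g x - eta) = pd ν g := by
    funext x; simp only [pd, fderiv_sub_const]
  rwa [e] at h

theorem IsAsymptoticallyFlat.decaysLike_comp {W : Type} [NormedAddCommGroup W] [NormedSpace ℝ W]
    {F : Tensor2 → W} (hflat : IsAsymptoticallyFlat g) (hF : ContDiffAt ℝ ∞ F eta) :
    DecaysLike (fun x => F (g x)) 0 :=
  hflat.decaysLike_metric.comp_bounded one_pos hF.continuousAt

theorem IsAsymptoticallyFlat.decaysLike_currentCoeff (hflat : IsAsymptoticallyFlat g)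
    (μ ν : Fin 4) :
    DecaysLike (fun x => currentCoeff μ ν (g x)) 1 :=
  hflat.decaysLike_metric.comp_zero one_pos (adm_eta.contDiffAt_currentCoeff μ ν)
    (currentCoeff_eta μ ν)

theorem IsAsymptoticallyFlat.decaysLike_fderiv_currentCoeff (hflat : IsAsymptoticallyFlat g)
    (μ ν : Fin 4) :
    DecaysLike (fun x => fderiv ℝ (currentCoeff μ ν) (g x)) 0 :=
  hflat.decaysLike_comp ((adm_eta.contDiffAt_currentCoeff μ ν).fderiv_right (by simp))

theorem IsAsymptoticallyFlat.decaysLike_christoffel (hflat : IsAsymptoticallyFlat g)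
    (ρ μ ν : Fin 4) :
    DecaysLike (fun x => christoffel ρ μ ν (jet1 g x)) 2 := by
  have h : ∀ a b c, DecaysLike (fun x => pd a g x b c) 2 := fun a b c =>
    ((hflat.decaysLike_pd a).coord b).coord c
  refine (DecaysLike.sum fun σ _ => ?_).const_mul (1 / 2)
  have := (hflat.decaysLike_comp (adm_eta.contDiffAt_inv ρ σ)).mul
    (((h μ σ ν).add (h ν σ μ)).sub (h σ μ ν))
  rwa [zero_add] at this

theorem IsAsymptoticallyFlat.decaysLike_lagGamma (hflat : IsAsymptoticallyFlat g) :
    DecaysLike (fun x => lagGamma (jet1 g x)) 4 := by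
  have h : ∀ a b c d e f, DecaysLike
      (fun x => christoffel a b c (jet1 g x) * christoffel d e f (jet1 g x)) 4 :=
    fun a b c d e f => by
      have := (hflat.decaysLike_christoffel a b c).mul (hflat.decaysLike_christoffel d e f)
      norm_num at this; exact this
  have h1 : DecaysLike (fun x => ∑ μ, ∑ ν, inv (g x) μ ν * ∑ ρ, ∑ σ,
      (christoffel ρ μ σ (jet1 g x) * christoffel σ ρ ν (jet1 g x)
      - christoffel ρ μ ν (jet1 g x) * christoffel σ ρ σ (jet1 g x))) 4 := by
    refine DecaysLike.sum fun μ _ => DecaysLike.sum fun ν _ => ?_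
    have := (hflat.decaysLike_comp (adm_eta.contDiffAt_inv μ ν)).mul
      (DecaysLike.sum fun ρ (_ : ρ ∈ Finset.univ) => DecaysLike.sum
        fun σ (_ : σ ∈ Finset.univ) => (h ρ μ σ σ ρ ν).sub (h ρ μ ν σ ρ σ))
    rwa [zero_add] at this
  have := (hflat.decaysLike_comp adm_eta.contDiffAt_sqrtDet).mul h1
  rwa [zero_add] at this

/-- Every term of the momentum contains a first derivative of the metric. -/
theorem IsAsymptoticallyFlat.decaysLike_momentumField (hflat : IsAsymptoticallyFlat g)
    (hg : IsAdmissibleMetric g) (μ : Fin 4) : DecaysLike (momentumField g μ) 2 := by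
  have hp : DecaysLike (fun x => (fun μ => pd μ g x : Fin 4 → Tensor2)) 2 :=
    decaysLike_pi hflat.decaysLike_pd
  have a0 : Adm ((eta, 0) : Jet1 Tensor2).1 := adm_eta
  refine DecaysLike.add ?_ (DecaysLike.sum fun ν _ => DecaysLike.sub ?_ ?_)
  · refine DecaysLike.comp_sub (F := fun j : Jet1 Tensor2 => (fderiv ℝ lagGamma j).comp
        ((ContinuousLinearMap.inr ℝ Tensor2 (Fin 4 → Tensor2)).comp
          (ContinuousLinearMap.single ℝ (fun _ => Tensor2) μ)))
      (f := jet1 g) (f' := fun x => (g x, 0)) (v := (eta, 0)) (p := 1) (q := 1) ?_ ?_ one_pos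
      one_pos ?_ ?_ fun x => ?_
    · simpa [jet1] using hflat.decaysLike_metric.prodMk (hp.mono (by norm_num : (1 : ℝ) ≤ 2))
    · simpa using hflat.decaysLike_metric.prodMk (decaysLike_zero (V := Fin 4 → Tensor2))
    · simpa [jet1] using (decaysLike_zero (V := Tensor2)).prodMk hp
    · exact (a0.contDiffAt_lagGamma.fderiv_right (by simp)).clm_comp contDiffAt_const
    · ext e
      simp [(hg.adm x).fderiv_lagGamma_zero]
  · have := (hflat.decaysLike_fderiv_currentCoeff μ ν).of_norm_le_mul (hflat.decaysLike_pd ν)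
      (k := fun x => (fderiv ℝ (currentCoeff μ ν) (g x)).flip (pd ν g x))
      fun x => by
        have := ((fderiv ℝ (currentCoeff μ ν) (g x)).flip).le_opNorm (pd ν g x)
        rwa [ContinuousLinearMap.opNorm_flip] at this
    rwa [zero_add] at this
  · simpa using (hflat.decaysLike_fderiv_currentCoeff μ ν).clm_apply (hflat.decaysLike_pd ν)

section variation

variable {δ : Spacetime → Tensor2} {q : ℝ}

theorem IsAsymptoticallyFlat.decaysLike_momentum1 (hflat : IsAsymptoticallyFlat g)
    (hg : IsAdmissibleMetric g) (hδs : ∀ x, IsSym (δ x)) (hδ : DecaysLike δ q) (μ : Fin 4) :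
    DecaysLike (fun x => momentum1 lagK g μ (δ x) x) (2 + q) := by
  simp only [momentum1_lagK hg μ (hδs _)]
  exact (hflat.decaysLike_momentumField hg μ).clm_apply hδ

theorem IsAsymptoticallyFlat.decaysLike_partialL2 (hflat : IsAsymptoticallyFlat g)
    (hg : IsAdmissibleMetric g) (hδs : ∀ x, IsSym (δ x)) (hδ : DecaysLike δ q) (μ ν : Fin 4) :
    DecaysLike (fun x => partialL2 lagK g μ ν (δ x) x) (1 + q) := by
  simp only [partialL2_lagK hg μ ν (hδs _)]
  exact (hflat.decaysLike_currentCoeff μ ν).clm_apply hδ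

theorem IsAsymptoticallyFlat.decaysLike_pd_partialL2 (hflat : IsAsymptoticallyFlat g)
    (hg : IsAdmissibleMetric g) (hδ : ContDiff ℝ ∞ δ) (hδs : ∀ x, IsSym (δ x))
    (hδ0 : DecaysLike δ 1) (hδ1 : ∀ κ, DecaysLike (pd κ δ) 2) (κ μ ν : Fin 4) :
    DecaysLike (pd κ fun x => partialL2 lagK g μ ν (δ x) x) 3 := by
  have e : pd κ (fun x => partialL2 lagK g μ ν (δ x) x)
      = fun x => fderiv ℝ (currentCoeff μ ν) (g x) (pd κ g x) (δ x)
        + currentCoeff μ ν (g x) (pd κ δ x) := by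
    simp only [partialL2_lagK hg μ ν (hδs _)]
    funext x
    rw [pd_clm_apply (contDiff_currentCoeff hg μ ν) hδ, pd_currentCoeff hg]
  rw [e]
  have h1 := ((hflat.decaysLike_fderiv_currentCoeff μ ν).clm_apply
    (hflat.decaysLike_pd κ)).clm_apply hδ0
  have h2 := (hflat.decaysLike_currentCoeff μ ν).clm_apply (hδ1 κ)
  norm_num at h1 h2
  exact h1.add h2

/-- On shell, the Noether charge of a symmetry of the trace K Lagrangian is conserved if the
variation of the metric falls off like `1/r` and the current faster than `1/r²`. -/
theorem conservedAtInfinity_noetherCharge (hflat : IsAsymptoticallyFlat g)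
    (hg : IsAdmissibleMetric g) {F : Spacetime → Fin 4 → ℝ} {p : ℝ} (hδ : ContDiff ℝ ∞ δ)
    (hδs : ∀ x, IsSym (δ x)) (hδ0 : DecaysLike δ 1) (hδ1 : ∀ κ, DecaysLike (pd κ δ) 2)
    (hF : ∀ μ, ContDiff ℝ ∞ fun x => F x μ)
    (hdiv : ∀ x, variation2 lagK g δ x = ∑ μ, pd μ (fun y => F y μ) x)
    (hp : 2 < p) (hFp : ∀ i : Fin 3, DecaysLike (fun x => F x i.succ) p) (hshell : OnShell lagK g) :
    ConservedAtInfinity (noetherCharge lagK g δ F) := by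
  have hL : ∀ x, ContDiffAt ℝ ∞ lagK (jet2 g x) := fun x => (hg.adm_jet2 x).contDiffAt_lagK
  refine conservedAtInfinity_of_flux (p := min p 3) (lt_min hp (by norm_num)) ?_
    fun r hr t => hasDerivAt_noetherCharge hg.smooth hδ hL hF hdiv
      (fun x => hshell x (δ x) (hδs x)) (fun x => ?_) hr t
  · intro i
    have h1 := hflat.decaysLike_momentum1 hg hδs hδ0 i.succ
    norm_num at h1
    refine (((hFp i).mono (min_le_left _ _)).sub (h1.mono (min_le_right _ _))).neg.add
      (DecaysLike.sum fun j _ => ?_)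
    have hP : ∀ a b, ContDiff ℝ ∞ fun x => partialL2 lagK g a b (δ x) x :=
      (variation2_eq_eulerLagrange_add hg.smooth hδ hL).2.1
    have e : pd j.succ (fun y => (1 / 2) *
          (partialL2 lagK g i.succ j.succ (δ y) y
            + partialL2 lagK g j.succ i.succ (δ y) y))
        = fun x => (1 / 2) *
          (pd j.succ (fun y => partialL2 lagK g i.succ j.succ (δ y) y) x
            + pd j.succ (fun y => partialL2 lagK g j.succ i.succ (δ y) y) x) := by
      funext x
      rw [pd_fun_mul (differentiableAt_const _)
        (((hP _ _).add (hP _ _)).differentiable (by simp) x),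
        pd_fun_add ((hP _ _).differentiable (by simp) x) ((hP _ _).differentiable (by simp) x)]
      simp [pd]
    rw [e]
    exact (((hflat.decaysLike_pd_partialL2 hg hδ hδs hδ0 hδ1 _ _ _).add
      (hflat.decaysLike_pd_partialL2 hg hδ hδs hδ0 hδ1 _ _ _)).const_mul _).mono (min_le_right _ _)
  · rw [partialL2_lagK hg _ _ (hδs x), currentCoeff_self]
    simp

end variation

end metric

/-! ### Asymptotic Poincaré transformations -/

theorem pd_affineField (w : Fin 4 → Fin 4 → ℝ) (a : Fin 4 → ℝ) (ν : Fin 4) (x : Spacetime) :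
    DifferentiableAt ℝ (affineField w a) x ∧ pd ν (affineField w a) x = fun μ => w μ ν := by
  let A : Spacetime →L[ℝ] (Fin 4 → ℝ) :=
    LinearMap.toContinuousLinearMap (Matrix.toLin' (Matrix.of w))
  have e : affineField w a = fun x => A x + a := by
    funext x μ
    simp [affineField, A, Matrix.mulVec, dotProduct]
  have h : HasFDerivAt (affineField w a) A x := by
    rw [e]; exact A.hasFDerivAt.add_const a
  refine ⟨h.differentiableAt, ?_⟩
  rw [pd, h.fderiv]
  funext μ
  simp [A]

theorem DecaysLike.glTensor {A : Spacetime → Fin 4 → Fin 4 → ℝ} {u : Spacetime → Tensor2} {p q : ℝ}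
    (hA : ∀ ρ ν, DecaysLike (fun x => A x ρ ν) p) (hu : DecaysLike u q) :
    DecaysLike (fun x => glTensor (A x) (u x)) (q + p) :=
  decaysLike_pi fun μ => decaysLike_pi fun ν => DecaysLike.sum fun ρ _ =>
    (((hu.coord μ).coord ρ).mul (hA ρ ν)).add (((hu.coord ρ).coord ν).mul (hA ρ μ))

variable {ε : Spacetime → Fin 4 → ℝ} {g : Spacetime → Tensor2}

theorem IsAsymptoticallyPoincare.decaysLike_self (hε : IsAsymptoticallyPoincare ε) :
    DecaysLike ε (-1) := by
  obtain ⟨w, a, -, h0, -⟩ := hε.lowOrder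
  simpa using (h0.mono (by norm_num : (-1 : ℝ) ≤ 1)).add (decaysLike_affineField w a)

theorem decaysLike_pd_sub {w : Fin 4 → Fin 4 → ℝ} {a : Fin 4 → ℝ} (hε : ContDiff ℝ ∞ ε)
    (h1 : DecaysLike (fderiv ℝ (fun x => ε x - affineField w a x)) 2) (ρ ν : Fin 4) :
    DecaysLike (fun x => pd ν ε x ρ - w ρ ν) 2 := by
  have h2 := (h1.pd ν).coord ρ
  have e : (fun x => pd ν (fun x => ε x - affineField w a x) x ρ)
      = fun x => pd ν ε x ρ - w ρ ν := by
    funext x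
    have h3 := pd_affineField w a ν x
    have h4 : pd ν (fun x => ε x - affineField w a x) x
        = pd ν ε x - pd ν (affineField w a) x := by
      simp only [pd]
      rw [fderiv_fun_sub (hε.differentiable (by simp) x) h3.1]
      rfl
    rw [h4, h3.2]
    rfl
  rwa [e] at h2

theorem IsAsymptoticallyPoincare.decaysLike_pd (hε : IsAsymptoticallyPoincare ε) (ρ ν : Fin 4) :
    DecaysLike (fun x => pd ν ε x ρ) 0 := by
  obtain ⟨w, a, -, -, h1⟩ := hε.lowOrder
  simpa using ((decaysLike_pd_sub hε.smooth h1 ρ ν).mono (by norm_num : (0 : ℝ) ≤ 2)).add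
    (decaysLike_const (w ρ ν))

theorem IsAsymptoticallyPoincare.exists_decaysLike_pd_pd (hε : IsAsymptoticallyPoincare ε) :
    ∃ p : ℝ, 2 < p ∧ ∀ μ ν ρ, DecaysLike (fun x => pd μ (pd ν ε) x ρ) p := by
  obtain ⟨α, hα, h⟩ := hε.highOrder 2 le_rfl
  exact ⟨2 + α, by linarith, fun μ ν ρ => by
    have := (h.pd_pd hε.smooth μ ν).coord ρ
    norm_num at this
    exact this⟩

/-- Asymptotic Poincaré transformations change the metric by `O(1/r)`: the growing part of `ε`
multiplies derivatives of the metric, and its constant derivatives preserve the Minkowski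
metric. -/
theorem IsAsymptoticallyPoincare.decaysLike_deltaD (hε : IsAsymptoticallyPoincare ε)
    (hflat : IsAsymptoticallyFlat g) : DecaysLike (deltaD ε g) 1 := by
  obtain ⟨w, a, hw, -, h1⟩ := hε.lowOrder
  refine decaysLike_pi fun μ => decaysLike_pi fun ν => ?_
  have hd := decaysLike_pd_sub hε.smooth h1
  have hm : ∀ a b, DecaysLike (fun x => g x a b - eta a b) 1 := fun a b =>
    (hflat.decaysLike_metric.coord a).coord b
  have e : (fun x => deltaD ε g x μ ν) = fun x => ∑ ρ, (ε x ρ * pd ρ g x μ ν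
      + ((g x μ ρ - eta μ ρ) * pd ν ε x ρ + eta μ ρ * (pd ν ε x ρ - w ρ ν))
      + ((g x ρ ν - eta ρ ν) * pd μ ε x ρ + eta ρ ν * (pd μ ε x ρ - w ρ μ))) := by
    funext x
    have h2 : ∑ ρ, (eta μ ρ * w ρ ν + eta ρ ν * w ρ μ) = 0 := by
      rw [← hw μ ν]
      exact Finset.sum_congr rfl fun ρ _ => by rw [adm_eta.symm ρ ν]
    rw [← add_zero (∑ ρ, _), ← h2, ← Finset.sum_add_distrib, deltaD]
    exact Finset.sum_congr rfl fun ρ _ => by ring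
  rw [e]
  refine DecaysLike.sum fun ρ _ => (DecaysLike.add ?_ (DecaysLike.add ?_ ?_)).add
    (DecaysLike.add ?_ ?_)
  · have := (hε.decaysLike_self.coord ρ).mul (((hflat.decaysLike_pd ρ).coord μ).coord ν)
    norm_num at this
    exact this
  · simpa using (hm μ ρ).mul (hε.decaysLike_pd ρ ν)
  · exact ((hd ρ ν).const_mul _).mono (by norm_num)
  · simpa using (hm ρ ν).mul (hε.decaysLike_pd ρ μ)
  · exact ((hd ρ μ).const_mul _).mono (by norm_num)

theorem IsAsymptoticallyPoincare.decaysLike_pd_deltaD (hε : IsAsymptoticallyPoincare ε)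
    (hflat : IsAsymptoticallyFlat g) (hg : IsAdmissibleMetric g) (κ : Fin 4) :
    DecaysLike (pd κ (deltaD ε g)) 2 := by
  have e : pd κ (deltaD ε g) = fun x => (∑ ρ, ε x ρ • pd κ (pd ρ g) x)
      + (glTensor (fun ρ ν => pd ν ε x ρ) (pd κ g x) + ∑ ρ, pd κ ε x ρ • pd ρ g x)
      + glTensor (fun ρ ν => pd κ (pd ν ε) x ρ) (g x) := by
    funext x
    have := congrFun (congrArg Prod.snd (jet1_deltaD hε.smooth hg.smooth x)) κ
    simp only [jet1, glJet, hessJet, Prod.snd_add, Prod.snd_sum, Prod.smul_snd, Pi.add_apply,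
      Finset.sum_apply, Pi.smul_apply] at this
    exact this
  rw [e]
  obtain ⟨p, hp, h2⟩ := hε.exists_decaysLike_pd_pd
  refine ((DecaysLike.sum fun ρ _ => ?_).add (DecaysLike.add ?_ (DecaysLike.sum fun ρ _ => ?_))).add
    ?_
  · have := (hε.decaysLike_self.coord ρ).smul (hflat.decaysLike_pd_pd hg κ ρ)
    norm_num at this
    exact this
  · simpa using DecaysLike.glTensor hε.decaysLike_pd (hflat.decaysLike_pd κ)
  · simpa using (hε.decaysLike_pd ρ κ).smul (hflat.decaysLike_pd ρ)
  · have hb : DecaysLike g 0 := hflat.decaysLike_comp (F := id) contDiffAt_id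
    have := DecaysLike.glTensor (fun ρ ν => h2 κ ν ρ) hb
    exact this.mono (by linarith)

theorem variation1_boundaryCurrent (hg : IsAdmissibleMetric g) {δ : Spacetime → Tensor2}
    (hδ : ContDiff ℝ ∞ δ) (hδs : ∀ x, IsSym (δ x)) (μ : Fin 4) (x : Spacetime) :
    variation1 (boundaryCurrent μ) g δ x = ∑ ν, (fderiv ℝ (currentCoeff μ ν) (g x) (δ x) (pd ν g x)
      + currentCoeff μ ν (g x) (pd ν δ x)) := by
  have ha := hg.adm_jet1 x
  have e : variation1 (boundaryCurrent μ) g δ x = fderiv ℝ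
      (fun k : Jet1 Tensor2 => ∑ ν, currentCoeff μ ν k.1 (k.2 ν)) (jet1 g x) (jet1 δ x) :=
    ha.fderiv_congr_symJet1 (symJet1_jet1 hg.smooth hg.symm x) (symJet1_jet1 hδ hδs x)
      (ha.contDiffAt_boundaryCurrent μ) (ha.contDiffAt_linearCurrent μ)
      fun i hi hi' => hi.boundaryCurrent_eq hi' μ
  rw [e, ha.fderiv_linearCurrent]
  rfl

/-- The current of an asymptotic Poincaré transformation falls off faster than `1/r²`. -/
theorem IsAsymptoticallyPoincare.exists_decaysLike_noetherF (hε : IsAsymptoticallyPoincare ε)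
    (hflat : IsAsymptoticallyFlat g) (hg : IsAdmissibleMetric g) :
    ∃ p : ℝ, 2 < p ∧ ∀ μ, DecaysLike (fun x => noetherF ε g x μ) p := by
  obtain ⟨p, hp, h2⟩ := hε.exists_decaysLike_pd_pd
  refine ⟨min p 3, lt_min hp (by norm_num), fun μ => ?_⟩
  have hδ := contDiff_deltaD hε.smooth hg.smooth
  have hδs := isSym_deltaD (ε := ε) hg.smooth hg.symm
  simp only [noetherF_eq hg, gammaCurrent, variation1_boundaryCurrent hg hδ hδs]
  have hD : ∀ a b c d e, DecaysLike (fun x => densInv a b (g x) * pd c (pd d ε) x e) p :=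
    fun a b c d e => by
      have := (hflat.decaysLike_comp (adm_eta.contDiffAt_densInv a b)).mul (h2 c d e)
      rwa [zero_add] at this
  refine DecaysLike.add (DecaysLike.add (DecaysLike.sub ?_ ?_) ?_)
    (DecaysLike.sum fun ν _ => DecaysLike.add ?_ ?_)
  · have := (hε.decaysLike_self.coord μ).mul hflat.decaysLike_lagGamma
    norm_num at this
    exact this.mono (min_le_right _ _)
  · exact (DecaysLike.sum fun ν _ => DecaysLike.sum fun σ _ => hD _ _ _ _ _).mono (min_le_left _ _)
  · exact (DecaysLike.sum fun ν _ => DecaysLike.sum fun σ _ => hD _ _ _ _ _).mono (min_le_left _ _)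
  · have := ((hflat.decaysLike_fderiv_currentCoeff μ ν).clm_apply
      (hε.decaysLike_deltaD hflat)).clm_apply (hflat.decaysLike_pd ν)
    norm_num at this
    exact this.mono (min_le_right _ _)
  · have := (hflat.decaysLike_currentCoeff μ ν).clm_apply (hε.decaysLike_pd_deltaD hflat hg ν)
    norm_num at this
    exact this.mono (min_le_right _ _)

/-! ### Translations -/

/-- The trace K Lagrangian is quadratic in first derivatives, up to second derivatives with a
coefficient that vanishes at infinity. -/
theorem IsAsymptoticallyFlat.decaysLike_lagK (hflat : IsAsymptoticallyFlat g)
    (hg : IsAdmissibleMetric g) : DecaysLike (fun x => lagK (jet2 g x)) 4 := by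
  have e : (fun x => lagK (jet2 g x)) = fun x => lagGamma (jet1 g x) + ∑ μ, ∑ ν,
      (fderiv ℝ (currentCoeff μ ν) (g x) (pd μ g x) (pd ν g x)
        + currentCoeff μ ν (g x) (pd μ (pd ν g) x)) :=
    funext fun x => (hg.adm_jet2 x).lagK_eq_reducedLag (symJet2_jet2 hg.smooth hg.symm x)
  rw [e]
  refine hflat.decaysLike_lagGamma.add (DecaysLike.sum fun μ _ => DecaysLike.sum fun ν _ =>
    DecaysLike.add ?_ ?_)
  · have := ((hflat.decaysLike_fderiv_currentCoeff μ ν).clm_apply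
      (hflat.decaysLike_pd μ)).clm_apply (hflat.decaysLike_pd ν)
    norm_num at this
    exact this
  · have := (hflat.decaysLike_currentCoeff μ ν).clm_apply (hflat.decaysLike_pd_pd hg μ ν)
    norm_num at this
    exact this

/-- Integrals over large balls of a function that falls off faster than `1/r³` converge. -/
theorem DecaysLike.exists_tendsto_setIntegral_ball {f : Spacetime → ℝ} {p : ℝ}
    (hf : DecaysLike f p) (hp : 3 < p) (hc : Continuous f) (t : ℝ) :
    ∃ q, Tendsto (fun r => ∫ y in Metric.ball (0 : Space) r, f (pt t y)) atTop (𝓝 q) := by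
  have hcont : Continuous fun y : Space => f (pt t y) :=
    hc.comp (contDiff_pt_right t).continuous
  have hint : Integrable (fun y : Space => f (pt t y)) := by
    obtain ⟨C, R, hR, h⟩ := hf |t|
    obtain ⟨B, hB⟩ := (isCompact_closedBall (0 : Space) (max R 1)).exists_bound_of_continuousOn
      hcont.continuousOn
    have h1 : Integrable fun y : Space => (1 + ‖y‖) ^ (-p) :=
      integrable_one_add_norm (by simpa using hp)
    refine Integrable.mono' (h1.const_mul (max (|C| * 2 ^ p) (|B| * (1 + max R 1) ^ p)))
      hcont.aestronglyMeasurable (Eventually.of_forall fun y => ?_)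
    have hy : 0 < 1 + ‖y‖ := by positivity
    have hpow : 0 < (1 + ‖y‖) ^ p := Real.rpow_pos_of_pos hy p
    rw [Real.rpow_neg hy.le, ← div_eq_mul_inv, le_div_iff₀ hpow]
    rcases le_or_gt (max R 1) ‖y‖ with hr | hr
    · have h1y : 1 ≤ ‖y‖ := (le_max_right _ _).trans hr
      have h2 := h (pt t y) (by simp [pt]) (by rw [radius_pt]; exact (le_max_left _ _).trans hr)
      rw [radius_pt] at h2
      have h3 : (1 + ‖y‖) ^ p ≤ 2 ^ p * ‖y‖ ^ p := by
        rw [← Real.mul_rpow (by norm_num) (norm_nonneg _)]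
        exact Real.rpow_le_rpow hy.le (by linarith) (by linarith)
      have h4 : 0 < ‖y‖ ^ p := Real.rpow_pos_of_pos (by linarith) p
      calc ‖f (pt t y)‖ * (1 + ‖y‖) ^ p ≤ (|C| / ‖y‖ ^ p) * (2 ^ p * ‖y‖ ^ p) :=
            mul_le_mul (h2.trans (by gcongr; exact le_abs_self C)) h3 hpow.le (by positivity)
        _ = |C| * 2 ^ p := by field_simp
        _ ≤ _ := le_max_left _ _
    · have h2 := hB y (by simpa using hr.le)
      calc ‖f (pt t y)‖ * (1 + ‖y‖) ^ p ≤ |B| * (1 + max R 1) ^ p :=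
            mul_le_mul (h2.trans (le_abs_self B))
              (Real.rpow_le_rpow hy.le (by linarith) (by linarith)) hpow.le (abs_nonneg B)
        _ ≤ _ := le_max_right _ _
  refine ⟨∫ y, f (pt t y), ?_⟩
  have h := tendsto_setIntegral_of_monotone (μ := (volume : Measure Space))
    (s := fun r : ℝ => Metric.ball (0 : Space) r) (f := fun y => f (pt t y))
    (fun r => measurableSet_ball) (fun r r' h => Metric.ball_subset_ball h) hint.integrableOn
  have hU : (⋃ r : ℝ, Metric.ball (0 : Space) r) = Set.univ :=
    Set.iUnion_eq_univ_iff.mpr fun y => ⟨‖y‖ + 1, by simp⟩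
  rwa [hU, setIntegral_univ] at h

theorem isAsymptoticallyPoincare_const (a : Fin 4 → ℝ) : IsAsymptoticallyPoincare fun _ => a where
  smooth := contDiff_const
  lowOrder := by
    have e : (fun x => a - affineField (fun _ _ => 0) a x) = fun _ => 0 := by
      funext x μ; simp [affineField]
    refine ⟨fun _ _ => 0, a, by simp, ?_, ?_⟩
    · rw [e]; exact decaysLike_zero
    · rw [e]
      have e' : fderiv ℝ (fun _ : Spacetime => (0 : Fin 4 → ℝ)) = fun _ => 0 := by
        funext x; simp
      rw [e']; exact decaysLike_zero
  highOrder m hm := by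
    refine ⟨1, one_pos, ?_⟩
    rw [iteratedFDeriv_const_of_ne (by omega)]
    exact decaysLike_zero

/-- The charge of a space translation has a limit for infinite radius. -/
theorem exists_tendsto_translationCharge (hflat : IsAsymptoticallyFlat g)
    (hg : IsAdmissibleMetric g) {a : Fin 4 → ℝ} (ha : a 0 = 0) (t : ℝ) :
    ∃ q, Tendsto (fun r => noetherCharge lagK g (deltaD (fun _ => a) g)
      (fun y μ => a μ * lagK (jet2 g y)) r t) atTop (𝓝 q) := by
  set δ := deltaD (fun _ => a) g with hδ_def
  have hδ : ContDiff ℝ ∞ δ := contDiff_deltaD contDiff_const hg.smooth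
  have hδs : ∀ x, IsSym (δ x) := isSym_deltaD hg.smooth hg.symm
  have hL : ∀ x, ContDiffAt ℝ ∞ lagK (jet2 g x) := fun x => (hg.adm_jet2 x).contDiffAt_lagK
  have hδ2 : DecaysLike δ 2 := by
    rw [hδ_def, deltaD_const]
    refine DecaysLike.sum fun ρ _ => ?_
    simpa using (decaysLike_const (a ρ)).smul (hflat.decaysLike_pd ρ)
  have hM := hflat.decaysLike_momentum1 hg hδs hδ2 0
  norm_num at hM
  obtain ⟨q, hq⟩ := hM.exists_tendsto_setIntegral_ball (by norm_num)
    ((variation2_eq_eulerLagrange_add hg.smooth hδ hL).1 0).continuous t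
  have hP : ∀ μ ν, DecaysLike (fun x => partialL2 lagK g μ ν (δ x) x) 3 := fun μ ν => by
    have := hflat.decaysLike_partialL2 hg hδs hδ2 μ ν
    norm_num at this
    exact this
  have hflux := tendsto_flux_zero (V := fun x i => partialL2 lagK g 0 i.succ (δ x) x
    + partialL2 lagK g i.succ 0 (δ x) x) (by norm_num) (fun i => (hP _ _).add (hP _ _)) t
  refine ⟨-q - 0, (hq.neg.sub hflux).congr fun r => ?_⟩
  simp only [noetherCharge, ha, zero_mul, zero_sub, integral_neg]

end

end TraceK

theorem mainTheorem4 (g : Spacetime → Tensor2) (hg : IsAdmissibleMetric g)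
    (hflat : IsAsymptoticallyFlat g) :
    (∀ x, lagK (jet2 g x) = lagGamma (jet1 g x)
      + ∑ μ, pd μ (fun y => -angleTerm μ (jet1 g y) + normalTerm μ (jet1 g y)) x) ∧
    (∀ ε : Spacetime → Fin 4 → ℝ, IsAsymptoticallyPoincare ε →
      (∀ x, variation2 lagK g (deltaD ε g) x = ∑ μ, pd μ (fun y => noetherF ε g y μ) x) ∧
      (∀ t, Tendsto (fun r => flux (spatial (noetherF ε g)) r t) atTop (𝓝 0)) ∧
      (OnShell lagK g →
        ConservedAtInfinity (noetherCharge lagK g (deltaD ε g) (noetherF ε g)))) ∧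
    (∀ a : Fin 4 → ℝ, a 0 = 0 →
      (∀ x, variation2 lagK g (deltaD (fun _ => a) g) x
        = ∑ μ, pd μ (fun y => a μ * lagK (jet2 g y)) x) ∧
      (∀ t, Tendsto
        (fun r => flux (spatial (fun y μ => a μ * lagK (jet2 g y))) r t) atTop (𝓝 0)) ∧
      (OnShell lagK g →
        ConservedAtInfinity
          (noetherCharge lagK g (deltaD (fun _ => a) g) (fun y μ => a μ * lagK (jet2 g y))) ∧
        ∃ p : ℝ, ∀ t, Tendsto
          (fun r => noetherCharge lagK g (deltaD (fun _ => a) g)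
            (fun y μ => a μ * lagK (jet2 g y)) r t) atTop (𝓝 p))) := by
  refine ⟨lagK_jet2_eq hg, fun ε hε => ?_, fun a ha => ?_⟩
  · obtain ⟨p, hp, hF⟩ := hε.exists_decaysLike_noetherF hflat hg
    refine ⟨variation2_lagK_deltaD hg hε.smooth,
      tendsto_flux_zero hp fun i => hF i.succ, fun hshell => ?_⟩
    exact conservedAtInfinity_noetherCharge hflat hg (contDiff_deltaD hε.smooth hg.smooth)
      (isSym_deltaD hg.smooth hg.symm) (hε.decaysLike_deltaD hflat)
      (hε.decaysLike_pd_deltaD hflat hg) (contDiff_noetherF hg hε.smooth)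
      (variation2_lagK_deltaD hg hε.smooth) hp (fun i => hF i.succ) hshell
  · have hε := isAsymptoticallyPoincare_const a
    have hF : ∀ i : Fin 3, DecaysLike (fun x => a i.succ * lagK (jet2 g x)) 4 := fun i =>
      (hflat.decaysLike_lagK hg).const_mul _
    have hp : (2 : ℝ) < 4 := by norm_num
    refine ⟨variation2_lagK_translation hg a, tendsto_flux_zero hp hF, fun hshell => ?_⟩
    have hQ := conservedAtInfinity_noetherCharge hflat hg (contDiff_deltaD hε.smooth hg.smooth)
      (isSym_deltaD hg.smooth hg.symm) (hε.decaysLike_deltaD hflat)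
      (hε.decaysLike_pd_deltaD hflat hg) (F := fun y μ => a μ * lagK (jet2 g y))
      (fun μ => contDiff_const.mul (contDiff_lagK_jet2 hg)) (variation2_lagK_translation hg a) hp
      hF hshell
    obtain ⟨q, hq⟩ := exists_tendsto_translationCharge hflat hg ha 0
    exact ⟨hQ, q, hQ.2.2.2 0 q hq⟩
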